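/- All spaces, algebras and tensor products are over $\mathbb C$; $p(\cdot)\in\mathbb Z/2$ denotes parity, and for a field $a(z)=\sum_{n\in\mathbb Z}a_{(n)}z^{-n-1}$ (with $a_{(n)}v=0$ for $n\gg0$, for every vector $v$) and a field $b(z)$, the $n$-th product is $a_{(n)}b=\mathrm{Res}_x\big(i_{|x|>|z|}(x-z)^n a(x)b(z)-(-1)^{p(a)p(b)}i_{|z|>|x|}(x-z)^n b(z)a(x)\big)$, $n\in\mathbb Z$; $:\!ab\!:\,=a_{(-1)}b$, and $[a_\lambda b]=\sum_{n\ge0}\frac{\lambda^n}{n!}a_{(n)}b$. Let $\mathfrak g$ be a simple finite-dimensional Lie superalgebra with a non-degenerate even supersymmetric invariant bilinear form $(\cdot|\cdot)$, let $x,f\in\mathfrak g$ be even elements such that $\operatorname{ad}x$ is diagonalizable with eigenvalues in $\frac12\mathbb Z$ and $[x,f]=-f$, and let $k\in\mathbb C$. Write $\mathfrak g_j$ for the $j$-eigenspace of $\operatorname{ad}x$ and $\mathfrak g_+=\bigoplus_{j>0}\mathfrak g_j$. Let $V_k(\mathfrak g)$ be the universal affine vertex algebra, generated by the currents $u(z)$,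 $u\in\mathfrak g$, with $[u_\lambda v]=[u,v]+\lambda k(u|v)$. Let $A_{\rm ch}=\Pi\mathfrak g_+\oplus\Pi\mathfrak g_+^*$ ($\Pi$ reverses parity) with the skew-supersymmetric form for which both summands are isotropic and $\langle a,b^*\rangle=b^*(a)$ for $a\in\Pi\mathfrak g_+$, $b^*\in\Pi\mathfrak g_+^*$. Let $A_{\rm ne}=\mathfrak g_{1/2}$ with the form $\langle a,b\rangle=(f|[a,b])$. Let $F(A_{\rm ch})$, $F(A_{\rm ne})$ be the vertex algebras generated by the free superfermions $\varphi(z)$, $\Phi(z)$ based on these superspaces, with $[\varphi_\lambda\psi]=\langle\varphi,\psi\rangle1$. All three are realized on the corresponding vacuum modules. Let $\mathcal C=\mathcal C(\mathfrak g,x,f,k)=V_k(\mathfrak g)\otimes F(A_{\rm ch})\otimes F(A_{\rm ne})$, and let $\mathcal C_m$ be the span of the iterated $n$-th products ($n\in\mathbb Z$) of total charge $m$ of the identity field and the generating fields, where $\varphi(z)$ has charge $1$ for $\varphi\in\Pi\mathfrak g_+$, $\varphi^*(z)$ has charge $-1$ for $\varphi^*\in\Pi\mathfrak g_+^*$, and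 the identity field, the currents and the fields $\Phi(z)$ have charge $0$. Let $\{u_i\}$ be any basis of $\mathfrak g$ consisting of elements homogeneous for parity and for the eigenspace decomposition of $\operatorname{ad}x$; let $S$ (resp. $S'$) be the set of $i$ with $u_i\in\mathfrak g_+$ (resp. $u_i\in\mathfrak g_{1/2}$), let $[u_i,u_j]=\sum_\ell c^\ell_{ij}u_\ell$, and let $\varphi_i,\varphi_i^*$ $(i\in S)$ be the corresponding dual bases of $\Pi\mathfrak g_+$, $\Pi\mathfrak g_+^*$ and $\Phi_i$ $(i\in S')$ the corresponding basis of $A_{\rm ne}$. Put $$d(z)=\sum_{i\in S}(-1)^{p(u_i)}:\!u_i\varphi_i^*\!:\;-\tfrac12\sum_{i,j,\ell\in S}(-1)^{p(u_i)p(u_\ell)}c^\ell_{ij}:\!\varphi_\ell\varphi_i^*\varphi_j^*\!:\;+\sum_{i\in S}(f|u_i)\varphi_i^*+\sum_{i\in S'}:\!\varphi_i^*\Phi_i\!:,\qquad d_0=\mathrm{Res}_z\,d(z).$$ Then: 1. $\mathcal C$ is a vertex algebra with respect to the $n$-th products of fields, $\mathcal C=\bigoplus_{m\in\mathbb Z}\mathcal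 C_m$, and $d(z)$ is an odd field of $\mathcal C$, lying in $\mathcal C_{-1}$. 2. $[d_\lambda d]=0$. 3. $d_0^2=0$ on $V_k(\mathfrak g)\otimes F(A_{\rm ch})\otimes F(A_{\rm ne})$, and $[d_0,\cdot\,]$ is an odd derivation of all $n$-th products of $\mathcal C$, which has square zero and maps $\mathcal C_m$ to $\mathcal C_{m-1}$ for every $m$. 4. The $0$-th homology $W_k(\mathfrak g,x,f)=\ker\big([d_0,\cdot\,]\big|_{\mathcal C_0}\big)\big/[d_0,\mathcal C_1]$ is a vertex algebra with the vacuum, the parity and the $n$-th products induced from $\mathcal C$. -/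

import Mathlib

open Filter TensorProduct

noncomputable section

namespace QRed

/-! ## Superspaces

A superspace `V = V₀ ⊕ V₁` over `ℂ` is encoded by its parity involution `Γ`
(`+1` on the even part, `-1` on the odd part); as `2` is invertible the two are the same thing. -/

/-- A vector superspace, given by its parity involution. -/
structure Superspace (V : Type*) [AddCommGroup V] [Module ℂ V] where
  par : V →ₗ[ℂ] V
  par_par : ∀ v, par (par v) = v

/-- The Koszul sign `(-1)^{ij}` for parities `i, j`. -/
def koszul (i j : ZMod 2) : ℂ := (-1 : ℂ) ^ (i.val * j.val)

namespace Superspace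

variable {V W : Type*} [AddCommGroup V] [Module ℂ V] [AddCommGroup W] [Module ℂ W]

/-- The subspace `V_i` of vectors of parity `i`. -/
def part (S : Superspace V) (i : ZMod 2) : Submodule ℂ V :=
  Module.End.eigenspace S.par ((-1 : ℂ) ^ i.val)

/-- Projection to the even part. -/
def even (S : Superspace V) : V →ₗ[ℂ] V := (1 / 2 : ℂ) • (LinearMap.id + S.par)

/-- Projection to the odd part. -/
def odd (S : Superspace V) : V →ₗ[ℂ] V := (1 / 2 : ℂ) • (LinearMap.id - S.par)

theorem even_mem (S : Superspace V) (v : V) : S.even v ∈ S.part 0 := by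
  simp [part, even, S.par_par, add_comm]

theorem odd_mem (S : Superspace V) (v : V) : S.odd v ∈ S.part 1 := by
  rw [part, Module.End.mem_eigenspace_iff]
  have : (1 : ZMod 2).val = 1 := rfl
  simp [odd, S.par_par, this, ← smul_neg]

theorem even_add_odd (S : Superspace V) (v : V) : S.even v + S.odd v = v := by
  simp only [even, odd, LinearMap.smul_apply, LinearMap.add_apply, LinearMap.sub_apply,
    LinearMap.id_apply, ← smul_add]
  rw [add_add_sub_cancel, ← two_smul ℂ v, smul_smul]
  norm_num

/-- The superspace with reversed parity. -/
def reverse (S : Superspace V) : Superspace V where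
  par := -S.par
  par_par v := by simp [S.par_par]

/-- The dual superspace: `α` has parity `i` iff it vanishes on the other part. -/
def dual (S : Superspace V) : Superspace (Module.Dual ℂ V) where
  par := S.par.dualMap
  par_par α := by ext v; simp [S.par_par]

/-- Direct sum of superspaces. -/
def prod (S : Superspace V) (T : Superspace W) : Superspace (V × W) where
  par := S.par.prodMap T.par
  par_par v := by simp [S.par_par, T.par_par]

/-- Tensor product of superspaces. -/
def tensor (S : Superspace V) (T : Superspace W) : Superspace (V ⊗[ℂ] W) where
  par := TensorProduct.map S.par T.par
  par_par v := by
    rw [← LinearMap.comp_apply, ← TensorProduct.map_comp]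
    have h1 : S.par ∘ₗ S.par = LinearMap.id := LinearMap.ext S.par_par
    have h2 : T.par ∘ₗ T.par = LinearMap.id := LinearMap.ext T.par_par
    rw [h1, h2, TensorProduct.map_id, LinearMap.id_apply]

/-- A parity-stable subspace. -/
def restrict (S : Superspace V) (P : Submodule ℂ V) (h : ∀ v ∈ P, S.par v ∈ P) :
    Superspace P where
  par := S.par.restrict h
  par_par v := by ext; simp [S.par_par]

/-- The endomorphisms of a superspace: `T` has parity `i` iff `T V_j ⊆ V_{i+j}`. -/
def endo (S : Superspace V) : Superspace (Module.End ℂ V) where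
  par :=
    { toFun := fun T => S.par * T * S.par
      map_add' := fun T U => by simp [mul_add, add_mul]
      map_smul' := fun c T => by simp }
  par_par T := by ext v; simp [S.par_par]

/-- `(-1)^{p(T)p(U)} U T` for homogeneous `T`, `U`, extended bilinearly: the product `U T`, with
the sign of the product of the odd parts reversed. -/
def swapMul (S : Superspace V) (T U : Module.End ℂ V) : Module.End ℂ V :=
  U * T - (2 : ℂ) • (S.endo.odd U * S.endo.odd T)

/-- The supercommutator `[T, U] = T U - (-1)^{p(T)p(U)} U T`, extended bilinearly. -/
def superComm (S : Superspace V) (T U : Module.End ℂ V) : Module.End ℂ V :=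
  T * U - S.swapMul T U

end Superspace

/-! ## Fields and their `n`-th products

An `End V`-valued field is `a(z) = ∑ a_(n) z^{-n-1}` with modes `a_(n) ∈ End V`, such that for every
`v ∈ V` one has `a_(n) v = 0` for `n ≫ 0`. -/

section Fields

variable {V W : Type*} [AddCommGroup V] [Module ℂ V] [AddCommGroup W] [Module ℂ W]

/-- The subspace of fields among all sequences of modes. -/
def fieldSpace (V : Type*) [AddCommGroup V] [Module ℂ V] : Submodule ℂ (ℤ → Module.End ℂ V) where
  carrier := {a | ∀ v, ∀ᶠ n : ℤ in atTop, a n v = 0}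
  zero_mem' v := by simp
  add_mem' {a b} ha hb v := by
    filter_upwards [ha v, hb v] with n h1 h2
    simp [h1, h2]
  smul_mem' c a ha v := by
    filter_upwards [ha v] with n h1
    simp [h1]

/-- The vector space of `End V`-valued fields. -/
def VField (V : Type*) [AddCommGroup V] [Module ℂ V] : Type _ := fieldSpace V

instance : AddCommGroup (VField V) := inferInstanceAs (AddCommGroup (fieldSpace V))

instance : Module ℂ (VField V) := inferInstanceAs (Module ℂ (fieldSpace V))

/-- The mode `a_(n)` of a field. -/
def ncoeff (a : VField V) (n : ℤ) : Module.End ℂ V := a.1 n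

theorem ncoeff_eventually (a : VField V) (v : V) : ∀ᶠ n : ℤ in atTop, ncoeff a n v = 0 := a.2 v

/-- The field with given modes. -/
def mkField (f : ℤ → Module.End ℂ V) (h : ∀ v, ∀ᶠ n : ℤ in atTop, f n v = 0) : VField V := ⟨f, h⟩

@[simp] theorem ncoeff_mkField (f : ℤ → Module.End ℂ V)
    (h : ∀ v, ∀ᶠ n : ℤ in atTop, f n v = 0) (n : ℤ) : ncoeff (mkField f h) n = f n := rfl

@[simp] theorem ncoeff_add (a b : VField V) (n : ℤ) :
    ncoeff (a + b) n = ncoeff a n + ncoeff b n := rfl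

@[simp] theorem ncoeff_smul (c : ℂ) (a : VField V) (n : ℤ) :
    ncoeff (c • a) n = c • ncoeff a n := rfl

theorem field_ext {a b : VField V} (h : ∀ n, ncoeff a n = ncoeff b n) : a = b :=
  Subtype.ext (funext h : a.1 = b.1)

/-- The identity field. -/
def oneField : VField V :=
  mkField (fun n => if n = -1 then 1 else 0) fun v => by
    filter_upwards [eventually_ge_atTop 0] with n hn
    rw [if_neg (by lia)]; rfl

/-- Fields on a superspace form a superspace: a field has parity `i` iff all its modes do. -/
def fieldSuper (S : Superspace V) : Superspace (VField V) where
  par :=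
    { toFun := fun a => mkField (fun n => S.endo.par (ncoeff a n)) fun v => by
        filter_upwards [ncoeff_eventually a (S.par v)] with n hn
        simp [Superspace.endo, hn]
      map_add' := fun a b => field_ext fun n => map_add S.endo.par _ _
      map_smul' := fun c a => field_ext fun n => map_smul S.endo.par _ _ }
  par_par a := field_ext fun n => S.endo.par_par _

theorem swapMul_eventually (S : Superspace V) (T : Module.End ℂ V) (b : VField V)
    (v : V) : ∀ᶠ m : ℤ in atTop, S.swapMul T (ncoeff b m) v = 0 := by
  filter_upwards [ncoeff_eventually b (T v), ncoeff_eventually b (S.endo.odd T v),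
    ncoeff_eventually b (S.par (S.endo.odd T v))] with n h2 h3 h4
  have h5 : S.endo.odd (ncoeff b n) (S.endo.odd T v) = 0 := by
    generalize S.endo.odd T v = w at h3 h4
    simp [Superspace.odd, Superspace.endo, h3, h4]
  simp [Superspace.swapMul, h2, h5]

/-- `[D, a(z)]` for an operator `D` and a field `a(z)`. -/
def adField (S : Superspace V) (D : Module.End ℂ V) :
    VField V →ₗ[ℂ] VField V where
  toFun a := mkField (fun n => S.superComm D (ncoeff a n)) fun v => by
    filter_upwards [ncoeff_eventually a v, swapMul_eventually S D a v] with n h1 h2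
    simp [Superspace.superComm, h1, h2]
  map_add' a b := field_ext fun n => by
    simp [Superspace.superComm, Superspace.swapMul, mul_add, add_mul]
    abel
  map_smul' c a := field_ext fun n => by
    simp [Superspace.superComm, Superspace.swapMul, smul_sub, smul_comm c (2 : ℂ)]

/-- The `j`-th term of the mode `(a_(n)b)_(m)` applied to `v`:
`(-1)^j (n choose j) (a_(n-j) b_(m+j) - (-1)^n (-1)^{p(a)p(b)} b_(m+n-j) a_(j)) v`. -/
def nprodTerm (S : Superspace V) (a b : VField V) (n m : ℤ) (j : ℕ) :
    Module.End ℂ V :=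
  ((-1 : ℂ) ^ j * ((Ring.choose n j : ℤ) : ℂ)) •
    (ncoeff a (n - j) * ncoeff b (m + j)
      - (-1 : ℂ) ^ n •
        S.swapMul (ncoeff a j) (ncoeff b (m + n - j)))

theorem swapMul_zero (S : Superspace V) (T U : Module.End ℂ V) (v : V) (h1 : T v = 0)
    (h2 : T (S.par v) = 0) : S.swapMul T U v = 0 := by
  simp [Superspace.swapMul, Superspace.odd, Superspace.endo, h1, h2]

theorem nprodTerm_finite (S : Superspace V) (a b : VField V) (n m : ℤ) (v : V) :
    (Function.support fun j : ℕ => nprodTerm S a b n m j v).Finite := by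
  obtain ⟨N1, h1⟩ := eventually_atTop.1 (ncoeff_eventually b v)
  obtain ⟨N2, h2⟩ := eventually_atTop.1 (ncoeff_eventually a v)
  obtain ⟨N3, h3⟩ := eventually_atTop.1 (ncoeff_eventually a (S.par v))
  refine (Set.finite_lt_nat ((N1 - m).toNat + N2.toNat + N3.toNat)).subset fun j hj => ?_
  by_contra hlt
  change ¬ j < _ at hlt
  refine hj ?_
  simp only [nprodTerm, LinearMap.smul_apply, LinearMap.sub_apply, Module.End.mul_apply]
  rw [h1 _ (by lia), swapMul_zero S _ _ v (h2 _ (by lia)) (h3 _ (by lia))]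
  simp

/-- The mode `(a_(n)b)_(m)`; the sum is finite on every vector. -/
def nprodMode (S : Superspace V) (a b : VField V) (n m : ℤ) : Module.End ℂ V where
  toFun v := ∑ᶠ j : ℕ, nprodTerm S a b n m j v
  map_add' v w := by
    simp only [map_add]
    exact finsum_add_distrib (nprodTerm_finite S a b n m v) (nprodTerm_finite S a b n m w)
  map_smul' c v := by
    simp only [map_smul, RingHom.id_apply]
    exact (smul_finsum c _).symm

/-- The `n`-th product `a(z)_(n) b(z)`, `n ∈ ℤ`, of two fields:
`Res_x (i_{|x|>|z|} (x-z)^n a(x) b(z) - (-1)^{p(a)p(b)} i_{|z|>|x|} (x-z)^n b(z) a(x))`.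
For `n ≥ 0` this is `Res_x (x-z)^n [a(x), b(z)]`, for `n = -1` the normally ordered product
`: a(z) b(z) :`, and for `n = -k-1 < 0` it is `: ∂^k a(z) b(z) : / k!`. -/
def nprod (S : Superspace V) (a : VField V) (n : ℤ) (b : VField V) :
    VField V :=
  mkField (nprodMode S a b n) fun v => by
    obtain ⟨N1, h1⟩ := eventually_atTop.1 (ncoeff_eventually b v)
    obtain ⟨N2, h2⟩ := eventually_atTop.1 (ncoeff_eventually a v)
    obtain ⟨N3, h3⟩ := eventually_atTop.1 (ncoeff_eventually a (S.par v))
    have key : ∀ᶠ m : ℤ in atTop, ∀ j ∈ Finset.range (N2.toNat + N3.toNat),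
        S.swapMul (ncoeff a j) (ncoeff b (m + n - j)) v = 0 := by
      rw [Filter.eventually_all_finset]
      intro j _
      have : Tendsto (fun m : ℤ => m + n - j) atTop atTop := by
        simp only [add_sub_assoc]
        exact tendsto_atTop_add_const_right _ _ tendsto_id
      exact this.eventually (swapMul_eventually S _ b v)
    filter_upwards [key, eventually_ge_atTop N1] with m hm hN
    refine finsum_eq_zero_of_forall_eq_zero fun j => ?_
    simp only [nprodTerm, LinearMap.smul_apply, LinearMap.sub_apply, Module.End.mul_apply]
    rw [h1 _ (by lia)]
    by_cases hj : j ∈ Finset.range (N2.toNat + N3.toNat)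
    · rw [hm j hj]; simp
    · simp only [Finset.mem_range, not_lt] at hj
      rw [swapMul_zero S _ _ v (h2 _ (by lia)) (h3 _ (by lia))]; simp

/-- The `λ`-bracket `[a_λ b] = ∑_{n ≥ 0} (λ^n / n!) a_(n) b`, as the sequence of its coefficients,
i.e. as a formal power series in `λ` with coefficients in the space of fields. -/
def lambdaBracket (S : Superspace V) (a b : VField V) : ℕ → VField V :=
  fun n => (1 / (n.factorial : ℂ)) • nprod S a n b

/-- The field `a(z) ⊗ 1`. -/
def tensorLeft (a : VField V) : VField (V ⊗[ℂ] W) :=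
  mkField (fun n => TensorProduct.map (ncoeff a n) LinearMap.id) fun t => by
    induction t with
    | zero => simp
    | tmul v w =>
      filter_upwards [ncoeff_eventually a v] with n hn
      simp [hn]
    | add s t hs ht =>
      filter_upwards [hs, ht] with n h1 h2
      rw [map_add, h1, h2, add_zero]

/-- The field `1 ⊗ b(z)`, acting with the Koszul rule
`(1 ⊗ b)(v ⊗ w) = (-1)^{p(b)p(v)} v ⊗ b w`. -/
def tensorRight (S : Superspace V) (T : Superspace W) (b : VField W) :
    VField (V ⊗[ℂ] W) :=
  mkField (fun n =>
      TensorProduct.map LinearMap.id (T.endo.even (ncoeff b n))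
        + TensorProduct.map S.par (T.endo.odd (ncoeff b n))) fun t => by
    induction t with
    | zero => simp
    | tmul v w =>
      filter_upwards [ncoeff_eventually b w, ncoeff_eventually b (T.par w)] with n h1 h2
      simp [Superspace.even, Superspace.odd, Superspace.endo, h1, h2]
    | add s t hs ht =>
      filter_upwards [hs, ht] with n h1 h2
      rw [map_add, h1, h2, add_zero]

/-- The space of fields generated by a family of fields, where the fields in `G m` have charge `m`,
in charge `m`: `generated S G m` is the span of all iterated `n`-th products (`n ∈ ℤ`) of total
charge `m` of the identity field (of charge `0`) and the generators. -/
inductive Generated (S : Superspace V) (G : ℤ → Set (VField V)) :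
    ℤ → VField V → Prop
  | one : Generated S G 0 oneField
  | gen {m : ℤ} {a : VField V} : a ∈ G m → Generated S G m a
  | nprod {m m' : ℤ} {a b : VField V} (n : ℤ) :
      Generated S G m a → Generated S G m' b → Generated S G (m + m') (nprod S a n b)
  | zero (m : ℤ) : Generated S G m 0
  | add {m : ℤ} {a b : VField V} :
      Generated S G m a → Generated S G m b → Generated S G m (a + b)
  | smul {m : ℤ} (c : ℂ) {a : VField V} :
      Generated S G m a → Generated S G m (c • a)

/-- The charge `m` part of the space of fields generated by `G`. -/
def chargePart (S : Superspace V) (G : ℤ → Set (VField V)) (m : ℤ) :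
    Submodule ℂ (VField V) where
  carrier := {a | Generated S G m a}
  zero_mem' := Generated.zero m
  add_mem' := Generated.add
  smul_mem' c _ := Generated.smul c

/-- The smallest space of fields that contains the identity field and all the generators in `G` and
is closed under all `n`-th products, `n ∈ ℤ` (hence under `∂a = a_(-2) 1`). -/
def closure (S : Superspace V) (G : Set (VField V)) :
    Submodule ℂ (VField V) :=
  sInf {P | oneField ∈ P ∧ G ⊆ P ∧ ∀ a ∈ P, ∀ b ∈ P, ∀ n : ℤ, nprod S a n b ∈ P}

end Fields

/-! ## Vertex algebras -/

/-- A vertex algebra (in the super sense) on `V`: parity, vacuum `|0⟩`, translation operator `T`,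
and state-field correspondence `a ↦ Y(a, z) = ∑ a_(n) z^{-n-1}`, with the vacuum axioms,
translation covariance, and locality `(z - w)^N [Y(a, z), Y(b, w)] = 0` for large `N`. -/
structure VertexAlgebra (V : Type*) [AddCommGroup V] [Module ℂ V] extends Superspace V where
  vac : V
  T : V →ₗ[ℂ] V
  Y : V →ₗ[ℂ] VField V
  par_vac : par vac = vac
  par_Y : ∀ a b n,
    par (ncoeff (Y a) n b) = ncoeff (Y (par a)) n (par b)
  T_vac : T vac = 0
  Y_vac : Y vac = oneField
  creation : ∀ a, ncoeff (Y a) (-1) vac = a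
  creation_nonneg : ∀ a, ∀ n : ℤ, 0 ≤ n → ncoeff (Y a) n vac = 0
  translation : ∀ a b, ∀ n : ℤ,
    T (ncoeff (Y a) n b) - ncoeff (Y a) n (T b)
      = -(n : ℂ) • ncoeff (Y a) (n - 1) b
  locality : ∀ (i j : ZMod 2), ∀ a ∈ toSuperspace.part i, ∀ b ∈ toSuperspace.part j,
    ∃ N : ℕ, ∀ m n : ℤ, ∑ s ∈ Finset.range (N + 1), ((-1 : ℂ) ^ s * (N.choose s : ℂ)) •
      (ncoeff (Y a) (m + N - s) * ncoeff (Y b) (n + s)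
        - koszul i j •
          (ncoeff (Y b) (n + s) * ncoeff (Y a) (m + N - s))) = 0

/-! ## Affinizations and their vacuum modules -/

/-- A superspace `A` with an even bracket and two even bilinear forms. It gives rise to modes
`a_(n) = a tⁿ` with
`[a_(m), b_(n)] = [a, b]_(m+n) + ⟨a, b⟩ δ_{m,-n-1} + m (a, b) δ_{m,-n}`,
where `⟨·,·⟩` is `form0` and `(·,·)` is `form1` (in other words
`[a_λ b] = [a, b] + ⟨a, b⟩ + λ (a, b)`). -/
structure ModeData (A : Type*) [AddCommGroup A] [Module ℂ A] extends Superspace A where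
  bracket : A →ₗ[ℂ] A →ₗ[ℂ] A
  form0 : A →ₗ[ℂ] A →ₗ[ℂ] ℂ
  form1 : A →ₗ[ℂ] A →ₗ[ℂ] ℂ
  bracket_par : ∀ a b, bracket (par a) (par b) = par (bracket a b)
  form0_par : ∀ a b, form0 (par a) (par b) = form0 a b
  form1_par : ∀ a b, form1 (par a) (par b) = form1 a b

namespace ModeData

variable {A : Type*} [AddCommGroup A] [Module ℂ A]

/-- The free mode `a tⁿ` in the tensor algebra of `A[t, t⁻¹]`; the latter is `ℤ →₀ A`. -/
def freeMode (a : A) (n : ℤ) : TensorAlgebra ℂ (ℤ →₀ A) :=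
  TensorAlgebra.ι ℂ (Finsupp.single n a)

/-- The scalar `⟨a, b⟩ δ_{m,-n-1} + m (a, b) δ_{m,-n}`. -/
def central (R : ModeData A) (a b : A) (m n : ℤ) : ℂ :=
  (if m = -n - 1 then R.form0 a b else 0) + (if m = -n then (m : ℂ) * R.form1 a b else 0)

/-- The supercommutation relations of the modes. -/
inductive Rel (R : ModeData A) : TensorAlgebra ℂ (ℤ →₀ A) → TensorAlgebra ℂ (ℤ →₀ A) → Prop
  | comm {i j : ZMod 2} {a b : A} (m n : ℤ) (ha : a ∈ R.part i) (hb : b ∈ R.part j) :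
      Rel R (freeMode a m * freeMode b n)
        (koszul i j • (freeMode b n * freeMode a m) + freeMode (R.bracket a b) (m + n)
          + algebraMap ℂ _ (R.central a b m n))

/-- The quotient of the universal enveloping algebra of the affinization
`A[t, t⁻¹] ⊕ ℂ K` by the ideal that identifies the central element `K` with its fixed value
(the value is included in the forms). -/
abbrev U (R : ModeData A) : Type _ := RingQuot R.Rel

/-- The mode `a_(n) = a tⁿ` in `U`. -/
def mode (R : ModeData A) (a : A) (n : ℤ) : R.U := RingQuot.mkAlgHom ℂ R.Rel (freeMode a n)

theorem mode_comm (R : ModeData A) {i j : ZMod 2} {a b : A} (m n : ℤ) (ha : a ∈ R.part i)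
    (hb : b ∈ R.part j) : R.mode a m * R.mode b n = koszul i j • (R.mode b n * R.mode a m)
      + R.mode (R.bracket a b) (m + n) + algebraMap ℂ _ (R.central a b m n) := by
  have := RingQuot.mkAlgHom_rel ℂ (Rel.comm (R := R) m n ha hb)
  simpa [mode] using this

theorem mode_add (R : ModeData A) (a b : A) (n : ℤ) :
    R.mode (a + b) n = R.mode a n + R.mode b n := by
  simp [mode, freeMode]

/-- The left ideal of `U` generated by all `a tⁿ` with `n ≥ 0`. -/
def annih (R : ModeData A) : Submodule R.U R.U :=
  Submodule.span R.U {u | ∃ (a : A) (n : ℤ), 0 ≤ n ∧ u = R.mode a n}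

/-- The vacuum module: `U` modulo the left ideal generated by all `a tⁿ` with `n ≥ 0`. -/
def Vac (R : ModeData A) : Type _ := R.U ⧸ R.annih

instance (R : ModeData A) : AddCommGroup R.Vac := inferInstanceAs (AddCommGroup (R.U ⧸ R.annih))

instance (R : ModeData A) : Module R.U R.Vac := inferInstanceAs (Module R.U (R.U ⧸ R.annih))

instance (R : ModeData A) : Module ℂ R.Vac := inferInstanceAs (Module ℂ (R.U ⧸ R.annih))

instance (R : ModeData A) : IsScalarTower ℂ R.U R.Vac :=
  inferInstanceAs (IsScalarTower ℂ R.U (R.U ⧸ R.annih))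

/-- The class of an element of `U` in the vacuum module. -/
def toVac (R : ModeData A) : R.U →ₗ[R.U] R.Vac := R.annih.mkQ

theorem toVac_surjective (R : ModeData A) : Function.Surjective R.toVac :=
  R.annih.mkQ_surjective

theorem toVac_eq_zero (R : ModeData A) {u : R.U} (h : u ∈ R.annih) : R.toVac u = 0 :=
  (Submodule.Quotient.mk_eq_zero _).2 h

theorem act_toVac (R : ModeData A) (u w : R.U) :
    (Algebra.lsmul ℂ ℂ R.Vac u) (R.toVac w) = R.toVac (u * w) := by
  change u • R.toVac w = _
  rw [← map_smul, smul_eq_mul]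

/-- The operator by which an element of `U` acts on the vacuum module. -/
def act (R : ModeData A) : R.U →ₐ[ℂ] Module.End ℂ R.Vac := Algebra.lsmul ℂ ℂ R.Vac

theorem act_trunc_step (R : ModeData A) (x : TensorAlgebra ℂ (ℤ →₀ A)) :
    ∀ v : R.Vac, (∀ a, ∀ᶠ n : ℤ in atTop, R.act (R.mode a n) v = 0) →
      ∀ a, ∀ᶠ n : ℤ in atTop,
        R.act (R.mode a n) (R.act (RingQuot.mkAlgHom ℂ R.Rel x) v) = 0 := by
  induction x using TensorAlgebra.induction with
  | algebraMap r =>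
    intro v hv a
    filter_upwards [hv a] with n hn
    rw [AlgHom.commutes, AlgHom.commutes, Module.algebraMap_end_apply, map_smul, hn, smul_zero]
  | mul x y hx hy =>
    intro v hv
    simpa using hx _ (hy v hv)
  | add x y hx hy =>
    intro v hv a
    filter_upwards [hx v hv a, hy v hv a] with n h1 h2
    simp [h1, h2]
  | ι p =>
    induction p using Finsupp.induction_linear with
    | zero => intro v hv a; simp
    | add p q hp hq =>
      intro v hv a
      filter_upwards [hp v hv a, hq v hv a] with n h1 h2
      simp [h1, h2]
    | single m b =>
      intro v hv a
      change ∀ᶠ n : ℤ in atTop, R.act (R.mode a n) (R.act (R.mode b m) v) = 0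
      have hom : ∀ (i j : ZMod 2) (a b : A), a ∈ R.part i → b ∈ R.part j →
          ∀ᶠ n : ℤ in atTop, R.act (R.mode a n) (R.act (R.mode b m) v) = 0 := by
        intro i j a b ha hb
        have h3 : Tendsto (fun n : ℤ => n + m) atTop atTop :=
          tendsto_atTop_add_const_right _ _ tendsto_id
        filter_upwards [hv a, h3.eventually (hv (R.bracket a b)), eventually_gt_atTop (-m)]
          with n h1 h2 hn
        have hc : R.central a b n m = 0 := by
          rw [central, if_neg (by lia), if_neg (by lia), add_zero]
        rw [← Module.End.mul_apply, ← map_mul, R.mode_comm n m ha hb, hc]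
        simp [h1, h2]
      have e1 := hom 0 0 _ _ (R.even_mem a) (R.even_mem b)
      have e2 := hom 0 1 _ _ (R.even_mem a) (R.odd_mem b)
      have e3 := hom 1 0 _ _ (R.odd_mem a) (R.even_mem b)
      have e4 := hom 1 1 _ _ (R.odd_mem a) (R.odd_mem b)
      filter_upwards [e1, e2, e3, e4] with n h1 h2 h3 h4
      rw [← R.even_add_odd a, ← R.even_add_odd b]
      simp [mode_add, h1, h2, h3, h4]

/-- The field `a(z) = ∑ (a tⁿ) z^{-n-1}` on the vacuum module. -/
def field (R : ModeData A) (a : A) : VField R.Vac :=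
  mkField (fun n => R.act (R.mode a n)) fun v => by
    obtain ⟨u, rfl⟩ := R.toVac_surjective v
    obtain ⟨x, rfl⟩ := RingQuot.mkAlgHom_surjective ℂ R.Rel u
    have h := R.act_trunc_step x (R.toVac 1) (fun a => by
      filter_upwards [eventually_ge_atTop 0] with n hn
      rw [act, act_toVac, mul_one]
      exact R.toVac_eq_zero (Submodule.subset_span ⟨a, n, hn, rfl⟩)) a
    filter_upwards [h] with n hn
    rw [← hn, act, act_toVac, act_toVac, act_toVac, mul_one]

theorem par_mem (R : ModeData A) {i : ZMod 2} {a : A} (ha : a ∈ R.part i) :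
    R.par a ∈ R.part i := by
  rw [Superspace.part, Module.End.mem_eigenspace_iff] at ha ⊢
  rw [ha, map_smul, ha]

/-- The parity automorphism `a tⁿ ↦ Γ(a) tⁿ` of `U`. -/
def parU (R : ModeData A) : R.U →ₐ[ℂ] R.U :=
  RingQuot.liftAlgHom ℂ
    ⟨(RingQuot.mkAlgHom ℂ R.Rel).comp
      (TensorAlgebra.lift ℂ (TensorAlgebra.ι ℂ ∘ₗ Finsupp.mapRange.linearMap R.par)), by
      rintro _ _ ⟨m, n, ha, hb⟩
      have := R.mode_comm m n (R.par_mem ha) (R.par_mem hb)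
      rw [R.bracket_par] at this
      simpa [mode, freeMode, central, R.form0_par, R.form1_par] using this⟩

@[simp] theorem parU_mode (R : ModeData A) (a : A) (n : ℤ) :
    R.parU (R.mode a n) = R.mode (R.par a) n := by
  simp [parU, mode, freeMode]

theorem parU_parU (R : ModeData A) (u : R.U) : R.parU (R.parU u) = u := by
  have : R.parU.comp R.parU = AlgHom.id ℂ _ := by
    apply RingQuot.ringQuot_ext'
    apply TensorAlgebra.hom_ext
    apply Finsupp.lhom_ext
    intro n a
    change R.parU (R.parU (R.mode a n)) = R.mode a n
    rw [parU_mode, parU_mode, R.par_par]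
  exact DFunLike.congr_fun this u

theorem parU_annih (R : ModeData A) :
    R.annih.restrictScalars ℂ ≤ (R.annih.restrictScalars ℂ).comap R.parU.toLinearMap := by
  intro u hu
  change R.parU u ∈ R.annih
  change u ∈ R.annih at hu
  induction hu using Submodule.span_induction with
  | mem u h =>
    obtain ⟨a, n, hn, rfl⟩ := h
    rw [parU_mode]
    exact Submodule.subset_span ⟨_, n, hn, rfl⟩
  | zero => simp
  | add u v _ _ h1 h2 => rw [map_add]; exact add_mem h1 h2
  | smul c u _ h =>
    rw [smul_eq_mul, map_mul]
    exact Submodule.smul_mem _ _ h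

/-- The parity of the vacuum module: the vacuum is even, and `a tⁿ` has the parity of `a`. -/
def vacSuper (R : ModeData A) : Superspace R.Vac where
  par := ((R.annih.restrictScalars ℂ).mapQ (R.annih.restrictScalars ℂ) R.parU.toLinearMap
    R.parU_annih : R.U ⧸ R.annih.restrictScalars ℂ →ₗ[ℂ] R.U ⧸ R.annih.restrictScalars ℂ)
  par_par v := by
    obtain ⟨u, rfl⟩ := R.toVac_surjective v
    change R.toVac (R.parU (R.parU u)) = _
    rw [parU_parU]

end ModeData

/-! ## Lie superalgebras -/

/-- A Lie superalgebra structure over `ℂ` on `g`. -/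
structure LieSuperalgebra (g : Type*) [AddCommGroup g] [Module ℂ g] extends Superspace g where
  bracket : g →ₗ[ℂ] g →ₗ[ℂ] g
  bracket_par : ∀ a b, bracket (par a) (par b) = par (bracket a b)
  skew : ∀ i j, ∀ a ∈ toSuperspace.part i, ∀ b ∈ toSuperspace.part j,
    bracket a b = -(koszul i j • bracket b a)
  jacobi : ∀ i j, ∀ a ∈ toSuperspace.part i, ∀ b ∈ toSuperspace.part j, ∀ c,
    bracket a (bracket b c) = bracket (bracket a b) c + koszul i j • bracket b (bracket a c)

/-- Simplicity: not abelian, and no proper nonzero graded ideal. -/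
def LieSuperalgebra.IsSimple {g : Type*} [AddCommGroup g] [Module ℂ g]
    (L : LieSuperalgebra g) : Prop :=
  L.bracket ≠ 0 ∧ ∀ I : Submodule ℂ g, (∀ a ∈ I, L.par a ∈ I) →
    (∀ a, ∀ b ∈ I, L.bracket a b ∈ I) → I = ⊥ ∨ I = ⊤

/-- A Lie superalgebra with a non-degenerate even supersymmetric invariant bilinear form and even
elements `x`, `f` such that `ad x` is diagonalizable with half-integer eigenvalues and
`[x, f] = -f`. -/
structure ReductionData {g : Type*} [AddCommGroup g] [Module ℂ g] (L : LieSuperalgebra g) where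
  form : g →ₗ[ℂ] g →ₗ[ℂ] ℂ
  form_par : ∀ a b, form (L.par a) (L.par b) = form a b
  form_symm : ∀ i j, ∀ a ∈ L.part i, ∀ b ∈ L.part j, form a b = koszul i j * form b a
  form_inv : ∀ a b c, form (L.bracket a b) c = form a (L.bracket b c)
  form_nondeg : form.Nondegenerate
  x : g
  f : g
  x_even : x ∈ L.part 0
  f_even : f ∈ L.part 0
  diag : ⨆ j : ℤ, Module.End.eigenspace (L.bracket x) ((j : ℂ) / 2) = ⊤
  bracket_x_f : L.bracket x f = -f

namespace ReductionData

variable {g : Type*} [AddCommGroup g] [Module ℂ g] {L : LieSuperalgebra g} (D : ReductionData L)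

/-- The eigenspace `g_{j/2}` of `ad x`, for an integer `j`. -/
def gr (j : ℤ) : Submodule ℂ g := Module.End.eigenspace (L.bracket D.x) ((j : ℂ) / 2)

/-- `g₊`, the sum of the eigenspaces of `ad x` with positive eigenvalues. -/
def gPlus : Submodule ℂ g := ⨆ j : ℤ, ⨆ _ : 0 < j, D.gr j

theorem par_gr (j : ℤ) : ∀ a ∈ D.gr j, L.par a ∈ D.gr j := by
  intro a ha
  rw [gr, Module.End.mem_eigenspace_iff] at ha ⊢
  have hx : L.par D.x = D.x := by
    have := D.x_even
    rw [Superspace.part, Module.End.mem_eigenspace_iff] at this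
    simpa using this
  have h := L.bracket_par D.x a
  rw [hx, ha, map_smul] at h
  exact h

theorem par_gPlus : ∀ a ∈ D.gPlus, L.par a ∈ D.gPlus := by
  have : D.gPlus ≤ D.gPlus.comap L.par :=
    iSup₂_le fun j hj a ha =>
      (le_iSup₂_of_le (f := fun (j : ℤ) (_ : 0 < j) => D.gr j) j hj le_rfl) (D.par_gr j a ha)
  exact this

/-- The superspace `g₊`. -/
def plusSuper : Superspace D.gPlus := L.toSuperspace.restrict D.gPlus D.par_gPlus

/-- The currents: `[a_λ b] = [a, b] + λ k (a|b)`, i.e. the Kac-Moody affinization of `g`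
at level `k`. -/
def currents (k : ℂ) : ModeData g where
  toSuperspace := L.toSuperspace
  bracket := L.bracket
  form0 := 0
  form1 := k • D.form
  bracket_par := L.bracket_par
  form0_par := by simp
  form1_par := by simp [D.form_par]

/-- The form on `A_ch = Π g₊ ⊕ Π g₊*`, where `Π` reverses parity: both summands are isotropic,
`⟨a, β⟩ = β(a)` for `a ∈ Π g₊`, `β ∈ Π g₊*`, and the form is skew-supersymmetric, i.e.
`⟨α, b⟩ = -(-1)^{p(α)p(b)} ⟨b, α⟩`. As `α(b) ≠ 0` only if `α` and `b` have the same parity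
in `A_ch`, this sign is the parity of `b` in `g₊`, whence `⟨α, b⟩ = α(Γ b)`. -/
def chForm : (D.gPlus × Module.Dual ℂ D.gPlus) →ₗ[ℂ]
    (D.gPlus × Module.Dual ℂ D.gPlus) →ₗ[ℂ] ℂ :=
  LinearMap.mk₂ ℂ (fun p q => q.2 p.1 + p.2 (D.plusSuper.par q.1))
    (fun p p' q => by simp; ring) (fun c p q => by simp; ring)
    (fun p q q' => by simp; ring) (fun c p q => by simp; ring)

/-- The charged free superfermions: Clifford affinization of `A_ch = Π g₊ ⊕ Π g₊*`. -/
def charged : ModeData (D.gPlus × Module.Dual ℂ D.gPlus) where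
  toSuperspace := D.plusSuper.reverse.prod D.plusSuper.dual.reverse
  bracket := 0
  form0 := D.chForm
  form1 := 0
  bracket_par := by simp
  form0_par a b := by
    simp [chForm, Superspace.prod, Superspace.reverse, Superspace.dual, D.plusSuper.par_par]
  form1_par := by simp

/-- The form `⟨a, b⟩ = (f | [a, b])` on `g_{1/2}`. -/
def neForm : D.gr 1 →ₗ[ℂ] D.gr 1 →ₗ[ℂ] ℂ :=
  LinearMap.mk₂ ℂ (fun a b => D.form D.f (L.bracket a b))
    (fun a a' b => by simp) (fun c a b => by simp)
    (fun a b b' => by simp) (fun c a b => by simp)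

/-- The neutral free superfermions: Clifford affinization of `A_ne = g_{1/2}`. -/
def neutral : ModeData (D.gr 1) where
  toSuperspace := L.toSuperspace.restrict (D.gr 1) (D.par_gr 1)
  bracket := 0
  form0 := D.neForm
  form1 := 0
  bracket_par := by simp
  form0_par a b := by
    have hf : L.par D.f = D.f := by
      have := D.f_even
      rw [Superspace.part, Module.End.mem_eigenspace_iff] at this
      simpa using this
    have h := D.form_par D.f (L.bracket a b)
    rw [hf] at h
    simp [neForm, Superspace.restrict, L.bracket_par, h]
  form1_par := by simp

/-- The underlying space `V_k(g) ⊗ F(A_ch) ⊗ F(A_ne)`. -/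
def Space (k : ℂ) : Type _ := (D.currents k).Vac ⊗[ℂ] (D.charged.Vac ⊗[ℂ] D.neutral.Vac)

instance (k : ℂ) : AddCommGroup (D.Space k) :=
  inferInstanceAs (AddCommGroup ((D.currents k).Vac ⊗[ℂ] (D.charged.Vac ⊗[ℂ] D.neutral.Vac)))

instance (k : ℂ) : Module ℂ (D.Space k) :=
  inferInstanceAs (Module ℂ ((D.currents k).Vac ⊗[ℂ] (D.charged.Vac ⊗[ℂ] D.neutral.Vac)))

/-- The superspace `F(A_ch) ⊗ F(A_ne)`. -/
def ghostSuper : Superspace (D.charged.Vac ⊗[ℂ] D.neutral.Vac) :=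
  D.charged.vacSuper.tensor D.neutral.vacSuper

/-- The superspace `V_k(g) ⊗ F(A_ch) ⊗ F(A_ne)`. -/
def super (k : ℂ) : Superspace (D.Space k) := (D.currents k).vacSuper.tensor D.ghostSuper

/-- The current `a(z) ⊗ 1 ⊗ 1`, for `a ∈ g`. -/
def cur (k : ℂ) (a : g) : VField (D.Space k) :=
  tensorLeft ((D.currents k).field a)

/-- The charged ghost `1 ⊗ φ(z) ⊗ 1`, for `φ ∈ A_ch`. -/
def gh (k : ℂ) (φ : D.gPlus × Module.Dual ℂ D.gPlus) : VField (D.Space k) :=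
  tensorRight (D.currents k).vacSuper D.ghostSuper (tensorLeft (D.charged.field φ))

/-- The neutral ghost `1 ⊗ 1 ⊗ Φ(z)`, for `Φ ∈ A_ne = g_{1/2}`. -/
def ne (k : ℂ) (b : D.gr 1) : VField (D.Space k) :=
  tensorRight (D.currents k).vacSuper D.ghostSuper
    (tensorRight D.charged.vacSuper D.neutral.vacSuper (D.neutral.field b))

/-- The generating fields by charge: currents and neutral ghosts have charge `0`, the ghosts `φ(z)`
with `φ ∈ Π g₊` have charge `1`, and the ghosts `φ*(z)` with `φ* ∈ Π g₊*` have charge `-1`. -/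
def gens (k : ℂ) (m : ℤ) : Set (VField (D.Space k)) :=
  {a | (m = 0 ∧ ∃ u, a = D.cur k u) ∨ (m = 1 ∧ ∃ φ, a = D.gh k (φ, 0)) ∨
    (m = -1 ∧ ∃ α, a = D.gh k (0, α)) ∨ (m = 0 ∧ ∃ b, a = D.ne k b)}

/-- The vertex algebra `C(g, x, f, k) = V_k(g) ⊗ F(A_ch) ⊗ F(A_ne)`, as a space of fields: the
smallest space of fields on `V_k(g) ⊗ F(A_ch) ⊗ F(A_ne)` that contains the identity field,
the currents and the ghosts and is closed under all `n`-th products. -/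
def C (k : ℂ) : Submodule ℂ (VField (D.Space k)) :=
  closure (D.super k) (⋃ m, D.gens k m)

/-- The component `C_m` of charge `m`. -/
def Cm (k : ℂ) (m : ℤ) : Submodule ℂ (VField (D.Space k)) :=
  chargePart (D.super k) (D.gens k) m

/-- A basis `(u_i)` of `g`, homogeneous for the parity and for the eigenspace decomposition of
`ad x`: `u_i` has parity `p i` and lies in `g_{deg i / 2}`. -/
structure AdaptedBasis (ι : Type*) where
  u : Module.Basis ι ℂ g
  p : ι → ZMod 2
  deg : ι → ℤ
  mem_part : ∀ i, u i ∈ L.part (p i)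
  mem_gr : ∀ i, u i ∈ D.gr (deg i)

namespace AdaptedBasis

variable {D} {ι : Type*} (E : D.AdaptedBasis ι)

/-- The index set `S` of the basis of `g₊`. -/
abbrev S : Type _ := {i : ι // 0 < E.deg i}

/-- The index set `S'` of the basis of `g_{1/2}`. -/
abbrev S' : Type _ := {i : ι // E.deg i = 1}

/-- The element `u_i` of `g₊`, for `i ∈ S`. -/
def uPlus (i : E.S) : D.gPlus :=
  ⟨E.u i, le_iSup₂_of_le (f := fun (j : ℤ) (_ : 0 < j) => D.gr j) _ i.2 le_rfl (E.mem_gr i)⟩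

/-- An element of `S'` as an element of `S`. -/
def incl (i : E.S') : E.S := ⟨i.1, by rw [i.2]; norm_num⟩

/-- The structure constants, `[u_i, u_j] = ∑_l c^l_{ij} u_l`. -/
def c (l i j : ι) : ℂ := E.u.repr (L.bracket (E.u i) (E.u j)) l

/-- The ghost `φ_i(z)`. -/
def phi (k : ℂ) (i : E.S) : VField (D.Space k) := D.gh k (E.uPlus i, 0)

/-- The ghost `φ*_i(z)`: here `φ*_i` is the dual basis of `g₊*`. -/
def phiStar (k : ℂ) (i : E.S) : VField (D.Space k) :=
  D.gh k (0, (E.u.coord i).comp D.gPlus.subtype)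

/-- The ghost `Φ_i(z)`. -/
def Phi (k : ℂ) (i : E.S') : VField (D.Space k) :=
  D.ne k ⟨E.u i, by have := E.mem_gr i; rwa [i.2] at this⟩


/-- The field
`d(z) = ∑_{i ∈ S} (-1)^{p(u_i)} u_i φ*_i - ½ ∑_{i,j,l ∈ S} (-1)^{p(u_i)p(u_l)} c^l_{ij} φ_l φ*_i φ*_j
  + ∑_{i ∈ S} (f|u_i) φ*_i + ∑_{i ∈ S'} φ*_i Φ_i`. -/
def d [Fintype ι] (k : ℂ) : VField (D.Space k) :=
  ∑ i : E.S, (-1 : ℂ) ^ (E.p i).val • nprod (D.super k) (D.cur k (E.u i)) (-1) (E.phiStar k i)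
  - (1 / 2 : ℂ) • ∑ i : E.S, ∑ j : E.S, ∑ l : E.S,
      ((-1 : ℂ) ^ ((E.p i).val * (E.p l).val) * E.c l i j) •
        nprod (D.super k) (E.phi k l) (-1)
          (nprod (D.super k) (E.phiStar k i) (-1) (E.phiStar k j))
  + ∑ i : E.S, D.form D.f (E.u i) • E.phiStar k i
  + ∑ i : E.S', nprod (D.super k) (E.phiStar k (E.incl i)) (-1) (E.Phi k i)

/-- `d₀ = Res_z d(z)`. -/
def d0 [Fintype ι] (k : ℂ) : Module.End ℂ (D.Space k) := ncoeff (E.d k) 0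

/-- The differential `a(z) ↦ [d₀, a(z)]`. -/
def diff [Fintype ι] (k : ℂ) :
    VField (D.Space k) →ₗ[ℂ] VField (D.Space k) :=
  adField (D.super k) (E.d0 k)

/-- The `0`-cycles: the kernel of `[d₀, ·]` on `C_0`. -/
def Z [Fintype ι] (k : ℂ) : Submodule ℂ (VField (D.Space k)) :=
  D.Cm k 0 ⊓ LinearMap.ker (E.diff k)

/-- The `0`-boundaries: the image of `C_1` under `[d₀, ·]`. -/
def B [Fintype ι] (k : ℂ) : Submodule ℂ (VField (D.Space k)) :=
  (D.Cm k 1).map (E.diff k)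

/-- The `0`-th homology `W_k(g, x, f)` of `(C(g, x, f, k), d₀)`. -/
abbrev Wk [Fintype ι] (k : ℂ) : Type _ := E.Z k ⧸ (E.B k).comap (E.Z k).subtype

/-- The class in `W_k(g, x, f)` of a `0`-cycle. -/
def cls [Fintype ι] (k : ℂ) : E.Z k →ₗ[ℂ] E.Wk k := Submodule.mkQ _

end AdaptedBasis

end ReductionData

end QRed

end

/-! Vertex algebras of fields. The `n`-th product is a residue in `x` of `(x-w)^n` against the pair
of operator products `a(x)b(w)` and `±b(w)a(x)`, each taken with its own expansion (`hasRes_nprod`).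
Multiplying the pair by `x-w` raises `n` by one (`hasRes_dif_iff`), and the modes of such a residue
are unique; these two facts replace binomial identities throughout. From them come the vacuum and
translation axioms, Dong's lemma (`Local.nprod_of_mem`), and the fact that left multiplications
`a_(p)` and `b_(q)` by mutually local fields are again mutually local (`dif_pow_nprod_nprod`). Hence
a parity-stable space of pairwise local fields that contains the identity and is closed under all
products is a vertex algebra (`exists_vertexAlgebra`). The currents and ghosts are pairwise local
because their brackets are at most linear in `λ`, so this applies to `C`.

Charge. Scaling the charged ghosts `φ` by `2` and `φ*` by `1/2` lifts to an even invertible operator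
on the complex. Conjugation by it acts on `C_m` as `2^m`, so the components are independent as
subspaces of distinct eigenspaces.

The identity `[d_λ d] = 0`. Put `Y_i = u_i + (f|u_i) ± Φ_i` for `u_i` in `g₊`. The invariant form
vanishes on `g₊ × g₊`, so the level disappears; and the bracket of the neutral ghosts is exactly the
scalar `(f|[u_i,u_j])` produced by the shift. So the `Y_i` satisfy the relations of `g₊` with no
central term (`br_shifted_shifted`), and `d` becomes the standard BRST field `∑ ± Y_i φ*_i - ½ ∑ φ_l
q_l`, where `q_l` is quadratic in the `φ*` (`d_eq`). Every bracket that occurs is then constant in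
`λ`: since all degrees are positive, a nonzero `c^l_{ij}` has `deg l` larger than `deg i` and `deg
j`, which rules out double contractions and hence the integral term in Wick's formula. What remains
is finite algebra: the terms `Y_l q_l` cancel with coefficients `1 - ½ - ½`, and the cubic terms in
the `φ*` vanish by the Jacobi identity (`BRST.r_eq_zero`).

Homology. As `d₀` is odd, `[d₀,d₀] = 2 d₀²`, so `d₀² = 0`. The supercommutator with a homogeneous
operator is a derivation of all products, because it passes through the residue (`adField_nprod`).
Therefore the cycles of charge `0` form a vertex algebra of fields, the boundaries are an ideal in
it, and the quotient inherits the structure (`exists_vertexAlgebra_quotient`). -/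

noncomputable section

namespace QRed

/-! ## Pointwise finite sums of operators -/

section PointwiseSum

variable {V : Type*} [AddCommGroup V] [Module ℂ V] {ι κ : Type*}

/-- The family of operators `T` is finite on every vector, and its sum is `X`. -/
def HasPSum (T : ι → Module.End ℂ V) (X : Module.End ℂ V) : Prop :=
  ∀ v, (Function.support fun j => T j v).Finite ∧ ∑ᶠ j, T j v = X v

namespace HasPSum

variable {T T' : ι → Module.End ℂ V} {X X' : Module.End ℂ V}

theorem unique (h : HasPSum T X) (h' : HasPSum T X') : X = X' :=
  LinearMap.ext fun v => (h v).2.symm.trans (h' v).2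

theorem of_finite (h : ∀ v, (Function.support fun j => T j v).Finite) : ∃ X, HasPSum T X :=
  ⟨{ toFun := fun v => ∑ᶠ j, T j v
     map_add' := fun v w => by
       simp only [map_add]
       exact finsum_add_distrib (h v) (h w)
     map_smul' := fun c v => by
       simp only [map_smul, RingHom.id_apply]
       exact (smul_finsum c _).symm }, fun v => ⟨h v, rfl⟩⟩

theorem zero : HasPSum (fun _ : ι => (0 : Module.End ℂ V)) 0 := fun v => by
  simp [Function.support]

theorem add (h : HasPSum T X) (h' : HasPSum T' X') :
    HasPSum (fun j => T j + T' j) (X + X') := fun v => by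
  refine ⟨((h v).1.union (h' v).1).subset fun j hj => ?_, ?_⟩
  · by_contra hc
    simp only [Set.mem_union, Function.mem_support, not_or, not_not] at hc
    exact hj (by simp [hc.1, hc.2])
  · simp only [LinearMap.add_apply]
    rw [finsum_add_distrib (h v).1 (h' v).1, (h v).2, (h' v).2]

theorem mul_left (A : Module.End ℂ V) (h : HasPSum T X) :
    HasPSum (fun j => A * T j) (A * X) := fun v => by
  refine ⟨(h v).1.subset fun j hj => ?_, ?_⟩
  · rw [Function.mem_support] at hj ⊢
    intro h0
    exact hj (by simp [h0])
  · simp only [Module.End.mul_apply]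
    rw [← (h v).2, map_finsum A (h v).1]

theorem mul_right (A : Module.End ℂ V) (h : HasPSum T X) :
    HasPSum (fun j => T j * A) (X * A) := fun v => h (A v)

theorem smul (c : ℂ) (h : HasPSum T X) : HasPSum (fun j => c • T j) (c • X) := by
  simpa using h.mul_left (c • 1)

theorem neg (h : HasPSum T X) : HasPSum (fun j => -T j) (-X) := by
  simpa using h.smul (-1)

theorem sub (h : HasPSum T X) (h' : HasPSum T' X') :
    HasPSum (fun j => T j - T' j) (X - X') := by
  simpa [sub_eq_add_neg] using h.add h'.neg

/-- Passes between sums over `j : ℕ`, as in `nprodTerm`, and sums over exponents `x : ℤ`. -/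
theorem of_injective {e : κ → ι} (he : Function.Injective e)
    (h0 : ∀ j, j ∉ Set.range e → T j = 0) :
    HasPSum (fun i => T (e i)) X ↔ HasPSum T X := by
  classical
  refine forall_congr' fun v => and_congr ?_ ?_
  · have h1 : (Function.support fun j => T j v)
        = e '' (Function.support fun i => T (e i) v) := by
      ext j
      constructor
      · intro hj
        by_cases hr : j ∈ Set.range e
        · obtain ⟨i, rfl⟩ := hr
          exact ⟨i, hj, rfl⟩
        · exact absurd (by simp [h0 j hr]) hj
      · rintro ⟨i, hi, rfl⟩
        exact hi
    rw [h1, Set.finite_image_iff he.injOn]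
  · have h1 : ∑ᶠ j, T j v = ∑ᶠ i, T (e i) v := by
      rw [← finsum_mem_range (f := fun j => T j v) he]
      refine finsum_congr fun j => ?_
      by_cases hr : j ∈ Set.range e
      · rw [finsum_eq_if, if_pos hr]
      · rw [finsum_eq_if, if_neg hr, h0 j hr, LinearMap.zero_apply]
    rw [h1]

theorem comp_equiv (e : κ ≃ ι) : HasPSum (fun i => T (e i)) X ↔ HasPSum T X :=
  of_injective e.injective fun j hj => absurd (e.surjective j) hj

theorem congr (h : HasPSum T X) (hT : ∀ j, T j = T' j) : HasPSum T' X := by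
  rwa [show T' = T from (funext hT).symm]

theorem single [DecidableEq ι] (i : ι) (h : ∀ j, j ≠ i → T j = 0) : HasPSum T (T i) := fun v => by
  refine ⟨(Set.finite_singleton i).subset fun j hj => ?_, finsum_eq_single _ i fun j hj => ?_⟩
  · by_contra hc
    exact hj (by simp [h j hc])
  · simp [h j hj]

/-- Joint finiteness has to be assumed: finiteness of the outer sum and of every inner sum does not
imply it, since inner sums may cancel. -/
theorem uncurry {B : ι → κ → Module.End ℂ V} (hB : ∀ i, HasPSum (B i) (T i)) (hT : HasPSum T X)
    (hf : ∀ v, (Function.support fun p : ι × κ => B p.1 p.2 v).Finite) :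
    HasPSum (fun p : ι × κ => B p.1 p.2) X := fun v => by
  refine ⟨hf v, ?_⟩
  rw [finsum_curry _ (hf v), ← (hT v).2]
  exact finsum_congr fun i => (hB i v).2

end HasPSum

end PointwiseSum

/-! ## Expansions of `(x - w)^n` -/

/-- The coefficient of `x ^ a w ^ (n - a)` in the expansion of `(x - w)^n` in `|x| > |w|`. -/
def wOut (n a : ℤ) : ℂ :=
  if a ≤ n then (-1 : ℂ) ^ (n - a).toNat * ((Ring.choose n (n - a).toNat : ℤ) : ℂ) else 0

/-- The coefficient of `x ^ a w ^ (n - a)` in the expansion of `(x - w)^n` in `|w| > |x|`. -/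
def wIn (n a : ℤ) : ℂ :=
  if 0 ≤ a then (-1 : ℂ) ^ n * ((-1 : ℂ) ^ a.toNat * ((Ring.choose n a.toNat : ℤ) : ℂ)) else 0

theorem wOut_of_lt {n a : ℤ} (h : n < a) : wOut n a = 0 := if_neg (by lia)

theorem wIn_of_neg {n a : ℤ} (h : a < 0) : wIn n a = 0 := if_neg (by lia)

theorem wOut_sub (n : ℤ) (j : ℕ) :
    wOut n (n - j) = (-1 : ℂ) ^ j * ((Ring.choose n j : ℤ) : ℂ) := by
  rw [wOut, if_pos (by lia), show (n - (n - (j : ℤ))).toNat = j by lia]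

theorem wIn_natCast (n : ℤ) (j : ℕ) :
    wIn n j = (-1 : ℂ) ^ n * ((-1 : ℂ) ^ j * ((Ring.choose n j : ℤ) : ℂ)) := by
  rw [wIn, if_pos (by lia), Int.toNat_natCast]

theorem signed_choose_succ (n : ℤ) (j : ℕ) :
    (-1 : ℂ) ^ (j + 1) * ((Ring.choose (n + 1) (j + 1) : ℤ) : ℂ)
      = (-1 : ℂ) ^ (j + 1) * ((Ring.choose n (j + 1) : ℤ) : ℂ)
        - (-1 : ℂ) ^ j * ((Ring.choose n j : ℤ) : ℂ) := by
  rw [Ring.choose_succ_succ]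
  push_cast
  ring

/-- Comparison of coefficients in `(x-w)^{n+1} = (x-w)(x-w)^n`. Together with its twin for `wIn`,
this recursion is the main source of later facts about the coefficients. -/
theorem wOut_succ (n a : ℤ) : wOut (n + 1) a = wOut n (a - 1) - wOut n a := by
  rcases lt_trichotomy a (n + 1) with h | rfl | h
  · obtain ⟨j, rfl⟩ : ∃ j : ℕ, a = n - j := ⟨(n - a).toNat, by lia⟩
    rw [show n - (j : ℤ) = n + 1 - ((j + 1 : ℕ) : ℤ) by push_cast; ring, wOut_sub,
      signed_choose_succ, show n + 1 - ((j + 1 : ℕ) : ℤ) - 1 = n - ((j + 1 : ℕ) : ℤ) by ring,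
      show n + 1 - ((j + 1 : ℕ) : ℤ) = n - (j : ℤ) by push_cast; ring, wOut_sub, wOut_sub]
  · have h1 := wOut_sub (n + 1) 0
    have h2 := wOut_sub n 0
    simp only [Nat.cast_zero, sub_zero, Ring.choose_zero_right] at h1 h2
    rw [h1, add_sub_cancel_right, h2, wOut_of_lt (lt_add_one n), sub_zero]
  · rw [wOut_of_lt h, wOut_of_lt (by lia), wOut_of_lt (by lia), sub_zero]

theorem wIn_succ (n a : ℤ) : wIn (n + 1) a = wIn n (a - 1) - wIn n a := by
  rcases lt_trichotomy a 0 with h | rfl | h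
  · rw [wIn_of_neg h, wIn_of_neg h, wIn_of_neg (by lia), sub_zero]
  · have h1 := wIn_natCast (n + 1) 0
    have h2 := wIn_natCast n 0
    simp only [Nat.cast_zero, Ring.choose_zero_right] at h1 h2
    rw [h1, h2, wIn_of_neg (by lia), zpow_add₀ (by norm_num)]
    simp
  · obtain ⟨j, rfl⟩ : ∃ j : ℕ, a = ((j + 1 : ℕ) : ℤ) := ⟨(a - 1).toNat, by lia⟩
    rw [wIn_natCast, wIn_natCast, show ((j + 1 : ℕ) : ℤ) - 1 = (j : ℕ) by push_cast; ring,
      wIn_natCast, signed_choose_succ, zpow_add₀ (by norm_num)]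
    ring

theorem wOut_zero (a : ℤ) : wOut 0 a = if a = 0 then 1 else 0 := by
  split_ifs with h
  · subst h
    simp [wOut]
  · by_cases h0 : a ≤ 0
    · obtain ⟨j, rfl⟩ : ∃ j : ℕ, a = 0 - ((j + 1 : ℕ) : ℤ) := ⟨(-a - 1).toNat, by lia⟩
      rw [wOut_sub, Ring.choose_zero_succ]
      simp
    · exact wOut_of_lt (by lia)

theorem wIn_zero (a : ℤ) : wIn 0 a = if a = 0 then 1 else 0 := by
  split_ifs with h
  · subst h
    simp [wIn]
  · by_cases h0 : 0 ≤ a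
    · obtain ⟨j, rfl⟩ : ∃ j : ℕ, a = ((j + 1 : ℕ) : ℤ) := ⟨(a - 1).toNat, by lia⟩
      rw [wIn_natCast, Ring.choose_zero_succ]
      simp
    · exact wIn_of_neg (by lia)

/-- The two expansions of `1/(x-w)` differ by the formal delta function. Multiplication by `x-w`
kills the difference, so its coefficients are independent of `a`; at `a = -1` only the outer
expansion contributes. -/
theorem wOut_sub_wIn_neg_one (a : ℤ) : wOut (-1) a - wIn (-1) a = 1 := by
  have h1 := wOut_succ (-1)
  have h2 := wIn_succ (-1)
  simp only [neg_add_cancel] at h1 h2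
  have h : ∀ a, wOut (-1) (a - 1) - wIn (-1) (a - 1) = wOut (-1) a - wIn (-1) a := by
    intro a
    have e1 := h1 a
    have e2 := h2 a
    rw [wOut_zero] at e1
    rw [wIn_zero] at e2
    linear_combination e2 - e1
  have h0 : wOut (-1) (-1) - wIn (-1) (-1) = 1 := by
    rw [wIn_of_neg (by lia)]
    simp [wOut]
  induction a using Int.induction_on with
  | zero => rw [← h0, ← h 0]; simp
  | succ i ih => rw [← h, ← ih]; simp
  | pred i ih => rw [h, ih]

/-! ## Shift operators -/

section Shift

variable {M : Type*} [AddCommGroup M] [Module ℂ M]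

/-- Multiplication of `∑ K m n x^{-m-1} y^{-n-1}` by `x - y`. -/
def dif : (ℤ → ℤ → M) →ₗ[ℂ] (ℤ → ℤ → M) where
  toFun K := fun m n => K (m + 1) n - K m (n + 1)
  map_add' K L := by
    funext m n
    simp only [Pi.add_apply]
    abel
  map_smul' c K := by
    funext m n
    simp [smul_sub]

theorem dif_apply (K : ℤ → ℤ → M) (m n : ℤ) : dif K m n = K (m + 1) n - K m (n + 1) := rfl

theorem dif_pow_succ (N : ℕ) (K : ℤ → ℤ → M) : (dif ^ (N + 1)) K = (dif ^ N) (dif K) := by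
  rw [pow_succ, Module.End.mul_apply]

theorem dif_pow_succ' (N : ℕ) (K : ℤ → ℤ → M) : (dif ^ (N + 1)) K = dif ((dif ^ N) K) := by
  rw [pow_succ', Module.End.mul_apply]

theorem dif_pow_eq_zero_mono {K : ℤ → ℤ → M} {N N' : ℕ} (h : N ≤ N') (hK : (dif ^ N) K = 0) :
    (dif ^ N') K = 0 := by
  obtain ⟨k, rfl⟩ := Nat.exists_eq_add_of_le h
  rw [add_comm, pow_add, Module.End.mul_apply, hK, map_zero]

/-- The binomial theorem for the two commuting shifts; it yields the finite sum in which
`VertexAlgebra.locality` is phrased. -/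
theorem dif_pow_apply (N : ℕ) (K : ℤ → ℤ → M) (m n : ℤ) :
    (dif ^ N) K m n = ∑ s ∈ Finset.range (N + 1), ((-1 : ℂ) ^ s * (N.choose s : ℂ)) •
      K (m + N - s) (n + s) := by
  induction N generalizing K m n with
  | zero => simp
  | succ N ih =>
    rw [dif_pow_succ', dif_apply, ih, ih, Finset.sum_range_succ' _ (N + 1),
      Finset.sum_range_succ' _ N, Finset.sum_range_succ _ N]
    simp only [Nat.choose_succ_succ, Nat.choose_self, Nat.choose_zero_right, Nat.cast_add,
      mul_add, add_smul, Finset.sum_add_distrib, pow_succ]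
    rw [Finset.sum_range_succ (n := N) (f := fun x => ((-1 : ℂ) ^ x * -1 * (N.choose x : ℂ)) •
      K (m + (N + (1 : ℕ)) - (x + (1 : ℕ))) (n + (x + (1 : ℕ))))]
    rw [Finset.sum_range_succ (n := N) (f := fun x => ((-1 : ℂ) ^ x * -1 * (N.choose (x + 1) : ℂ)) •
      K (m + (N + (1 : ℕ)) - (x + (1 : ℕ))) (n + (x + (1 : ℕ))))]
    have e1 : ∀ x : ℤ, m + 1 + N - x = m + (N + 1) - x := fun x => by ring
    have e2 : ∀ x : ℤ, m + N - x = m + (N + 1) - (x + 1) := fun x => by ring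
    have e3 : ∀ x : ℤ, n + 1 + x = n + (x + 1) := fun x => by ring
    simp only [Nat.cast_one, Nat.choose_self, Nat.choose_succ_self, Nat.cast_zero,
      mul_zero, zero_smul, e1, e2, e3]
    simp only [mul_neg, mul_one, neg_mul, neg_smul, Finset.sum_neg_distrib]
    abel

end Shift

/-! ## Koszul signs and the algebra of superoperators -/

theorem zmod_two_cases (i : ZMod 2) : i = 0 ∨ i = 1 := by
  revert i
  decide

theorem zmod_two_one_val : (1 : ZMod 2).val = 1 := rfl

theorem zmod_two_one_add_one : (1 : ZMod 2) + 1 = 0 := rfl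

@[simp] theorem koszul_zero_left (i : ZMod 2) : koszul 0 i = 1 := by simp [koszul]

@[simp] theorem koszul_zero_right (i : ZMod 2) : koszul i 0 = 1 := by simp [koszul]

@[simp] theorem koszul_one_one : koszul 1 1 = -1 := by simp [koszul, zmod_two_one_val]

theorem koszul_comm (i j : ZMod 2) : koszul i j = koszul j i := by simp [koszul, mul_comm]

theorem koszul_add_left (i j l : ZMod 2) : koszul (i + j) l = koszul i l * koszul j l := by
  rcases zmod_two_cases i with rfl | rfl <;> rcases zmod_two_cases j with rfl | rfl <;>
    rcases zmod_two_cases l with rfl | rfl <;> simp [zmod_two_one_add_one]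

theorem koszul_add_right (i j l : ZMod 2) : koszul i (j + l) = koszul i j * koszul i l := by
  rw [koszul_comm, koszul_add_left, koszul_comm j, koszul_comm l]

theorem koszul_mul_self (i j : ZMod 2) : koszul i j * koszul i j = 1 := by
  rw [← koszul_add_left, show i + i = 0 from CharTwo.add_self_eq_zero i, koszul_zero_left]

theorem koszul_one_left (i : ZMod 2) : koszul 1 i = (-1) ^ i.val := by
  simp [koszul, zmod_two_one_val]

namespace Superspace

variable {V : Type*} [AddCommGroup V] [Module ℂ V] (S : Superspace V)

theorem par_mul_par : S.par * S.par = 1 := LinearMap.ext S.par_par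

theorem endo_par_eq (T : Module.End ℂ V) : S.endo.par T = S.par * T * S.par := rfl

theorem endo_par_mul (T U : Module.End ℂ V) :
    S.endo.par (T * U) = S.endo.par T * S.endo.par U := by
  simp only [endo_par_eq]
  rw [show S.par * T * S.par * (S.par * U * S.par) = S.par * T * (S.par * S.par) * U * S.par by
    simp only [mul_assoc], par_mul_par, mul_one]
  simp only [mul_assoc]

theorem endo_par_one : S.endo.par 1 = 1 := by
  rw [endo_par_eq, mul_one, par_mul_par]

theorem mem_part_iff {i : ZMod 2} {v : V} : v ∈ S.part i ↔ S.par v = (-1 : ℂ) ^ i.val • v :=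
  Module.End.mem_eigenspace_iff

theorem mem_part_zero {v : V} : v ∈ S.part 0 ↔ S.par v = v := by
  simp [mem_part_iff]

theorem mem_part_one {v : V} : v ∈ S.part 1 ↔ S.par v = -v := by
  simp [mem_part_iff, zmod_two_one_val]

theorem even_apply (v : V) : S.even v = (1 / 2 : ℂ) • (v + S.par v) := rfl

theorem odd_apply (v : V) : S.odd v = (1 / 2 : ℂ) • (v - S.par v) := rfl

/-- The conjugation by the `i`-th power of the parity involution. -/
def tw (i : ZMod 2) : Module.End ℂ V →ₗ[ℂ] Module.End ℂ V := S.endo.par ^ i.val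

@[simp] theorem tw_zero (T : Module.End ℂ V) : S.tw 0 T = T := by simp [tw]

@[simp] theorem tw_one (T : Module.End ℂ V) : S.tw 1 T = S.endo.par T := by
  simp [tw, zmod_two_one_val]

theorem tw_mul (i : ZMod 2) (T U : Module.End ℂ V) : S.tw i (T * U) = S.tw i T * S.tw i U := by
  rcases zmod_two_cases i with rfl | rfl <;> simp [endo_par_mul]

theorem tw_tw (i j : ZMod 2) (T : Module.End ℂ V) : S.tw i (S.tw j T) = S.tw (i + j) T := by
  rcases zmod_two_cases i with rfl | rfl <;> rcases zmod_two_cases j with rfl | rfl <;>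
    simp [zmod_two_one_add_one, S.endo.par_par]

variable {S}

theorem tw_of_mem {j : ZMod 2} {T : Module.End ℂ V} (i : ZMod 2) (h : T ∈ S.endo.part j) :
    S.tw i T = koszul i j • T := by
  rcases zmod_two_cases i with rfl | rfl
  · simp
  · rw [tw_one, koszul_one_left]
    exact S.endo.mem_part_iff.1 h

theorem endo_mul_mem {i j : ZMod 2} {T U : Module.End ℂ V} (hT : T ∈ S.endo.part i)
    (hU : U ∈ S.endo.part j) : T * U ∈ S.endo.part (i + j) := by
  rw [mem_part_iff] at hT hU ⊢
  rw [endo_par_mul, hT, hU, smul_mul_smul_comm]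
  congr 1
  rw [← koszul_one_left, ← koszul_one_left, ← koszul_one_left, koszul_add_right]

theorem tw_mem {i j : ZMod 2} {T : Module.End ℂ V} (hT : T ∈ S.endo.part j) :
    S.tw i T ∈ S.endo.part j := by
  rw [tw_of_mem i hT]
  exact Submodule.smul_mem _ _ hT

variable (S)

theorem swapMul_eq (T U : Module.End ℂ V) :
    S.swapMul T U = U * S.endo.even T + S.endo.par U * S.endo.odd T := by
  simp only [swapMul, even_apply, odd_apply, smul_mul_assoc, mul_smul_comm, smul_smul, sub_mul,
    mul_add, mul_sub]
  module

variable {S}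

/-- Once `T` is homogeneous, the sign `(-1)^{p(T)p(U)}` is a power of the parity automorphism
applied to `U`, so `U` need not be homogeneous. -/
theorem swapMul_of_mem {i : ZMod 2} {T : Module.End ℂ V} (h : T ∈ S.endo.part i)
    (U : Module.End ℂ V) : S.swapMul T U = S.tw i U * T := by
  rcases zmod_two_cases i with rfl | rfl
  · rw [mem_part_zero] at h
    rw [swapMul_eq, even_apply, odd_apply, h, sub_self, smul_zero, mul_zero, add_zero, ← two_smul ℂ,
      smul_smul, tw_zero]
    norm_num
  · rw [mem_part_one] at h
    rw [swapMul_eq, even_apply, odd_apply, h, add_neg_cancel, smul_zero, mul_zero, zero_add,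
      sub_neg_eq_add, ← two_smul ℂ, smul_smul, tw_one]
    norm_num

theorem swapMul_of_mem_mem {i j : ZMod 2} {T U : Module.End ℂ V} (hT : T ∈ S.endo.part i)
    (hU : U ∈ S.endo.part j) : S.swapMul T U = koszul i j • (U * T) := by
  rw [swapMul_of_mem hT, tw_of_mem i hU, smul_mul_assoc]

theorem superComm_of_mem_mem {i j : ZMod 2} {T U : Module.End ℂ V} (hT : T ∈ S.endo.part i)
    (hU : U ∈ S.endo.part j) : S.superComm T U = T * U - koszul i j • (U * T) := by
  rw [superComm, swapMul_of_mem_mem hT hU]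

theorem superComm_of_mem {i : ZMod 2} {T : Module.End ℂ V} (hT : T ∈ S.endo.part i)
    (U : Module.End ℂ V) : S.superComm T U = T * U - S.tw i U * T := by
  rw [superComm, swapMul_of_mem hT]

variable (S)

/-- `swapMul` as a bilinear map. -/
def swapMulL : Module.End ℂ V →ₗ[ℂ] Module.End ℂ V →ₗ[ℂ] Module.End ℂ V :=
  LinearMap.mk₂ ℂ S.swapMul
    (fun T T' U => by simp only [swapMul, map_add, mul_add]; module)
    (fun c T U => by simp only [swapMul, map_smul, mul_smul_comm]; module)
    (fun T U U' => by simp only [swapMul, map_add, add_mul]; module)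
    (fun c T U => by simp only [swapMul, map_smul, smul_mul_assoc]; module)

/-- The supercommutator as a bilinear map. -/
def superCommL : Module.End ℂ V →ₗ[ℂ] Module.End ℂ V →ₗ[ℂ] Module.End ℂ V :=
  LinearMap.mul ℂ _ - S.swapMulL

theorem swapMulL_apply (T U : Module.End ℂ V) : S.swapMulL T U = S.swapMul T U := rfl

theorem superCommL_apply (T U : Module.End ℂ V) : S.superCommL T U = S.superComm T U := rfl

theorem endo_par_swapMul (T U : Module.End ℂ V) :
    S.endo.par (S.swapMul T U) = S.swapMul (S.endo.par T) (S.endo.par U) := by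
  simp only [swapMul, map_sub, map_smul, endo_par_mul, odd_apply]

theorem endo_par_superComm (T U : Module.End ℂ V) :
    S.endo.par (S.superComm T U) = S.superComm (S.endo.par T) (S.endo.par U) := by
  simp only [superComm, map_sub, endo_par_mul, endo_par_swapMul]

/-- Two bilinear expressions agree if they do on homogeneous elements. -/
theorem hom_induction {W : Type*} [AddCommGroup W] [Module ℂ W] (S : Superspace V)
    {f g : V →ₗ[ℂ] W} (h : ∀ i, ∀ v ∈ S.part i, f v = g v) (v : V) : f v = g v := by
  rw [← S.even_add_odd v, map_add, map_add, h 0 _ (S.even_mem v), h 1 _ (S.odd_mem v)]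

variable {S}

theorem superComm_symm {i j : ZMod 2} {T U : Module.End ℂ V} (hT : T ∈ S.endo.part i)
    (hU : U ∈ S.endo.part j) : S.superComm U T = -(koszul i j • S.superComm T U) := by
  rw [superComm_of_mem_mem hT hU, superComm_of_mem_mem hU hT, smul_sub, smul_smul, koszul_mul_self,
    koszul_comm j i]
  module

theorem superComm_mem {i j : ZMod 2} {T U : Module.End ℂ V} (hT : T ∈ S.endo.part i)
    (hU : U ∈ S.endo.part j) : S.superComm T U ∈ S.endo.part (i + j) := by
  rw [superComm_of_mem_mem hT hU]
  exact sub_mem (endo_mul_mem hT hU)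
    (Submodule.smul_mem _ _ (add_comm j i ▸ endo_mul_mem hU hT))

theorem superComm_mul {i : ZMod 2} {D : Module.End ℂ V} (hD : D ∈ S.endo.part i)
    (T U : Module.End ℂ V) :
    S.superComm D (T * U) = S.superComm D T * U + S.tw i T * S.superComm D U := by
  simp only [superComm_of_mem hD, tw_mul]
  noncomm_ring

theorem superComm_tw {i : ZMod 2} (j : ZMod 2) {D : Module.End ℂ V} (hD : D ∈ S.endo.part i)
    (U : Module.End ℂ V) : S.superComm D (S.tw j U) = koszul j i • S.tw j (S.superComm D U) := by
  simp only [superComm_of_mem hD, tw_mul, map_sub, tw_of_mem j hD, tw_tw, add_comm i j,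
    smul_sub, smul_mul_assoc, mul_smul_comm, smul_smul, koszul_mul_self, one_smul]

/-- The companion of `superComm_mul` for the second component of a residue pair; both are needed for
the derivation property of the products. -/
theorem superComm_swapMul {i : ZMod 2} {D : Module.End ℂ V} (hD : D ∈ S.endo.part i)
    (T U : Module.End ℂ V) :
    S.superComm D (S.swapMul T U)
      = S.swapMul (S.superComm D T) U + S.swapMul (S.tw i T) (S.superComm D U) := by
  have := S.endo.hom_induction (f := S.superCommL D ∘ₗ S.swapMulL.flip U)
    (g := S.swapMulL.flip U ∘ₗ S.superCommL D + S.swapMulL.flip (S.superCommL D U) ∘ₗ S.tw i)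
    (fun j T hT => by
      change S.superComm D (S.swapMul T U)
        = S.swapMul (S.superComm D T) U + S.swapMul (S.tw i T) (S.superComm D U)
      rw [swapMul_of_mem hT, swapMul_of_mem (superComm_mem hD hT), superComm_mul hD,
        superComm_tw j hD, swapMul_of_mem (tw_mem hT), tw_of_mem i hT, tw_tw, koszul_comm j i]
      simp only [smul_mul_assoc, mul_smul_comm]
      abel) T
  exact this

theorem superComm_superComm_self {D : Module.End ℂ V} (hD : D ∈ S.endo.part 1) (h : D * D = 0)
    (T : Module.End ℂ V) : S.superComm D (S.superComm D T) = 0 := by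
  rw [superComm_of_mem hD, superComm_of_mem hD, map_sub, tw_mul, tw_mul, tw_tw, tw_of_mem 1 hD,
    zmod_two_one_add_one, tw_zero, koszul_one_one, mul_sub, sub_mul, ← mul_assoc, h, zero_mul,
    mul_assoc T]
  simp only [neg_one_smul, neg_mul, h, neg_zero, mul_zero, mul_assoc]
  abel

end Superspace

/-! ## Residue sums -/

section Residue

variable {V : Type*} [AddCommGroup V] [Module ℂ V]

/-- `J` is the sequence of modes of
`Res_x (i_{|x|>|w|} (x-w)^n F₁(x, w) - i_{|w|>|x|} (x-w)^n F₂(x, w))`. -/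
def HasRes (n : ℤ) (F : ℤ → ℤ → Module.End ℂ V × Module.End ℂ V) (J : ℤ → Module.End ℂ V) :
    Prop :=
  ∀ m, HasPSum (fun x => wOut n x • (F x (m + n - x)).1 - wIn n x • (F x (m + n - x)).2) (J m)

/-- `F₁(x, w) v` is a Laurent series in `w` and `F₂(x, w) v` is a Laurent series in `x`. -/
def Truncated (F : ℤ → ℤ → Module.End ℂ V × Module.End ℂ V) : Prop :=
  ∀ v, ∃ N : ℤ, (∀ x y, N ≤ y → (F x y).1 v = 0) ∧ ∀ x y, N ≤ x → (F x y).2 v = 0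

variable {F G : ℤ → ℤ → Module.End ℂ V × Module.End ℂ V} {J H : ℤ → Module.End ℂ V} {n : ℤ}

theorem HasRes.sub (hF : HasRes n F J) (hG : HasRes n G H) : HasRes n (F - G) (J - H) := fun m =>
  ((hF m).sub (hG m)).congr fun x => by
    simp only [Pi.sub_apply, Prod.fst_sub, Prod.snd_sub, smul_sub]
    abel

theorem HasRes.unique (hF : HasRes n F J) (hG : HasRes n F H) : J = H :=
  funext fun m => (hF m).unique (hG m)

theorem HasRes.of_eq_zero : HasRes n (0 : ℤ → ℤ → Module.End ℂ V × Module.End ℂ V) 0 := fun m =>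
  HasPSum.zero.congr fun x => by simp

theorem Truncated.finite_out (hF : Truncated F) (n m : ℤ) (v : V) :
    (Function.support fun x => (wOut n x • (F x (m + n - x)).1) v).Finite := by
  obtain ⟨N, h1, -⟩ := hF v
  refine (Set.finite_Icc (m + n - N) n).subset fun x hx => ?_
  by_contra hc
  refine hx ?_
  by_cases h : x ≤ n
  · simp only [LinearMap.smul_apply]
    rw [h1 _ _ (by simp at hc; lia), smul_zero]
  · simp [wOut_of_lt (not_le.1 h)]

theorem Truncated.finite_in (hF : Truncated F) (n m : ℤ) (v : V) :
    (Function.support fun x => (wIn n x • (F x (m + n - x)).2) v).Finite := by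
  obtain ⟨N, -, h1⟩ := hF v
  refine (Set.finite_Icc 0 N).subset fun x hx => ?_
  by_contra hc
  refine hx ?_
  by_cases h : 0 ≤ x
  · simp only [LinearMap.smul_apply]
    rw [h1 _ _ (by simp at hc; lia), smul_zero]
  · simp [wIn_of_neg (not_le.1 h)]

theorem Truncated.hasRes (hF : Truncated F) (n : ℤ) : ∃ J, HasRes n F J := by
  choose X hX using fun m => HasPSum.of_finite (hF.finite_out n m)
  choose Y hY using fun m => HasPSum.of_finite (hF.finite_in n m)
  exact ⟨fun m => X m - Y m, fun m => (hX m).sub (hY m)⟩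

theorem Truncated.shift_left (hF : Truncated F) : Truncated fun x y => F (x + 1) y := fun v => by
  obtain ⟨N, h1, h2⟩ := hF v
  exact ⟨N, fun x y h => h1 _ _ h, fun x y h => h2 _ _ (by lia)⟩

theorem Truncated.shift_right (hF : Truncated F) : Truncated fun x y => F x (y + 1) := fun v => by
  obtain ⟨N, h1, h2⟩ := hF v
  exact ⟨N, fun x y h => h1 _ _ (by lia), fun x y h => h2 _ _ h⟩

theorem Truncated.sub (hF : Truncated F) (hG : Truncated G) :
    Truncated fun x y => F x y - G x y := fun v => by
  obtain ⟨N, h1, h2⟩ := hF v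
  obtain ⟨N', h1', h2'⟩ := hG v
  refine ⟨max N N', fun x y h => ?_, fun x y h => ?_⟩
  · simp [h1 x y (le_trans (le_max_left _ _) h), h1' x y (le_trans (le_max_right _ _) h)]
  · simp [h2 x y (le_trans (le_max_left _ _) h), h2' x y (le_trans (le_max_right _ _) h)]

theorem Truncated.dif (hF : Truncated F) : Truncated (dif F) := hF.shift_left.sub hF.shift_right

/-- Both shifted families have residues of their own. Reindexing `x ↦ x - 1` in the first puts both
over the same operators, and the recursions for `wOut` and `wIn` merge the coefficients. -/
theorem HasRes.of_dif (hF : Truncated F) (h : HasRes n (dif F) J) : HasRes (n + 1) F J := by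
  intro m
  obtain ⟨X, hX⟩ := hF.shift_left.hasRes n
  obtain ⟨Y, hY⟩ := hF.shift_right.hasRes n
  have h2 : J m = X m - Y m := by
    have := HasRes.unique h (hX.sub hY)
    rw [this]; rfl
  rw [h2]
  refine (((HasPSum.comp_equiv (Equiv.subRight (1 : ℤ))).2 (hX m)).sub (hY m)).congr fun x => ?_
  simp only [Equiv.subRight_apply, sub_add_cancel, wOut_succ, wIn_succ,
    show m + n - (x - 1) = m + (n + 1) - x by ring, show m + n - x + 1 = m + (n + 1) - x by ring]
  module

theorem hasRes_dif_iff (hF : Truncated F) : HasRes n (dif F) J ↔ HasRes (n + 1) F J := by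
  refine ⟨HasRes.of_dif hF, fun h => ?_⟩
  -- Existence of a residue for `dif F`, combined with uniqueness at exponent `n + 1`, gives the
  -- converse for free.
  obtain ⟨X, hX⟩ := hF.dif.hasRes n
  rwa [h.unique (hX.of_dif hF)]

theorem hasRes_dif_pow_iff (hF : Truncated F) (N : ℕ) :
    HasRes n ((dif ^ N) F) J ↔ HasRes (n + N) F J := by
  induction N generalizing F with
  | zero => simp
  | succ N ih => rw [dif_pow_succ, ih hF.dif, hasRes_dif_iff hF]; push_cast; rw [add_assoc]

theorem hasRes_zero (F : ℤ → ℤ → Module.End ℂ V × Module.End ℂ V) :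
    HasRes 0 F fun m => (F 0 m).1 - (F 0 m).2 := fun m => by
  have := HasPSum.single (T := fun x : ℤ => wOut 0 x • (F x (m + 0 - x)).1
    - wIn 0 x • (F x (m + 0 - x)).2) 0 fun j hj => by simp [wOut_zero, wIn_zero, hj]
  simpa [wOut_zero, wIn_zero] using this

/-- For a nonnegative exponent the two expansions coincide, so only the difference of the components
matters. Induction from exponent `0`, where the residue picks the mode `x = 0`, avoids writing out
binomials. -/
theorem hasRes_natCast (hF : Truncated F) (N : ℕ) :
    HasRes N F fun m => (dif ^ N) (fun x y => (F x y).1 - (F x y).2) 0 m := by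
  have h := (hasRes_dif_pow_iff (n := 0) hF N).1 (hasRes_zero _)
  rw [zero_add] at h
  convert h using 2 with m
  clear h hF
  induction N generalizing F with
  | zero => simp
  | succ N ih =>
    rw [dif_pow_succ, dif_pow_succ, ← ih]
    have e : dif (fun x y => (F x y).1 - (F x y).2)
        = fun x y => (dif F x y).1 - (dif F x y).2 := by
      funext x y
      simp only [dif_apply, Prod.fst_sub, Prod.snd_sub]
      abel
    rw [e]

end Residue

/-! ### The `n`-th product as a residue. -/

section NProd

variable {V : Type*} [AddCommGroup V] [Module ℂ V] (S : Superspace V)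

/-- The families of operators `a(x) b(w)` and `± b(w) a(x)`. -/
def pairing (a b : VField V) (x y : ℤ) : Module.End ℂ V × Module.End ℂ V :=
  (ncoeff a x * ncoeff b y, S.swapMul (ncoeff a x) (ncoeff b y))

theorem truncated_pairing (a b : VField V) : Truncated (pairing S a b) := fun v => by
  obtain ⟨N1, h1⟩ := eventually_atTop.1 (ncoeff_eventually b v)
  obtain ⟨N2, h2⟩ := eventually_atTop.1 (ncoeff_eventually a v)
  obtain ⟨N3, h3⟩ := eventually_atTop.1 (ncoeff_eventually a (S.par v))
  refine ⟨max N1 (max N2 N3), fun x y h => ?_, fun x y h => ?_⟩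
  · simp [pairing, h1 y (by lia)]
  · exact swapMul_zero S _ _ v (h2 _ (by lia)) (h3 _ (by lia))

/-- The coefficients `wOut n` live on the exponents `n - j` and `wIn n` on the exponents `j`, with
`j : ℕ`. Extending both halves of `nprodTerm` by zero to all of `ℤ` turns the termwise definition
into a residue, the form used from here on. -/
theorem hasRes_nprod (a b : VField V) (n : ℤ) :
    HasRes n (pairing S a b) (ncoeff (nprod S a n b)) := fun m => by
  have hT := truncated_pairing S a b
  obtain ⟨X, hX⟩ := HasPSum.of_finite (hT.finite_out n m)
  obtain ⟨Y, hY⟩ := HasPSum.of_finite (hT.finite_in n m)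
  have h1 := (HasPSum.of_injective (e := fun j : ℕ => n - (j : ℤ))
    (fun i j h => by simpa using h) (fun x hx => by
      rw [wOut_of_lt, zero_smul]
      by_contra hc
      exact hx ⟨(n - x).toNat, by simp only; lia⟩)).2 hX
  have h2 := (HasPSum.of_injective (e := fun j : ℕ => (j : ℤ))
    (fun i j h => by simpa using h) (fun x hx => by
      rw [wIn_of_neg, zero_smul]
      by_contra hc
      exact hx ⟨x.toNat, by simp only; lia⟩)).2 hY
  have h3 : HasPSum (nprodTerm S a b n m) (X - Y) := by
    refine (h1.sub h2).congr fun j => ?_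
    rw [wOut_sub, wIn_natCast, nprodTerm, pairing, show m + n - (n - (j : ℤ)) = m + j by ring]
    simp only [pairing, smul_sub, smul_smul]
    congr 2
    ring
  have h4 : HasPSum (nprodTerm S a b n m) (nprodMode S a b n m) := fun v =>
    ⟨nprodTerm_finite S a b n m v, rfl⟩
  change HasPSum _ (nprodMode S a b n m)
  rw [h4.unique h3]
  exact hX.sub hY

variable {S} in
theorem nprod_eq_of_hasRes {a b c : VField V} {n : ℤ}
    (h : HasRes n (pairing S a b) (ncoeff c)) : nprod S a n b = c :=
  field_ext fun m => congr_fun ((hasRes_nprod S a b n).unique h) m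

/-- The supercommutators of the modes of two fields. -/
def bracketModes (a b : VField V) (x y : ℤ) : Module.End ℂ V :=
  S.superComm (ncoeff a x) (ncoeff b y)

/-- This is how locality is used: if the `N`-th power of `dif` kills the supercommutators, then all
products with index at least `N` vanish. -/
theorem ncoeff_nprod_natCast (a b : VField V) (N : ℕ) (m : ℤ) :
    ncoeff (nprod S a N b) m = (dif ^ N) (bracketModes S a b) 0 m :=
  congr_fun ((hasRes_nprod S a b N).unique (hasRes_natCast (truncated_pairing S a b) N)) m

theorem ncoeff_nprod_zero (a b : VField V) (m : ℤ) :
    ncoeff (nprod S a 0 b) m = S.superComm (ncoeff a 0) (ncoeff b m) := by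
  simpa [bracketModes] using ncoeff_nprod_natCast S a b 0 m

theorem nprod_zero_eq_adField (a b : VField V) :
    nprod S a 0 b = adField S (ncoeff a 0) b :=
  field_ext fun m => ncoeff_nprod_zero S a b m

end NProd

/-! ## Elementary properties of the `n`-th products -/

/-- Upwards, the recursion propagates the vanishing of the row `n = 0`. Downwards, a vanishing row
makes the row below it constant in `x`, and one known zero per row finishes. -/
theorem eq_zero_of_recursion {E : ℤ → ℤ → ℂ} (h : ∀ n x, E (n + 1) x = E n (x - 1) - E n x)
    (h0 : ∀ x, E 0 x = 0) (hb : ∀ n, ∃ x, E n x = 0) (n x : ℤ) : E n x = 0 := by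
  induction n using Int.induction_on generalizing x with
  | zero => exact h0 x
  | succ i ih => rw [h, ih, ih, sub_zero]
  | pred i ih =>
    have hc : ∀ x, E (-i - 1) (x - 1) = E (-i - 1) x := fun x => by
      rw [← sub_eq_zero, ← h, sub_add_cancel, ih]
    obtain ⟨y, hy⟩ := hb (-i - 1)
    have : ∀ z : ℤ, E (-i - 1) (y + z) = 0 := fun z => by
      induction z using Int.induction_on with
      | zero => simpa
      | succ k hk => rw [← hc, ← hk]; ring_nf
      | pred k hk => rw [← hk, ← hc (y + -k)]; ring_nf
    simpa using this (x - y)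

/-- The coefficient form of `∂_w (x-w)^n = -n (x-w)^{n-1}`. -/
theorem sub_mul_wOut (n x : ℤ) : ((x : ℂ) - n) * wOut n x = n * wOut (n - 1) x := by
  rw [← sub_eq_zero]
  -- The exponent `n + 1` lies above the supports of both `wOut n` and `wOut (n - 1)`, which
  -- provides the required zero in each row.
  refine eq_zero_of_recursion (E := fun n x => ((x : ℂ) - n) * wOut n x - n * wOut (n - 1) x)
    (fun n x => ?_) (fun x => ?_) (fun n => ⟨n + 1, ?_⟩) n x
  · have h1 := wOut_succ n x
    have h2 := wOut_succ (n - 1) x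
    rw [sub_add_cancel] at h2
    simp only [add_sub_cancel_right]
    push_cast
    linear_combination ((x : ℂ) - n - 1) * h1 - (n : ℂ) * h2
  · simp only [wOut_zero]
    split_ifs with h <;> simp [h]
  · simp [wOut_of_lt (show n < n + 1 by lia), wOut_of_lt (show n - 1 < n + 1 by lia)]

theorem sub_mul_wIn (n x : ℤ) : ((x : ℂ) - n) * wIn n x = n * wIn (n - 1) x := by
  rw [← sub_eq_zero]
  refine eq_zero_of_recursion (E := fun n x => ((x : ℂ) - n) * wIn n x - n * wIn (n - 1) x)
    (fun n x => ?_) (fun x => ?_) (fun n => ⟨-1, ?_⟩) n x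
  · have h1 := wIn_succ n x
    have h2 := wIn_succ (n - 1) x
    rw [sub_add_cancel] at h2
    simp only [add_sub_cancel_right]
    push_cast
    linear_combination ((x : ℂ) - n - 1) * h1 - (n : ℂ) * h2
  · simp only [wIn_zero]
    split_ifs with h <;> simp [h]
  · simp [wIn_of_neg (show (-1 : ℤ) < 0 by lia)]

theorem wOut_natCast_eq_wIn (n : ℕ) (x : ℤ) : wOut n x = wIn n x := by
  induction n generalizing x with
  | zero => simp [wOut_zero, wIn_zero]
  | succ n ih => push_cast; rw [wOut_succ, wIn_succ, ih, ih]

theorem wOut_neg_one_right (n : ℤ) : wOut n (-1) = if n = -1 then 1 else 0 := by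
  split_ifs with h
  · subst h
    simp [wOut]
  · by_cases h1 : n < -1
    · exact wOut_of_lt h1
    · obtain ⟨k, rfl⟩ := Int.eq_ofNat_of_zero_le (show 0 ≤ n by lia)
      rw [wOut_natCast_eq_wIn, wIn_of_neg (by lia)]

/-- The derivative of the delta function, obtained by differentiating the case of exponent `-1`; it
makes `a_(-2) 1` the derivative of `a`. -/
theorem wOut_sub_wIn_neg_two (x : ℤ) : wOut (-2) x - wIn (-2) x = -(x + 1) := by
  have h1 := sub_mul_wOut (-1) x
  have h2 := sub_mul_wIn (-1) x
  have h3 := wOut_sub_wIn_neg_one x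
  norm_num at h1 h2
  linear_combination h1 - h2 - ((x : ℂ) + 1) * h3

section NProd

variable {V : Type*} [AddCommGroup V] [Module ℂ V] {n : ℤ}

section HasRes

variable {F G : ℤ → ℤ → Module.End ℂ V × Module.End ℂ V} {J H : ℤ → Module.End ℂ V}

theorem HasRes.add (hF : HasRes n F J) (hG : HasRes n G H) : HasRes n (F + G) (J + H) := fun m =>
  ((hF m).add (hG m)).congr fun x => by
    simp only [Pi.add_apply, Prod.fst_add, Prod.snd_add, smul_add]
    abel

theorem HasRes.smul (c : ℂ) (hF : HasRes n F J) : HasRes n (c • F) (c • J) := fun m =>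
  ((hF m).smul c).congr fun x => by
    simp only [Pi.smul_apply, Prod.smul_fst, Prod.smul_snd]
    module

theorem HasRes.mul_left (A : Module.End ℂ V) (hF : HasRes n F J) :
    HasRes n (fun x y => (A * (F x y).1, A * (F x y).2)) (fun m => A * J m) := fun m =>
  ((hF m).mul_left A).congr fun x => by
    simp only [mul_sub, mul_smul_comm]

theorem HasRes.mul_right (A : Module.End ℂ V) (hF : HasRes n F J) :
    HasRes n (fun x y => ((F x y).1 * A, (F x y).2 * A)) (fun m => J m * A) := fun m =>
  ((hF m).mul_right A).congr fun x => by
    simp only [sub_mul, smul_mul_assoc]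

theorem HasRes.congr (hF : HasRes n F J) (h : ∀ x y, F x y = G x y) : HasRes n G J := by
  rwa [show G = F from (funext fun x => funext fun y => h x y).symm]

end HasRes

@[simp] theorem ncoeff_zero (n : ℤ) : ncoeff (0 : VField V) n = 0 := rfl

@[simp] theorem ncoeff_neg (a : VField V) (n : ℤ) : ncoeff (-a) n = -ncoeff a n := rfl

@[simp] theorem ncoeff_sub (a b : VField V) (n : ℤ) :
    ncoeff (a - b) n = ncoeff a n - ncoeff b n := rfl

/-- The `n`-th mode as a linear map. -/
def ncoeffL (n : ℤ) : VField V →ₗ[ℂ] Module.End ℂ V where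
  toFun a := ncoeff a n
  map_add' _ _ := rfl
  map_smul' _ _ := rfl

theorem ncoeff_oneField (n : ℤ) : ncoeff (oneField : VField V) n = if n = -1 then 1 else 0 := rfl

variable (S : Superspace V)

theorem ncoeff_par (a : VField V) (n : ℤ) :
    ncoeff ((fieldSuper S).par a) n = S.endo.par (ncoeff a n) := rfl

variable {S} in
theorem mem_field_part {i : ZMod 2} {a : VField V} :
    a ∈ (fieldSuper S).part i ↔ ∀ n, ncoeff a n ∈ S.endo.part i := by
  simp only [Superspace.mem_part_iff]
  exact ⟨fun h n => by rw [← ncoeff_par, h, ncoeff_smul], fun h => field_ext h⟩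

/-- The `n`-th product as a bilinear map. -/
def nprodL (n : ℤ) : VField V →ₗ[ℂ] VField V →ₗ[ℂ] VField V :=
  LinearMap.mk₂ ℂ (fun a b => nprod S a n b)
    (fun a a' b => nprod_eq_of_hasRes
      (((hasRes_nprod S a b n).add (hasRes_nprod S a' b n)).congr fun x y => by
        simp [pairing, add_mul, ← Superspace.swapMulL_apply]))
    (fun c a b => nprod_eq_of_hasRes
      (((hasRes_nprod S a b n).smul c).congr fun x y => by
        simp [pairing, ← Superspace.swapMulL_apply]))
    (fun a b b' => nprod_eq_of_hasRes
      (((hasRes_nprod S a b n).add (hasRes_nprod S a b' n)).congr fun x y => by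
        simp [pairing, mul_add, ← Superspace.swapMulL_apply]))
    (fun c a b => nprod_eq_of_hasRes
      (((hasRes_nprod S a b n).smul c).congr fun x y => by
        simp [pairing, ← Superspace.swapMulL_apply]))

theorem nprodL_apply (a b : VField V) : nprodL S n a b = nprod S a n b := rfl

theorem nprod_add_left (a a' b : VField V) (n : ℤ) :
    nprod S (a + a') n b = nprod S a n b + nprod S a' n b := (nprodL S n).map_add₂ a a' b

theorem nprod_add_right (a b b' : VField V) (n : ℤ) :
    nprod S a n (b + b') = nprod S a n b + nprod S a n b' := (nprodL S n a).map_add b b'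

theorem nprod_smul_left (c : ℂ) (a b : VField V) (n : ℤ) :
    nprod S (c • a) n b = c • nprod S a n b := (nprodL S n).map_smul₂ c a b

theorem nprod_smul_right (c : ℂ) (a b : VField V) (n : ℤ) :
    nprod S a n (c • b) = c • nprod S a n b := (nprodL S n a).map_smul c b

theorem nprod_zero_left (b : VField V) (n : ℤ) : nprod S 0 n b = 0 := (nprodL S n).map_zero₂ b

theorem nprod_zero_right (a : VField V) (n : ℤ) : nprod S a n 0 = 0 := (nprodL S n a).map_zero

theorem nprod_sum_left {ι : Type*} (s : Finset ι) (a : ι → VField V) (b : VField V) (n : ℤ) :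
    nprod S (∑ i ∈ s, a i) n b = ∑ i ∈ s, nprod S (a i) n b :=
  (nprodL S n).map_sum₂ s a b

theorem nprod_sum_right {ι : Type*} (s : Finset ι) (a : VField V) (b : ι → VField V) (n : ℤ) :
    nprod S a n (∑ i ∈ s, b i) = ∑ i ∈ s, nprod S a n (b i) :=
  map_sum (nprodL S n a) b s

variable {S}

/-- An even operator that intertwines `a` with `a'` and `b` with `b'` intertwines their
products. -/
theorem nprod_intertwine {G : Module.End ℂ V} (hG : G * S.par = S.par * G) {a a' b b' : VField V}
    (ha : ∀ n, G * ncoeff a n = ncoeff a' n * G) (hb : ∀ n, G * ncoeff b n = ncoeff b' n * G)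
    (n m : ℤ) : G * ncoeff (nprod S a n b) m = ncoeff (nprod S a' n b') m * G := by
  have hm : ∀ T T' U U' : Module.End ℂ V, G * T = T' * G → G * U = U' * G →
      G * (T * U) = T' * U' * G := fun T T' U U' h h' => by
    rw [← mul_assoc, h, mul_assoc, h', mul_assoc]
  have hp : ∀ T T' : Module.End ℂ V, G * T = T' * G →
      G * S.endo.par T = S.endo.par T' * G := fun T T' h =>
    hm _ _ _ _ (hm _ _ _ _ hG h) hG
  have ho : ∀ T T' : Module.End ℂ V, G * T = T' * G →
      G * S.endo.odd T = S.endo.odd T' * G := fun T T' h => by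
    rw [Superspace.odd_apply, Superspace.odd_apply, mul_smul_comm, smul_mul_assoc, mul_sub,
      sub_mul, h, hp T T' h]
  refine congr_fun (HasRes.unique ((hasRes_nprod S a b n).mul_left G)
    (((hasRes_nprod S a' b' n).mul_right G).congr fun x y => ?_)) m
  simp only [pairing, Superspace.swapMul, Prod.mk.injEq]
  refine ⟨(hm _ _ _ _ (ha x) (hb y)).symm, ?_⟩
  rw [sub_mul, mul_sub, smul_mul_assoc, mul_smul_comm, hm _ _ _ _ (hb y) (ha x),
    hm _ _ _ _ (ho _ _ (hb y)) (ho _ _ (ha x))]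

/-- The parity involution of the underlying space intertwines `a` with its parity conjugate, so this
is an instance of `nprod_intertwine`. -/
theorem par_nprod (a b : VField V) (n : ℤ) : (fieldSuper S).par (nprod S a n b)
    = nprod S ((fieldSuper S).par a) n ((fieldSuper S).par b) := by
  have h : ∀ (a : VField V) (n : ℤ), S.par * ncoeff a n
      = ncoeff ((fieldSuper S).par a) n * S.par := fun a n => by
    rw [ncoeff_par, Superspace.endo_par_eq, mul_assoc, S.par_mul_par, mul_one]
  refine field_ext fun m => ?_
  rw [ncoeff_par, Superspace.endo_par_eq, nprod_intertwine rfl (h a) (h b), mul_assoc,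
    S.par_mul_par, mul_one]

theorem nprod_mem_part {i j : ZMod 2} {a b : VField V} (ha : a ∈ (fieldSuper S).part i)
    (hb : b ∈ (fieldSuper S).part j) (n : ℤ) : nprod S a n b ∈ (fieldSuper S).part (i + j) := by
  rw [Superspace.mem_part_iff] at ha hb ⊢
  rw [par_nprod, ha, hb, nprod_smul_left, nprod_smul_right, smul_smul, ← koszul_one_left,
    ← koszul_one_left, ← koszul_one_left, koszul_add_right]

theorem oneField_mem_part : (oneField : VField V) ∈ (fieldSuper S).part 0 := by
  refine mem_field_part.2 fun n => ?_
  rw [ncoeff_oneField, Superspace.mem_part_zero]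
  split_ifs
  · exact S.endo_par_one
  · simp

theorem par_oneField : (fieldSuper S).par oneField = oneField :=
  (fieldSuper S).mem_part_zero.1 oneField_mem_part

variable (S)

theorem nprod_oneField_left (b : VField V) (n : ℤ) :
    nprod S oneField n b = if n = -1 then b else 0 := by
  refine nprod_eq_of_hasRes fun m => ?_
  have h := HasPSum.single (T := fun x => wOut n x • (pairing S oneField b x (m + n - x)).1
    - wIn n x • (pairing S oneField b x (m + n - x)).2) (-1) fun j hj => by
      simp [pairing, ncoeff_oneField, hj, ← Superspace.swapMulL_apply]
  have e : wOut n (-1) • (pairing S oneField b (-1) (m + n - (-1))).1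
      - wIn n (-1) • (pairing S oneField b (-1) (m + n - (-1))).2
      = ncoeff (if n = -1 then b else 0) m := by
    rw [wIn_of_neg (by lia), wOut_neg_one_right, zero_smul, sub_zero]
    split_ifs with hn
    · simp [pairing, ncoeff_oneField, hn]
    · simp
  rwa [e] at h

/-- The products `a_(n) 1` have the modes of the derivatives of `a`. -/
theorem ncoeff_nprod_oneField_right (a : VField V) (n m : ℤ) :
    ncoeff (nprod S a n oneField) m
      = (wOut n (m + n + 1) - wIn n (m + n + 1)) • ncoeff a (m + n + 1) := by
  have h0 : ∀ T : Module.End ℂ V, S.swapMul T 1 = T := fun T => by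
    rw [Superspace.swapMul_eq, S.endo_par_one, one_mul, one_mul, S.endo.even_add_odd]
  have h := HasPSum.single (T := fun x => wOut n x • (pairing S a oneField x (m + n - x)).1
    - wIn n x • (pairing S a oneField x (m + n - x)).2) (m + n + 1) fun j hj => by
      have : m + n - j ≠ -1 := by lia
      simp [pairing, ncoeff_oneField, this, ← Superspace.swapMulL_apply]
  rw [((hasRes_nprod S a oneField n) m).unique h]
  simp only [pairing, ncoeff_oneField]
  rw [if_pos (by ring), mul_one, h0, sub_smul]

theorem nprod_neg_one_oneField (a : VField V) : nprod S a (-1) oneField = a :=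
  field_ext fun m => by
    rw [ncoeff_nprod_oneField_right, wOut_sub_wIn_neg_one, one_smul, neg_add_cancel_right]

theorem nprod_natCast_oneField (a : VField V) (n : ℕ) : nprod S a n oneField = 0 :=
  field_ext fun m => by
    rw [ncoeff_nprod_oneField_right, wOut_natCast_eq_wIn, sub_self, zero_smul, ncoeff_zero]

theorem ncoeff_nprod_neg_two_oneField (a : VField V) (m : ℤ) :
    ncoeff (nprod S a (-2) oneField) m = -(m : ℂ) • ncoeff a (m - 1) := by
  rw [ncoeff_nprod_oneField_right, wOut_sub_wIn_neg_two, show m + -2 + 1 = m - 1 by ring]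
  congr 1
  push_cast
  ring

/-- The derivative `∂_w` of the residue acts on `b(w)` and on the kernel `(x-w)^n`; the second
contribution is the right-hand side. -/
theorem nprod_translation (a b : VField V) (n : ℤ) :
    nprod S (nprod S a n b) (-2) oneField - nprod S a n (nprod S b (-2) oneField)
      = -(n : ℂ) • nprod S a (n - 1) b := by
  refine field_ext fun m => ?_
  have h1 := ((hasRes_nprod S a b n) (m - 1)).smul (-(m : ℂ))
  have h2 := (hasRes_nprod S a (nprod S b (-2) oneField) n) m
  have h3 := ((hasRes_nprod S a b (n - 1)) m).smul (-(n : ℂ))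
  rw [ncoeff_sub, ncoeff_smul, ncoeff_nprod_neg_two_oneField]
  refine (h1.sub h2).unique (h3.congr fun x => ?_)
  simp only [pairing, ncoeff_nprod_neg_two_oneField, show m - 1 + n - x = m + n - x - 1 by ring,
    show m + (n - 1) - x = m + n - x - 1 by ring]
  simp only [← Superspace.swapMulL_apply, map_smul, mul_smul_comm, smul_sub, smul_smul]
  -- The two derivatives contribute `-m` and `m + n - x`, whose sum is `n - x`; this is the factor
  -- that lowers the exponent of the kernel.
  rw [neg_mul, neg_mul, ← sub_mul_wOut, ← sub_mul_wIn]
  push_cast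
  module

variable {S}

/-- The supercommutator with a homogeneous operator is a derivation of all products. -/
theorem adField_nprod {i : ZMod 2} {D : Module.End ℂ V} (hD : D ∈ S.endo.part i)
    {a a' : VField V} (ha : ∀ n, ncoeff a' n = S.tw i (ncoeff a n)) (b : VField V) (n : ℤ) :
    adField S D (nprod S a n b) = nprod S (adField S D a) n b + nprod S a' n (adField S D b) := by
  -- The twist of `b` is needed as well: moving `D` past the whole product twists the product, and
  -- hence both of its factors.
  have hb : ∃ b' : VField V, ∀ n, ncoeff b' n = S.tw i (ncoeff b n) := by
    rcases zmod_two_cases i with rfl | rfl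
    · exact ⟨b, fun n => (S.tw_zero _).symm⟩
    · exact ⟨(fieldSuper S).par b, fun n => (S.tw_one _).symm⟩
  obtain ⟨b', hb'⟩ := hb
  have hab : ∀ m, ncoeff (nprod S a' n b') m = S.tw i (ncoeff (nprod S a n b) m) := fun m => by
    rcases zmod_two_cases i with rfl | rfl
    · rw [show a' = a from field_ext fun n => (ha n).trans (S.tw_zero _),
        show b' = b from field_ext fun n => (hb' n).trans (S.tw_zero _), S.tw_zero]
    · rw [show a' = (fieldSuper S).par a from field_ext fun n => (ha n).trans (S.tw_one _),
        show b' = (fieldSuper S).par b from field_ext fun n => (hb' n).trans (S.tw_one _),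
        S.tw_one, ← par_nprod, ncoeff_par]
  refine field_ext fun m => ?_
  change S.superComm D (ncoeff (nprod S a n b) m) = _
  rw [Superspace.superComm_of_mem hD, ← hab, ncoeff_add]
  refine congr_fun (HasRes.unique
    (((hasRes_nprod S a b n).mul_left D).sub ((hasRes_nprod S a' b' n).mul_right D))
    (((hasRes_nprod S (adField S D a) b n).add
      (hasRes_nprod S a' (adField S D b) n)).congr fun x y => ?_)) m
  have e1 := Superspace.superComm_mul hD (ncoeff a x) (ncoeff b y)
  have e2 := Superspace.superComm_swapMul hD (ncoeff a x) (ncoeff b y)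
  have e3 : S.tw i (S.swapMul (ncoeff a x) (ncoeff b y))
      = S.swapMul (S.tw i (ncoeff a x)) (S.tw i (ncoeff b y)) := by
    rcases zmod_two_cases i with rfl | rfl <;> simp [Superspace.endo_par_swapMul]
  rw [Superspace.superComm_of_mem hD (_ * _), S.tw_mul, ← ha, ← hb'] at e1
  rw [Superspace.superComm_of_mem hD (S.swapMul _ _), e3, ← ha, ← hb'] at e2
  simp only [Pi.add_apply, Pi.sub_apply, pairing, Prod.mk_add_mk, Prod.mk_sub_mk, e1, e2]
  rfl

end NProd

/-! ## Locality -/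

section ThreeVariables

variable {M M' : Type*} [AddCommGroup M] [Module ℂ M] [AddCommGroup M'] [Module ℂ M']

theorem dif_pow_map (g : M →ₗ[ℂ] M') (N : ℕ) (K : ℤ → ℤ → M) :
    (dif ^ N) (fun m n => g (K m n)) = fun m n => g ((dif ^ N) K m n) := by
  induction N with
  | zero => simp
  | succ N ih =>
    rw [dif_pow_succ', dif_pow_succ', ih]
    funext m n
    simp [dif_apply]

/-- Multiplication by `x - z` of a series in `x, y, z`. -/
def difXZ : (ℤ → ℤ → ℤ → M) →ₗ[ℂ] (ℤ → ℤ → ℤ → M) where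
  toFun F := fun x y z => F (x + 1) y z - F x y (z + 1)
  map_add' F G := by
    funext x y z
    simp only [Pi.add_apply]
    abel
  map_smul' c F := by
    funext x y z
    simp [smul_sub]

/-- Multiplication by `y - z` of a series in `x, y, z`. -/
def difYZ : (ℤ → ℤ → ℤ → M) →ₗ[ℂ] (ℤ → ℤ → ℤ → M) where
  toFun F := fun x => dif (F x)
  map_add' F G := by
    funext x
    simp only [Pi.add_apply, map_add]
  map_smul' c F := by
    funext x
    simp

/-- The relation `y - z = (x - z) - (x - y)` on which Dong's elimination rests. -/
theorem difYZ_eq (F : ℤ → ℤ → ℤ → M) : difYZ F = difXZ F - dif F := by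
  funext x y z
  simp only [difYZ, difXZ, LinearMap.coe_mk, AddHom.coe_mk, dif_apply, Pi.sub_apply]
  abel

theorem difXZ_comm_difYZ : Commute (difXZ (M := M)) difYZ := by
  refine LinearMap.ext fun F => ?_
  funext x y z
  simp only [difYZ, difXZ, LinearMap.coe_mk, AddHom.coe_mk, dif_apply, Module.End.mul_apply]
  abel

theorem difXZ_comm_dif : Commute (difXZ (M := M)) (dif (M := ℤ → M)) := by
  refine LinearMap.ext fun F => ?_
  funext x y z
  simp only [difXZ, LinearMap.coe_mk, AddHom.coe_mk, dif_apply, Module.End.mul_apply,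
    Pi.sub_apply]
  abel

theorem difYZ_pow_apply (N : ℕ) (F : ℤ → ℤ → ℤ → M) (x : ℤ) :
    (difYZ ^ N) F x = (dif ^ N) (F x) := by
  induction N generalizing F with
  | zero => simp
  | succ N ih => rw [pow_succ, Module.End.mul_apply, ih, dif_pow_succ]; rfl

theorem difXZ_pow_apply (N : ℕ) (F : ℤ → ℤ → ℤ → M) (x y z : ℤ) :
    (difXZ ^ N) F x y z = (dif ^ N) (fun x z => F x y z) x z := by
  induction N generalizing F with
  | zero => simp
  | succ N ih => rw [pow_succ, Module.End.mul_apply, ih, dif_pow_succ]; rfl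

theorem dif_pow_apply_apply (N : ℕ) (F : ℤ → ℤ → ℤ → M) (x y z : ℤ) :
    (dif ^ N) F x y z = (dif ^ N) (fun x y => F x y z) x y := by
  have := congr_fun (congr_fun (dif_pow_map (LinearMap.proj z : (ℤ → M) →ₗ[ℂ] M) N F) x) y
  exact this.symm

end ThreeVariables

/-! ### Residues in three variables and Dong's elimination. -/

section Dong

variable {V : Type*} [AddCommGroup V] [Module ℂ V]

/-- `HasRes` in the first two of three variables. -/
def HasResPar (n : ℤ) (F : ℤ → ℤ → ℤ → Module.End ℂ V × Module.End ℂ V)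
    (J : ℤ → ℤ → Module.End ℂ V) : Prop :=
  ∀ z, HasRes n (fun x y => F x y z) fun m => J m z

/-- `Truncated` in the first two of three variables. -/
def TruncatedPar (F : ℤ → ℤ → ℤ → Module.End ℂ V × Module.End ℂ V) : Prop :=
  ∀ z, Truncated fun x y => F x y z

variable {F : ℤ → ℤ → ℤ → Module.End ℂ V × Module.End ℂ V}
  {J : ℤ → ℤ → Module.End ℂ V} {n : ℤ}

theorem TruncatedPar.difXZ (hF : TruncatedPar F) : TruncatedPar (difXZ F) := fun z =>
  (hF z).shift_left.sub (hF (z + 1))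

theorem TruncatedPar.difYZ (hF : TruncatedPar F) : TruncatedPar (difYZ F) := fun z =>
  (hF z).shift_right.sub (hF (z + 1))

theorem TruncatedPar.difXZ_pow (hF : TruncatedPar F) (N : ℕ) :
    TruncatedPar ((QRed.difXZ ^ N) F) := by
  induction N with
  | zero => simpa
  | succ N ih => rw [pow_succ', Module.End.mul_apply]; exact ih.difXZ

theorem TruncatedPar.difYZ_pow (hF : TruncatedPar F) (N : ℕ) :
    TruncatedPar ((QRed.difYZ ^ N) F) := by
  induction N with
  | zero => simpa
  | succ N ih => rw [pow_succ', Module.End.mul_apply]; exact ih.difYZ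

theorem HasResPar.difYZ (h : HasResPar n F J) : HasResPar n (difYZ F) (dif J) := fun z m => by
  refine ((h z (m + 1)).sub (h (z + 1) m)).congr fun x => ?_
  simp only [QRed.difYZ, LinearMap.coe_mk, AddHom.coe_mk, dif_apply, Prod.fst_sub, Prod.snd_sub,
    show m + 1 + n - x = m + n - x + 1 by ring]
  module

theorem HasResPar.difYZ_pow (h : HasResPar n F J) (N : ℕ) :
    HasResPar n ((QRed.difYZ ^ N) F) ((dif ^ N) J) := by
  induction N with
  | zero => simpa
  | succ N ih =>
    rw [pow_succ', pow_succ', Module.End.mul_apply, Module.End.mul_apply]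
    exact ih.difYZ

theorem HasResPar.sub {G : ℤ → ℤ → ℤ → Module.End ℂ V × Module.End ℂ V}
    {H : ℤ → ℤ → Module.End ℂ V} (hF : HasResPar n F J) (hG : HasResPar n G H) :
    HasResPar n (F - G) (J - H) := fun z => (hF z).sub (hG z)

/-- The difference of the two components, as a linear map. -/
def pairDiff : Module.End ℂ V × Module.End ℂ V →ₗ[ℂ] Module.End ℂ V :=
  LinearMap.fst ℂ _ _ - LinearMap.snd ℂ _ _

/-- The two components of `F` agree up to a multiple of `(x - y)^N`. -/
def AgreeXY (N : ℕ) (F : ℤ → ℤ → ℤ → Module.End ℂ V × Module.End ℂ V) : Prop :=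
  (dif ^ N) (fun x y z => pairDiff (F x y z)) = 0

theorem AgreeXY.difXZ {N : ℕ} (h : AgreeXY N F) : AgreeXY N (difXZ F) := by
  have e : (fun x y z => pairDiff (QRed.difXZ F x y z))
      = QRed.difXZ fun x y z => pairDiff (F x y z) := by
    funext x y z
    simp [QRed.difXZ]
  rw [AgreeXY, e]
  have := LinearMap.congr_fun ((difXZ_comm_dif (M := Module.End ℂ V)).pow_right N)
    (fun x y z => pairDiff (F x y z))
  simp only [Module.End.mul_apply] at this
  rw [← this, h, map_zero]

theorem AgreeXY.difYZ {N : ℕ} (h : AgreeXY N F) : AgreeXY N (difYZ F) := by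
  have e : (fun x y z => pairDiff (QRed.difYZ F x y z))
      = (fun x y z => pairDiff (QRed.difXZ F x y z)) - dif fun x y z => pairDiff (F x y z) := by
    funext x y z
    simp [difYZ_eq, dif_apply]
  have h2 : (dif ^ N) (dif fun x y z => pairDiff (F x y z)) = 0 := by
    rw [← dif_pow_succ, dif_pow_succ', h, map_zero]
  rw [AgreeXY, e, map_sub, h.difXZ, h2, sub_zero]

/-- After multiplication by `(x-y)^j` the total exponent is at least `N ≥ 0`, so both expansions
agree and the residue only sees `(x-y)^{n+j}` times the difference of the components, which is zero.
-/
theorem AgreeXY.hasResPar_zero {N j : ℕ} (h : AgreeXY N F) (hF : TruncatedPar F)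
    (hj : (N : ℤ) ≤ n + j) : HasResPar n ((dif ^ j) F) 0 := fun z => by
  have e : (fun x y => (dif ^ j) F x y z) = (dif ^ j) fun x y => F x y z := by
    funext x y
    rw [dif_pow_apply_apply]
  rw [e]
  refine (hasRes_dif_pow_iff (hF z) j).2 ?_
  obtain ⟨N', hN'⟩ := Int.eq_ofNat_of_zero_le (show 0 ≤ n + j by lia)
  rw [hN'] at hj ⊢
  convert hasRes_natCast (hF z) N' using 1
  funext m
  have h2 := congr_fun (congr_fun (congr_fun
    (dif_pow_eq_zero_mono (N' := N') (by exact_mod_cast hj) h) 0) m) z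
  rw [dif_pow_apply_apply] at h2
  exact h2.symm

/-- The elimination at the heart of Dong's lemma: `y - z = (x - z) - (x - y)`. -/
theorem hasResPar_elim {N K : ℕ} (hF : TruncatedPar F) (hxy : AgreeXY N F)
    (hxz : (difXZ ^ N) ((difYZ ^ N) F) = 0) (hK : (N : ℤ) ≤ n + K) (t : ℕ) :
    ∀ j k l : ℕ, (K - j) + (N - k) ≤ t → N + t ≤ l →
      HasResPar n ((dif ^ j) ((difXZ ^ k) ((difYZ ^ l) F))) 0 := by
  have agree : ∀ k l : ℕ, AgreeXY N ((difXZ ^ k) ((difYZ ^ l) F)) := by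
    intro k l
    induction k with
    | zero =>
      induction l with
      | zero => exact hxy
      | succ l ih => rw [pow_zero, pow_succ', Module.End.mul_apply]; exact ih.difYZ
    | succ k ih => rw [pow_succ', Module.End.mul_apply]; exact ih.difXZ
  have large : ∀ j k l : ℕ, K ≤ j → HasResPar n ((dif ^ j) ((difXZ ^ k) ((difYZ ^ l) F))) 0 :=
    fun j k l hj => (agree k l).hasResPar_zero ((hF.difYZ_pow l).difXZ_pow k) (by lia)
  -- The number `t` bounds the factors still missing: `K - j` factors `x - y` or `N - k` factors `x
  -- - z`. Natural subtraction counts surplus factors as zero, and `l ≥ N + t` leaves enough factors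
  -- `y - z` to convert.
  induction t with
  | zero => exact fun j k l h _ => large j k l (by lia)
  | succ t ih =>
    intro j k l h hl
    by_cases hj : K ≤ j
    · exact large j k l hj
    by_cases hk : N ≤ k
    -- With at least `N` factors of both `x - z` and `y - z` the integrand itself vanishes.
    · obtain ⟨k, rfl⟩ := Nat.exists_eq_add_of_le hk
      obtain ⟨l, rfl⟩ := Nat.exists_eq_add_of_le (show N ≤ l by lia)
      have e : (difXZ ^ (N + k)) ((difYZ ^ (N + l)) F) = 0 := by
        have e1 : (difXZ (M := Module.End ℂ V × Module.End ℂ V)) ^ (N + k) * difYZ ^ (N + l)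
            = difXZ ^ k * difYZ ^ l * (difXZ ^ N * difYZ ^ N) := by
          rw [add_comm, add_comm N l, pow_add, pow_add, mul_assoc, mul_assoc,
            ← mul_assoc (difXZ ^ N), ← mul_assoc (difYZ ^ l),
            (difXZ_comm_difYZ.pow_pow N l).eq]
        have := LinearMap.congr_fun e1 F
        simp only [Module.End.mul_apply] at this
        rw [this, hxz, map_zero, map_zero]
      rw [e, map_zero]
      exact fun z => HasRes.of_eq_zero
    -- One factor `y - z` is traded for a factor `x - z` or a factor `x - y`; either choice lowers
    -- `t`.
    · obtain ⟨l, rfl⟩ := Nat.exists_eq_add_of_le (show 1 ≤ l by lia)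
      rw [add_comm 1 l, pow_succ' difYZ, Module.End.mul_apply, difYZ_eq, map_sub, map_sub]
      have h1 := ih j (k + 1) l (by lia) (by lia)
      have h2 := ih (j + 1) k l (by lia) (by lia)
      have e : (difXZ ^ k) (dif ((difYZ ^ l) F)) = dif ((difXZ ^ k) ((difYZ ^ l) F)) :=
        LinearMap.congr_fun (difXZ_comm_dif.pow_left k) _
      rw [pow_succ, Module.End.mul_apply] at h1
      rw [dif_pow_succ] at h2
      rw [e]
      simpa using h1.sub h2

theorem HasResPar.dif_pow_eq_zero {N K : ℕ} (h : HasResPar n F J) (hF : TruncatedPar F)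
    (hxy : AgreeXY N F) (hxz : (QRed.difXZ ^ N) ((QRed.difYZ ^ N) F) = 0)
    (hK : (N : ℤ) ≤ n + K) : (dif ^ (N + (K + N))) J = 0 := by
  have h1 := h.difYZ_pow (N + (K + N))
  -- At the start all `K + N` factors are missing, which explains the exponent `N + (K + N)`.
  have h2 := hasResPar_elim hF hxy hxz hK (K + N) 0 0 (N + (K + N)) (by lia) le_rfl
  funext m z
  exact congr_fun ((h1 z).unique (h2 z)) m

end Dong

/-! ### Mutual locality and its stability under products. -/

section Local

variable {V : Type*} [AddCommGroup V] [Module ℂ V] (S : Superspace V)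

/-- Locality of two fields. -/
def Local (a b : VField V) : Prop := ∃ N : ℕ, (dif ^ N) (bracketModes S a b) = 0

variable {S}

/-- Dong's lemma for homogeneous fields. -/
theorem Local.nprod_of_mem {i j l : ZMod 2} {a b c : VField V} (ha : a ∈ (fieldSuper S).part i)
    (hb : b ∈ (fieldSuper S).part j) (hc : c ∈ (fieldSuper S).part l) (hab : Local S a b)
    (hac : Local S a c) (hbc : Local S b c) (n : ℤ) : Local S (nprod S a n b) c := by
  obtain ⟨N1, h1⟩ := hab
  obtain ⟨N2, h2⟩ := hac
  obtain ⟨N3, h3⟩ := hbc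
  obtain ⟨N, hN1, hN2, hN3⟩ : ∃ N, N1 ≤ N ∧ N2 ≤ N ∧ N3 ≤ N :=
    ⟨N1 + N2 + N3, by lia, by lia, by lia⟩
  replace h1 := dif_pow_eq_zero_mono hN1 h1
  replace h2 := dif_pow_eq_zero_mono hN2 h2
  replace h3 := dif_pow_eq_zero_mono hN3 h3
  have hn := mem_field_part.1 (nprod_mem_part ha hb n)
  rw [mem_field_part] at ha hb hc
  set K := bracketModes S
  have eab : ∀ x y, K a b x y = ncoeff a x * ncoeff b y - koszul i j • (ncoeff b y * ncoeff a x) :=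
    fun x y => Superspace.superComm_of_mem_mem (ha x) (hb y)
  have eac : ∀ x z, K a c x z = ncoeff a x * ncoeff c z - koszul i l • (ncoeff c z * ncoeff a x) :=
    fun x y => Superspace.superComm_of_mem_mem (ha x) (hc y)
  have ebc : ∀ y z, K b c y z = ncoeff b y * ncoeff c z - koszul j l • (ncoeff c z * ncoeff b y) :=
    fun x y => Superspace.superComm_of_mem_mem (hb x) (hc y)
  -- The supercommutators of the modes of `a_(n)b` with those of `c` are the residue in `x` of this
  -- pair, which consists of `[a(x)b(y), c(z)]` and `±[b(y)a(x), c(z)]`.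
  let F : ℤ → ℤ → ℤ → Module.End ℂ V × Module.End ℂ V := fun x y z =>
    (ncoeff a x * ncoeff b y * ncoeff c z
      - koszul (i + j) l • (ncoeff c z * (ncoeff a x * ncoeff b y)),
    koszul i j • (ncoeff b y * ncoeff a x * ncoeff c z)
      - koszul (i + j) l • (ncoeff c z * (koszul i j • (ncoeff b y * ncoeff a x))))
  have hJ : HasResPar n F (bracketModes S (nprod S a n b) c) := fun z => by
    have h := ((hasRes_nprod S a b n).mul_right (ncoeff c z)).sub
      (((hasRes_nprod S a b n).mul_left (ncoeff c z)).smul (koszul (i + j) l))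
    have e : (fun m => bracketModes S (nprod S a n b) c m z)
        = (fun m => ncoeff (nprod S a n b) m * ncoeff c z)
          - koszul (i + j) l • fun m => ncoeff c z * ncoeff (nprod S a n b) m :=
      funext fun m => Superspace.superComm_of_mem_mem (hn m) (hc z)
    rw [e]
    refine h.congr fun x y => ?_
    simp only [pairing, Pi.sub_apply, Pi.smul_apply, Prod.smul_mk, Prod.mk_sub_mk, F,
      Superspace.swapMul_of_mem_mem (ha x) (hb y), smul_mul_assoc]
  have hT : TruncatedPar F := fun z v => by
    obtain ⟨M1, t1⟩ := eventually_atTop.1 (ncoeff_eventually b (ncoeff c z v))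
    obtain ⟨M2, t2⟩ := eventually_atTop.1 (ncoeff_eventually b v)
    obtain ⟨M3, t3⟩ := eventually_atTop.1 (ncoeff_eventually a (ncoeff c z v))
    obtain ⟨M4, t4⟩ := eventually_atTop.1 (ncoeff_eventually a v)
    refine ⟨max (max M1 M2) (max M3 M4), fun x y h => ?_, fun x y h => ?_⟩
    · simp [F, t1 y (by lia), t2 y (by lia)]
    · simp [F, t3 x (by lia), t4 x (by lia)]
  have hxy : AgreeXY N F := by
    funext x y z
    let g : Module.End ℂ V →ₗ[ℂ] Module.End ℂ V := LinearMap.mulRight ℂ (ncoeff c z)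
      - koszul (i + j) l • LinearMap.mulLeft ℂ (ncoeff c z)
    have e : (fun x y => pairDiff (F x y z)) = fun x y => g (K a b x y) := by
      funext x y
      rw [eab]
      simp only [pairDiff, F, g, LinearMap.sub_apply, LinearMap.fst_apply, LinearMap.snd_apply,
        LinearMap.smul_apply, LinearMap.mulLeft_apply, LinearMap.mulRight_apply, sub_mul, mul_sub,
        smul_mul_assoc]
      module
    rw [dif_pow_apply_apply, e, dif_pow_map, h1]
    simp
  -- By the Leibniz rule each component is a sum of a term containing `[b, c]`, killed by `(y-z)^N`,
  -- and a term containing `[a, c]`, killed by `(x-z)^N`.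
  have hxz : (difXZ ^ N) ((difYZ ^ N) F) = 0 := by
    let g1 : ℤ → Module.End ℂ V →ₗ[ℂ] Module.End ℂ V × Module.End ℂ V := fun x =>
      (LinearMap.mulLeft ℂ (ncoeff a x)).prod
        ((koszul i j * koszul i l) • LinearMap.mulRight ℂ (ncoeff a x))
    let g2 : ℤ → Module.End ℂ V →ₗ[ℂ] Module.End ℂ V × Module.End ℂ V := fun y =>
      (koszul j l • LinearMap.mulRight ℂ (ncoeff b y)).prod
        (koszul i j • LinearMap.mulLeft ℂ (ncoeff b y))
    have eF : F = (fun x y z => g1 x (K b c y z)) + fun x y z => g2 y (K a c x z) := by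
      funext x y z
      simp only [Pi.add_apply, eac, ebc, g1, g2, F, LinearMap.prod_apply, Function.prod,
        LinearMap.smul_apply, LinearMap.mulLeft_apply, LinearMap.mulRight_apply, Prod.mk_add_mk,
        sub_mul, mul_sub, smul_mul_assoc, mul_smul_comm, koszul_add_left, mul_assoc]
      refine Prod.ext ?_ ?_
      · module
      · simp only
        module
    have z1 : (difYZ ^ N) (fun x y z => g1 x (K b c y z)) = 0 := by
      funext x
      rw [difYZ_pow_apply, dif_pow_map, h3]
      funext y z
      simp
    have z2 : (difXZ ^ N) (fun x y z => g2 y (K a c x z)) = 0 := by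
      funext x y z
      rw [difXZ_pow_apply, dif_pow_map, h2]
      simp
    have e := LinearMap.congr_fun ((difXZ_comm_difYZ
      (M := Module.End ℂ V × Module.End ℂ V)).pow_pow N N).eq (fun x y z => g2 y (K a c x z))
    simp only [Module.End.mul_apply] at e
    rw [eF, map_add, map_add, z1, map_zero, zero_add, e, z2, map_zero]
  obtain ⟨k, hk⟩ : ∃ k : ℕ, (N : ℤ) ≤ n + k := ⟨((N : ℤ) - n).toNat, by lia⟩
  exact ⟨_, hJ.dif_pow_eq_zero hT hxy hxz hk⟩

theorem bracketModes_add_left (a a' b : VField V) :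
    bracketModes S (a + a') b = bracketModes S a b + bracketModes S a' b := by
  funext x y
  exact S.superCommL.map_add₂ _ _ _

theorem bracketModes_smul_left (r : ℂ) (a b : VField V) :
    bracketModes S (r • a) b = r • bracketModes S a b := by
  funext x y
  exact S.superCommL.map_smul₂ _ _ _

theorem bracketModes_add_right (a b b' : VField V) :
    bracketModes S a (b + b') = bracketModes S a b + bracketModes S a b' := by
  funext x y
  exact (S.superCommL _).map_add _ _

theorem bracketModes_smul_right (r : ℂ) (a b : VField V) :
    bracketModes S a (r • b) = r • bracketModes S a b := by
  funext x y
  exact (S.superCommL _).map_smul _ _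

theorem Local.add_left {a a' b : VField V} (h : Local S a b) (h' : Local S a' b) :
    Local S (a + a') b := by
  obtain ⟨N, h⟩ := h
  obtain ⟨N', h'⟩ := h'
  refine ⟨max N N', ?_⟩
  rw [bracketModes_add_left, map_add, dif_pow_eq_zero_mono (le_max_left _ _) h,
    dif_pow_eq_zero_mono (le_max_right _ _) h', add_zero]

theorem Local.smul_left (r : ℂ) {a b : VField V} (h : Local S a b) : Local S (r • a) b := by
  obtain ⟨N, h⟩ := h
  exact ⟨N, by rw [bracketModes_smul_left, map_smul, h, smul_zero]⟩

theorem Local.add_right {a b b' : VField V} (h : Local S a b) (h' : Local S a b') :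
    Local S a (b + b') := by
  obtain ⟨N, h⟩ := h
  obtain ⟨N', h'⟩ := h'
  refine ⟨max N N', ?_⟩
  rw [bracketModes_add_right, map_add, dif_pow_eq_zero_mono (le_max_left _ _) h,
    dif_pow_eq_zero_mono (le_max_right _ _) h', add_zero]

theorem Local.smul_right (r : ℂ) {a b : VField V} (h : Local S a b) : Local S a (r • b) := by
  obtain ⟨N, h⟩ := h
  exact ⟨N, by rw [bracketModes_smul_right, map_smul, h, smul_zero]⟩

theorem Local.zero_left (b : VField V) : Local S 0 b :=
  ⟨0, by simpa using bracketModes_smul_left (S := S) 0 0 b⟩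

theorem Local.zero_right (a : VField V) : Local S a 0 :=
  ⟨0, by simpa using bracketModes_smul_right (S := S) 0 a 0⟩

theorem Local.par_par {a b : VField V} (h : Local S a b) :
    Local S ((fieldSuper S).par a) ((fieldSuper S).par b) := by
  obtain ⟨N, h⟩ := h
  refine ⟨N, ?_⟩
  have e : bracketModes S ((fieldSuper S).par a) ((fieldSuper S).par b)
      = fun x y => S.endo.par (bracketModes S a b x y) := by
    funext x y
    exact (S.endo_par_superComm _ _).symm
  rw [e, dif_pow_map, h]
  funext x y
  simp

theorem dif_swap (K : ℤ → ℤ → Module.End ℂ V) :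
    dif (fun x y => K y x) = fun x y => -dif K y x := by
  funext x y
  simp only [dif_apply]
  abel

theorem dif_pow_swap (N : ℕ) {K : ℤ → ℤ → Module.End ℂ V} (h : (dif ^ N) K = 0) :
    (dif ^ N) (fun x y => K y x) = 0 := by
  have : (dif ^ N) (fun x y => K y x) = fun x y => (-1 : ℂ) ^ N • (dif ^ N) K y x := by
    clear h
    induction N generalizing K with
    | zero => simp
    | succ N ih =>
      rw [dif_pow_succ, dif_swap]
      have := ih (K := -dif K)
      simp only [Pi.neg_apply] at this
      rw [this, dif_pow_succ, map_neg]
      funext x y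
      simp [pow_succ]
  rw [this, h]
  funext x y
  simp

theorem Local.symm_of_mem {i j : ZMod 2} {a b : VField V} (ha : a ∈ (fieldSuper S).part i)
    (hb : b ∈ (fieldSuper S).part j) (h : Local S a b) : Local S b a := by
  obtain ⟨N, h⟩ := h
  refine ⟨N, ?_⟩
  have e : bracketModes S b a = (-koszul i j) • fun x y => bracketModes S a b y x := by
    funext x y
    rw [Pi.smul_apply, Pi.smul_apply, neg_smul]
    exact Superspace.superComm_symm (mem_field_part.1 ha y) (mem_field_part.1 hb x)
  rw [e, map_smul, dif_pow_swap N h, smul_zero]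

variable (S) in
/-- The subspace of the fields that are local with respect to all fields in `G`. -/
def localSpace (G : Set (VField V)) : Submodule ℂ (VField V) where
  carrier := {a | ∀ g ∈ G, Local S a g}
  zero_mem' g _ := Local.zero_left g
  add_mem' ha hb g hg := (ha g hg).add_left (hb g hg)
  smul_mem' c _ ha g hg := (ha g hg).smul_left c

theorem par_mem_localSpace {G : Set (VField V)} (hG : ∀ g ∈ G, (fieldSuper S).par g ∈ G)
    {a : VField V} (ha : a ∈ localSpace S G) : (fieldSuper S).par a ∈ localSpace S G :=
  fun g hg => by
    have := (ha _ (hG g hg)).par_par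
    rwa [(fieldSuper S).par_par] at this

theorem even_mem_of_par_mem {T : Superspace V} {P : Submodule ℂ V} (hP : ∀ a ∈ P, T.par a ∈ P)
    {a : V} (ha : a ∈ P) : T.even a ∈ P :=
  P.smul_mem _ (P.add_mem ha (hP a ha))

theorem odd_mem_of_par_mem {T : Superspace V} {P : Submodule ℂ V} (hP : ∀ a ∈ P, T.par a ∈ P)
    {a : V} (ha : a ∈ P) : T.odd a ∈ P :=
  P.smul_mem _ (P.sub_mem ha (hP a ha))

/-- In a parity-stable subspace, a property closed under sums may be checked on homogeneous
elements. -/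
theorem hom_induction_on {T : Superspace V} {P : Submodule ℂ V} (hP : ∀ a ∈ P, T.par a ∈ P)
    {p : V → Prop} (hadd : ∀ a b, p a → p b → p (a + b))
    (hhom : ∀ i, ∀ a ∈ P, a ∈ T.part i → p a) {a : V} (ha : a ∈ P) : p a := by
  rw [← T.even_add_odd a]
  exact hadd _ _ (hhom 0 _ (even_mem_of_par_mem hP ha) (T.even_mem a))
    (hhom 1 _ (odd_mem_of_par_mem hP ha) (T.odd_mem a))

/-- Exchanging the two fields costs a sign that is defined only for homogeneous fields, so both
spaces must contain the homogeneous components of their elements. -/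
theorem localSpace_symm {P Q : Submodule ℂ (VField V)} (hP : ∀ a ∈ P, (fieldSuper S).par a ∈ P)
    (hQ : ∀ a ∈ Q, (fieldSuper S).par a ∈ Q) (h : ∀ a ∈ P, ∀ b ∈ Q, Local S a b) :
    ∀ b ∈ Q, ∀ a ∈ P, Local S b a := by
  intro b hb a ha
  refine hom_induction_on hP (p := fun a => Local S b a) (fun _ _ h1 h2 => h1.add_right h2)
    (fun i a ha hi => ?_) ha
  refine hom_induction_on hQ (p := fun b => Local S b a) (fun _ _ h1 h2 => h1.add_left h2)
    (fun j b hb hj => ?_) hb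
  exact (h a ha b hb).symm_of_mem hi hj

/-- Dong's lemma. -/
theorem localSpace_nprod {P Q : Submodule ℂ (VField V)} (hP : ∀ a ∈ P, (fieldSuper S).par a ∈ P)
    (hQ : ∀ a ∈ Q, (fieldSuper S).par a ∈ Q) (hPP : ∀ a ∈ P, ∀ b ∈ P, Local S a b)
    (hPQ : ∀ a ∈ P, ∀ b ∈ Q, Local S a b) {a b c : VField V} (ha : a ∈ P) (hb : b ∈ P)
    (hc : c ∈ Q) (n : ℤ) : Local S (nprod S a n b) c := by
  refine hom_induction_on hP (p := fun a => Local S (nprod S a n b) c) (fun a a' h1 h2 => ?_)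
    (fun i a ha hi => ?_) ha
  · rw [nprod_add_left]
    exact h1.add_left h2
  refine hom_induction_on hP (p := fun b => Local S (nprod S a n b) c) (fun b b' h1 h2 => ?_)
    (fun j b hb hj => ?_) hb
  · rw [nprod_add_right]
    exact h1.add_left h2
  refine hom_induction_on hQ (p := fun c => Local S (nprod S a n b) c)
    (fun c c' h1 h2 => h1.add_right h2) (fun l c hc hl => ?_) hc
  exact Local.nprod_of_mem hi hj hl (hPP a ha b hb) (hPQ a ha c hc) (hPQ b hb c hc) n

theorem Local.oneField_left (b : VField V) : Local S oneField b := by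
  refine ⟨0, ?_⟩
  funext x y
  rw [pow_zero, Module.End.one_apply, bracketModes,
    Superspace.superComm_of_mem (mem_field_part.1 oneField_mem_part x), S.tw_zero,
    ncoeff_oneField]
  split_ifs <;> simp

/-- The fields generated by pairwise local fields are pairwise local. -/
theorem closure_local {G : Set (VField V)} (hG : ∀ g ∈ G, (fieldSuper S).par g ∈ G)
    (hloc : ∀ a ∈ G, ∀ b ∈ G, Local S a b) :
    ∀ a ∈ closure S G, ∀ b ∈ closure S G, Local S a b := by
  have hspan : ∀ a ∈ Submodule.span ℂ G, (fieldSuper S).par a ∈ Submodule.span ℂ G := by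
    intro a ha
    induction ha using Submodule.span_induction with
    | mem a h => exact Submodule.subset_span (hG a h)
    | zero => simp
    | add a b _ _ h1 h2 => rw [map_add]; exact add_mem h1 h2
    | smul c a _ h => rw [map_smul]; exact Submodule.smul_mem _ _ h
  set P := localSpace S G
  have hP : ∀ a ∈ P, (fieldSuper S).par a ∈ P := fun a ha => par_mem_localSpace hG ha
  -- A double commutant: `P` is everything local to `G`, and `Q` is everything local to `P`. Since
  -- `G ⊆ P`, also `Q ⊆ P`, so `Q` is pairwise local. It contains `G`, and Dong's lemma closes it
  -- under products.
  set Q := localSpace S (P : Set (VField V))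
  have hQ : ∀ a ∈ Q, (fieldSuper S).par a ∈ Q := fun a ha => par_mem_localSpace hP ha
  have hGP : G ⊆ P := fun a ha b hb => hloc a ha b hb
  have hspanP : ∀ a ∈ P, ∀ b ∈ Submodule.span ℂ G, Local S a b := by
    intro a ha b hb
    induction hb using Submodule.span_induction with
    | mem b h => exact ha b h
    | zero => exact Local.zero_right a
    | add a b _ _ h1 h2 => exact h1.add_right h2
    | smul c a _ h => exact h.smul_right c
  have hGQ : G ⊆ Q := fun a ha b hb =>
    localSpace_symm hP hspan hspanP a (Submodule.subset_span ha) b hb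
  have hQP : ∀ a ∈ Q, a ∈ P := fun a ha g hg => ha g (hGP hg)
  have hQQ : ∀ a ∈ Q, ∀ b ∈ Q, Local S a b := fun a ha b hb => ha b (hQP b hb)
  have hle : closure S G ≤ Q := sInf_le ⟨fun b _ => Local.oneField_left b, hGQ,
    fun a ha b hb n c hc => localSpace_nprod hQ hP hQQ (fun a ha b hb => ha b hb) ha hb hc n⟩
  exact fun a ha b hb => hQQ a (hle ha) b (hle hb)

end Local

/-! ## The commutator of two left multiplications -/

section Commutator

theorem finite_support_of_fibers {M : Type*} [Zero M] {f : ℤ → ℤ → M} {X : Set ℤ} (hX : X.Finite)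
    (h : ∀ x y, x ∉ X → f x y = 0) (hf : ∀ x, (Function.support (f x)).Finite) :
    (Function.support fun p : ℤ × ℤ => f p.1 p.2).Finite := by
  refine (hX.biUnion fun x _ => ((hf x).image (Prod.mk x))).subset fun p hp => ?_
  have hx : p.1 ∈ X := by
    by_contra hc
    exact hp (h _ _ hc)
  exact Set.mem_biUnion hx ⟨p.2, hp, rfl⟩

variable {V : Type*} [AddCommGroup V] [Module ℂ V] {S : Superspace V}

theorem HasPSum.tw {ι : Type*} {T : ι → Module.End ℂ V} {X : Module.End ℂ V} (h : HasPSum T X)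
    (i : ZMod 2) : HasPSum (fun j => S.tw i (T j)) (S.tw i X) := by
  rcases zmod_two_cases i with rfl | rfl
  · simpa using h
  · simp only [Superspace.tw_one, Superspace.endo_par_eq]
    exact (h.mul_left S.par).mul_right S.par

theorem tw_eventually (i : ZMod 2) (c : VField V) (v : V) :
    ∀ᶠ n : ℤ in atTop, S.tw i (ncoeff c n) v = 0 := by
  rcases zmod_two_cases i with rfl | rfl
  · simpa using ncoeff_eventually c v
  · simpa [ncoeff_par] using ncoeff_eventually ((fieldSuper S).par c) v

/-- The outer coefficients bound both exponents above, and truncation of `c` bounds their sum below;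
so each is bounded on both sides. -/
theorem finite_support_out_out (p q k : ℤ) (T : ℤ → ℤ → Module.End ℂ V) (c : VField V) (v : V) :
    (Function.support fun r : ℤ × ℤ =>
      ((wOut p r.1 * wOut q r.2) • (T r.1 r.2 * ncoeff c (k - r.1 - r.2))) v).Finite := by
  obtain ⟨N, hN⟩ := eventually_atTop.1 (ncoeff_eventually c v)
  refine ((Set.finite_Icc (k - q - N) p).prod (Set.finite_Icc (k - p - N) q)).subset fun r hr => ?_
  by_contra hc
  refine hr ?_
  by_cases h1 : p < r.1
  · simp [wOut_of_lt h1]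
  by_cases h2 : q < r.2
  · simp [wOut_of_lt h2]
  have : N ≤ k - r.1 - r.2 := by
    simp only [Set.mem_prod, Set.mem_Icc, not_and_or, not_le] at hc
    lia
  simp [hN _ this]

/-- The first exponent has a bound coming from `a` alone, but the bound for the second depends on
the vector `a_(x) v`; hence the count is made fibre by fibre. -/
theorem finite_support_in_out (p q k : ℤ) (T : ℤ → ℤ → Module.End ℂ V)
    {c : ℤ → Module.End ℂ V} (hc : ∀ v, ∀ᶠ n in atTop, c n v = 0) (a : VField V) (v : V) :
    (Function.support fun r : ℤ × ℤ =>
      ((wIn p r.1 * wOut q r.2) • (T r.1 r.2 * c (k - r.1 - r.2) * ncoeff a r.1)) v).Finite := by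
  obtain ⟨N, hN⟩ := eventually_atTop.1 (ncoeff_eventually a v)
  refine finite_support_of_fibers (f := fun x y =>
    ((wIn p x * wOut q y) • (T x y * c (k - x - y) * ncoeff a x)) v)
    (Set.finite_Icc 0 N) (fun x y hx => ?_) fun x => ?_
  · rw [Set.mem_Icc, not_and_or, not_le, not_le] at hx
    rcases hx with hx | hx
    · simp [wIn_of_neg hx]
    · simp [hN x hx.le]
  · obtain ⟨N', hN'⟩ := eventually_atTop.1 (hc (ncoeff a x v))
    refine (Set.finite_Icc (k - x - N') q).subset fun y hy => ?_
    by_contra hn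
    refine hy ?_
    rw [Set.mem_Icc, not_and_or, not_le, not_le] at hn
    rcases hn with hn | hn
    · simp [hN' (k - x - y) (by lia)]
    · simp [wOut_of_lt hn]

/-- The operators `K x y`, `x, y ≥ 0`, are finite on every vector. -/
def QuadrantFinite (K : ℤ → ℤ → Module.End ℂ V) : Prop :=
  ∀ v, ∃ N : ℤ, ∀ x y, 0 ≤ x → 0 ≤ y → (N ≤ x ∨ N ≤ y) → K x y v = 0

theorem QuadrantFinite.finite_support {K : ℤ → ℤ → Module.End ℂ V} (hK : QuadrantFinite K)
    (p q : ℤ) (T : ℤ → ℤ → Module.End ℂ V) (v : V) :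
    (Function.support fun r : ℤ × ℤ =>
      ((wIn p r.1 * wIn q r.2) • (T r.1 r.2 * K r.1 r.2)) v).Finite := by
  obtain ⟨N, hN⟩ := hK v
  refine ((Set.finite_Icc 0 N).prod (Set.finite_Icc 0 N)).subset fun r hr => ?_
  by_contra hc
  refine hr ?_
  by_cases h1 : r.1 < 0
  · simp [wIn_of_neg h1]
  by_cases h2 : r.2 < 0
  · simp [wIn_of_neg h2]
  simp only [Set.mem_prod, Set.mem_Icc, not_and_or, not_le] at hc
  simp [hN r.1 r.2 (by lia) (by lia) (by lia)]

theorem quadrantFinite_mul (a b : VField V) :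
    QuadrantFinite fun x y => ncoeff a x * ncoeff b y := fun v => by
  obtain ⟨N, hN⟩ := eventually_atTop.1 (ncoeff_eventually b v)
  have : ∀ᶠ x : ℤ in atTop, ∀ y ∈ Finset.Ico 0 N, ncoeff a x (ncoeff b y v) = 0 := by
    rw [Filter.eventually_all_finset]
    exact fun y _ => ncoeff_eventually a _
  obtain ⟨N', hN'⟩ := eventually_atTop.1 this
  refine ⟨max N N', fun x y hx hy h => ?_⟩
  by_cases hy' : N ≤ y
  · simp [hN y hy']
  · exact hN' x (by lia) y (Finset.mem_Ico.2 ⟨hy, by lia⟩)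

theorem QuadrantFinite.swap {K : ℤ → ℤ → Module.End ℂ V} (hK : QuadrantFinite K) :
    QuadrantFinite fun x y => K y x := fun v => by
  obtain ⟨N, hN⟩ := hK v
  exact ⟨N, fun x y hx hy h => hN y x hy hx h.symm⟩

theorem QuadrantFinite.sub_smul {K K' : ℤ → ℤ → Module.End ℂ V} (hK : QuadrantFinite K)
    (hK' : QuadrantFinite K') (c : ℂ) : QuadrantFinite fun x y => K x y - c • K' x y := fun v => by
  obtain ⟨N, hN⟩ := hK v
  obtain ⟨N', hN'⟩ := hK' v
  exact ⟨max N N', fun x y hx hy h => by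
    simp [hN x y hx hy (by lia), hN' x y hx hy (by lia)]⟩

theorem QuadrantFinite.shift_left {K : ℤ → ℤ → Module.End ℂ V} (hK : QuadrantFinite K) :
    QuadrantFinite fun x y => K (x + 1) y := fun v => by
  obtain ⟨N, hN⟩ := hK v
  exact ⟨N, fun x y hx hy h => hN _ _ (by lia) hy (by lia)⟩

theorem QuadrantFinite.shift_right {K : ℤ → ℤ → Module.End ℂ V} (hK : QuadrantFinite K) :
    QuadrantFinite fun x y => K x (y + 1) := hK.swap.shift_left.swap

theorem QuadrantFinite.dif {K : ℤ → ℤ → Module.End ℂ V} (hK : QuadrantFinite K) :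
    QuadrantFinite (dif K) := by
  have := hK.shift_left.sub_smul hK.shift_right 1
  simp only [one_smul] at this
  exact this

theorem support_add_finite {ι : Type*} {f g : ι → Module.End ℂ V} {v : V}
    (hf : (Function.support fun i => f i v).Finite)
    (hg : (Function.support fun i => g i v).Finite) :
    (Function.support fun i => (f i + g i) v).Finite :=
  (hf.union hg).subset fun i hi => by
    by_contra hc
    simp only [Set.mem_union, Function.mem_support, not_or, not_not] at hc
    exact hi (by simp [hc.1, hc.2])

theorem support_neg_finite {ι : Type*} {f : ι → Module.End ℂ V} {v : V}
    (hf : (Function.support fun i => f i v).Finite) :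
    (Function.support fun i => (-f i) v).Finite :=
  hf.subset fun i hi => by simpa using hi

/-- Each of `a` and `b` stands to the left of `c` with the outer expansion or to its right with the
inner one. This gives the orders `abc`, `acb`, `bca` and `cba`. -/
theorem hasPSum_nprod_nprod {i j : ZMod 2} {a b : VField V} (ha : a ∈ (fieldSuper S).part i)
    (hb : b ∈ (fieldSuper S).part j) (c : VField V) (p q m : ℤ) :
    HasPSum (fun r : ℤ × ℤ =>
      (wOut p r.1 * wOut q r.2) •
        (ncoeff a r.1 * ncoeff b r.2 * ncoeff c (m + p + q - r.1 - r.2))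
      + -((wOut p r.1 * wIn q r.2) •
        (ncoeff a r.1 * S.tw j (ncoeff c (m + p + q - r.1 - r.2)) * ncoeff b r.2))
      + -((wIn p r.1 * wOut q r.2) •
        (S.tw i (ncoeff b r.2) * S.tw i (ncoeff c (m + p + q - r.1 - r.2)) * ncoeff a r.1))
      + (wIn p r.1 * wIn q r.2) •
        (S.tw (i + j) (ncoeff c (m + p + q - r.1 - r.2)) * (S.tw i (ncoeff b r.2) * ncoeff a r.1)))
      (ncoeff (nprod S a p (nprod S b q c)) m) := by
  rw [mem_field_part] at ha hb
  have h1 := hasRes_nprod S a (nprod S b q c) p m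
  have h2 := hasRes_nprod S b c q
  have h3 := HasPSum.uncurry (fun x => (((h2 (m + p - x)).mul_left (ncoeff a x)).smul
    (wOut p x)).sub ((((h2 (m + p - x)).tw (S := S) i).mul_right (ncoeff a x)).smul (wIn p x)))
    (h1.congr fun x => by rw [pairing, Superspace.swapMul_of_mem (ha x)]) ?_
  · refine h3.congr fun r => ?_
    simp only [pairing, Superspace.swapMul_of_mem (hb _), map_sub, map_smul, Superspace.tw_mul,
      Superspace.tw_tw, mul_sub, sub_mul, smul_mul_assoc, mul_smul_comm, mul_assoc,
      show m + p - r.1 + q - r.2 = m + p + q - r.1 - r.2 by ring]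
    module
  · intro v
    have f1 := finite_support_out_out p q (m + p + q) (fun x y => ncoeff a x * ncoeff b y) c v
    have f2 := finite_support_in_out q p (m + p + q) (fun y x => ncoeff a x)
      (tw_eventually (S := S) j c) b v
    have f3 := finite_support_in_out p q (m + p + q) (fun x y => S.tw i (ncoeff b y))
      (tw_eventually (S := S) i c) a v
    have f4 : QuadrantFinite fun x y => S.tw i (ncoeff b y) * ncoeff a x := by
      rcases zmod_two_cases i with rfl | rfl
      · simpa using (quadrantFinite_mul b a).swap
      · simpa [ncoeff_par] using (quadrantFinite_mul ((fieldSuper S).par b) a).swap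
    have f4' := f4.finite_support p q (fun x y => S.tw (i + j) (ncoeff c (m + p + q - x - y))) v
    have f2' : (Function.support fun r : ℤ × ℤ => ((wOut p r.1 * wIn q r.2) •
        (ncoeff a r.1 * S.tw j (ncoeff c (m + p + q - r.1 - r.2)) * ncoeff b r.2)) v).Finite := by
      refine (f2.image Prod.swap).subset fun r hr => ⟨r.swap, ?_, r.swap_swap⟩
      simp only [Function.mem_support, Prod.fst_swap, Prod.snd_swap, mul_comm (wIn q r.2),
        show m + p + q - r.2 - r.1 = m + p + q - r.1 - r.2 by ring]
      exact hr
    refine (support_add_finite (support_add_finite (support_add_finite f1 (support_neg_finite f2'))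
      (support_neg_finite f3)) f4').subset fun r hr => ?_
    rw [Function.mem_support] at hr ⊢
    convert hr using 2
    simp only [pairing, Superspace.swapMul_of_mem (hb _), map_sub, map_smul, Superspace.tw_mul,
      Superspace.tw_tw, mul_sub, sub_mul, smul_mul_assoc, mul_smul_comm, mul_assoc,
      show m + p - r.1 + q - r.2 = m + p + q - r.1 - r.2 by ring]
    module

variable (S) in
/-- The terms of the modes of `Res_x Res_y` of
`i (x-z)^p (y-z)^q K(x, y) c(z) - i' (x-z)^p (y-z)^q c'(z) K(x, y)`. -/
def commTerm (K : ℤ → ℤ → Module.End ℂ V) (c : VField V) (i : ZMod 2) (m p q : ℤ) (r : ℤ × ℤ) :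
    Module.End ℂ V :=
  (wOut p r.1 * wOut q r.2) • (K r.1 r.2 * ncoeff c (m + p + q - r.1 - r.2))
    - (wIn p r.1 * wIn q r.2) • (S.tw i (ncoeff c (m + p + q - r.1 - r.2)) * K r.1 r.2)

/-- The commutator of the left multiplications by two fields. -/
theorem hasPSum_commutator {i j : ZMod 2} {a b : VField V} (ha : a ∈ (fieldSuper S).part i)
    (hb : b ∈ (fieldSuper S).part j) (c : VField V) (m p q : ℤ) :
    HasPSum (commTerm S (bracketModes S a b) c (i + j) m p q)
      (ncoeff (nprod S a p (nprod S b q c) - koszul i j • nprod S b q (nprod S a p c)) m) := by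
  have h1 := hasPSum_nprod_nprod ha hb c p q m
  have h2 := (HasPSum.comp_equiv (Equiv.prodComm ℤ ℤ)).2 (hasPSum_nprod_nprod hb ha c q p m)
  rw [mem_field_part] at ha hb
  -- The orders with `c` in the middle occur in both iterated products with equal signs and cancel;
  -- the others combine into supercommutators of `a` and `b`.
  refine (h1.sub (h2.smul (koszul i j))).congr fun r => ?_
  simp only [commTerm, bracketModes, Superspace.superComm_of_mem_mem (ha _) (hb _),
    Superspace.tw_of_mem _ (ha _), Superspace.tw_of_mem _ (hb _), Equiv.prodComm_apply,
    Prod.fst_swap, Prod.snd_swap, smul_mul_assoc, mul_smul_comm, sub_mul, mul_sub,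
    koszul_comm j i, add_comm j i, show m + q + p - r.2 - r.1 = m + p + q - r.1 - r.2 by ring,
    smul_add, smul_neg, smul_smul, mul_assoc, smul_sub]
  rcases mul_self_eq_one_iff.1 (koszul_mul_self i j) with e | e <;> simp only [e] <;> module

/-- As `x - y = (x - z) - (y - z)`, multiplying the kernel by `x - y` amounts to raising `p` minus
raising `q`, that is, to `dif` in the indices of the products. -/
theorem HasPSum.commTerm_dif {K : ℤ → ℤ → Module.End ℂ V} (hK : QuadrantFinite K) {c : VField V}
    {i : ZMod 2} {m : ℤ} {X : ℤ → ℤ → Module.End ℂ V}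
    (h : ∀ p q, HasPSum (commTerm S K c i m p q) (X p q)) (p q : ℤ) :
    HasPSum (commTerm S (dif K) c i m p q) (dif X p q) := by
  have ex : ∀ K : ℤ → ℤ → Module.End ℂ V, QuadrantFinite K →
      ∃ Z, HasPSum (commTerm S K c i m p q) Z := fun K hK => by
    obtain ⟨Z1, h1⟩ := HasPSum.of_finite fun v =>
      finite_support_out_out p q (m + p + q) K c v
    obtain ⟨Z2, h2⟩ := HasPSum.of_finite fun v =>
      hK.finite_support p q (fun x y => S.tw i (ncoeff c (m + p + q - x - y))) v
    exact ⟨_, h1.sub h2⟩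
  obtain ⟨Z1, h1⟩ := ex _ hK.shift_left
  obtain ⟨Z2, h2⟩ := ex _ hK.shift_right
  have e : Z1 - Z2 = dif X p q := by
    have g1 := (HasPSum.comp_equiv (Equiv.prodCongr (Equiv.subRight (1 : ℤ)) (Equiv.refl ℤ))).2 h1
    have g2 := (HasPSum.comp_equiv (Equiv.prodCongr (Equiv.refl ℤ) (Equiv.subRight (1 : ℤ)))).2 h2
    refine (g1.sub g2).unique (((h (p + 1) q).sub (h p (q + 1))).congr fun r => ?_)
    simp only [commTerm, Equiv.prodCongr_apply, Prod.map_fst, Prod.map_snd, Equiv.subRight_apply,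
      Equiv.refl_apply, sub_add_cancel, wOut_succ, wIn_succ,
      show m + p + q - (r.1 - 1) - r.2 = m + p + q + 1 - r.1 - r.2 by ring,
      show m + p + q - r.1 - (r.2 - 1) = m + p + q + 1 - r.1 - r.2 by ring,
      show m + (p + 1) + q - r.1 - r.2 = m + p + q + 1 - r.1 - r.2 by ring,
      show m + p + (q + 1) - r.1 - r.2 = m + p + q + 1 - r.1 - r.2 by ring]
    module
  rw [← e]
  refine (h1.sub h2).congr fun r => ?_
  simp only [commTerm, dif_apply, sub_mul, mul_sub, smul_sub]
  abel

theorem HasPSum.commTerm_dif_pow {K : ℤ → ℤ → Module.End ℂ V} (hK : QuadrantFinite K)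
    {c : VField V} {i : ZMod 2} {m : ℤ} {X : ℤ → ℤ → Module.End ℂ V}
    (h : ∀ p q, HasPSum (commTerm S K c i m p q) (X p q)) (N : ℕ) (p q : ℤ) :
    HasPSum (commTerm S ((dif ^ N) K) c i m p q) ((dif ^ N) X p q) := by
  induction N generalizing K X with
  | zero => simpa using h p q
  | succ N ih =>
    rw [dif_pow_succ, dif_pow_succ]
    exact ih hK.dif (HasPSum.commTerm_dif hK h)

/-- Left multiplications by mutually local fields are mutually local. -/
theorem dif_pow_nprod_nprod {i j : ZMod 2} {a b : VField V} (ha : a ∈ (fieldSuper S).part i)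
    (hb : b ∈ (fieldSuper S).part j) {N : ℕ} (h : (dif ^ N) (bracketModes S a b) = 0)
    (c : VField V) :
    (dif ^ N) (fun p q => nprod S a p (nprod S b q c) - koszul i j • nprod S b q (nprod S a p c))
      = 0 := by
  have hK : QuadrantFinite (bracketModes S a b) := by
    have := (quadrantFinite_mul a b).sub_smul (quadrantFinite_mul b a).swap (koszul i j)
    rw [mem_field_part] at ha hb
    convert this using 1
    funext x y
    exact Superspace.superComm_of_mem_mem (ha x) (hb y)
  funext p q
  refine field_ext fun m => ?_
  have h1 := HasPSum.commTerm_dif_pow hK (fun p q => hasPSum_commutator ha hb c m p q) N p q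
  rw [h] at h1
  have e := congr_fun (congr_fun (dif_pow_map (ncoeffL m) N fun p q =>
    nprod S a p (nprod S b q c) - koszul i j • nprod S b q (nprod S a p c)) p) q
  change _ = ncoeff _ m at e
  rw [← e]
  refine h1.unique (HasPSum.zero.congr fun r => ?_)
  simp [commTerm]

end Commutator

/-! ## Vertex algebras of fields -/

section VertexAlgebraOfFields

variable {V : Type*} [AddCommGroup V] [Module ℂ V] {S : Superspace V}

/-- A parity-stable space of pairwise local fields that contains the identity field and is closed
under all `n`-th products is a vertex algebra. -/
theorem exists_vertexAlgebra {P : Submodule ℂ (VField V)} (hone : oneField ∈ P)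
    (hpar : ∀ a ∈ P, (fieldSuper S).par a ∈ P)
    (hmul : ∀ a ∈ P, ∀ b ∈ P, ∀ n : ℤ, nprod S a n b ∈ P)
    (hloc : ∀ a ∈ P, ∀ b ∈ P, Local S a b) :
    ∃ A : VertexAlgebra P, (A.vac : VField V) = oneField ∧
      (∀ a, (A.par a : VField V) = (fieldSuper S).par a) ∧
      (∀ a, (A.T a : VField V) = nprod S a (-2) oneField) ∧
      ∀ a b n, (ncoeff (A.Y a) n b : VField V) = nprod S a n b := by
  let mul : P → ℤ → Module.End ℂ P := fun a n =>
    ((nprodL S n a).comp P.subtype).codRestrict P fun b => hmul _ a.2 _ b.2 n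
  -- Locality of `a` and `b` bounds the indices of their nonzero products, so left multiplication by
  -- `a` is a field on `P`.
  have htr : ∀ a b, ∀ᶠ n : ℤ in atTop, mul a n b = 0 := fun a b => by
    obtain ⟨N, hN⟩ := hloc _ a.2 _ b.2
    filter_upwards [eventually_ge_atTop (N : ℤ)] with n hn
    obtain ⟨k, rfl⟩ := Int.eq_ofNat_of_zero_le (show 0 ≤ n by lia)
    refine Subtype.ext (field_ext fun m => ?_)
    change ncoeff (nprod S a k b) m = 0
    rw [ncoeff_nprod_natCast, dif_pow_eq_zero_mono (by lia) hN]
    rfl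
  let Y : P →ₗ[ℂ] VField P :=
    { toFun := fun a => mkField (mul a) (htr a)
      map_add' := fun a a' => field_ext fun n => LinearMap.ext fun b =>
        Subtype.ext (nprod_add_left S a a' b n)
      map_smul' := fun c a => field_ext fun n => LinearMap.ext fun b =>
        Subtype.ext (nprod_smul_left S c a b n) }
  have hY : ∀ a b n, ((ncoeff (Y a) n b : P) : VField V) = nprod S a n b := fun _ _ _ => rfl
  have hpart : ∀ i, ∀ a : P, a ∈ ((fieldSuper S).restrict P hpar).part i →
      (a : VField V) ∈ (fieldSuper S).part i := fun i a ha => by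
    rw [Superspace.mem_part_iff] at ha ⊢
    exact congr_arg Subtype.val ha
  refine ⟨{
    toSuperspace := (fieldSuper S).restrict P hpar
    vac := ⟨oneField, hone⟩
    T := ((nprodL S (-2)).flip oneField ∘ₗ P.subtype).codRestrict P
      fun a => hmul _ a.2 _ hone (-2)
    Y := Y
    par_vac := Subtype.ext par_oneField
    par_Y := fun a b n => Subtype.ext (par_nprod _ _ n)
    T_vac := Subtype.ext ?_
    Y_vac := field_ext fun n => LinearMap.ext fun b => Subtype.ext ?_
    creation := fun a => Subtype.ext (nprod_neg_one_oneField S _)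
    creation_nonneg := fun a n hn => Subtype.ext ?_
    translation := fun a b n => Subtype.ext (nprod_translation S a b n)
    locality := fun i j a ha b hb => ?_ }, rfl, fun _ => rfl, fun _ => rfl, hY⟩
  · change nprod S oneField (-2) oneField = 0
    rw [nprod_oneField_left, if_neg (by norm_num)]
  · rw [hY, nprod_oneField_left, ncoeff_oneField]
    split_ifs <;> rfl
  · obtain ⟨k, rfl⟩ := Int.eq_ofNat_of_zero_le hn
    exact nprod_natCast_oneField S _ k
  · obtain ⟨N, hN⟩ := hloc _ a.2 _ b.2
    refine ⟨N, fun m n => LinearMap.ext fun c => Subtype.ext ?_⟩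
    have h := congr_fun (congr_fun
      (dif_pow_nprod_nprod (hpart i a ha) (hpart j b hb) hN (c : VField V)) m) n
    rw [dif_pow_apply] at h
    rw [LinearMap.sum_apply, AddSubmonoidClass.coe_finsetSum]
    exact h

/-- The quotient of a vertex algebra by an ideal. -/
theorem exists_vertexAlgebra_quotient {W : Type*} [AddCommGroup W] [Module ℂ W]
    (A : VertexAlgebra W) (I : Submodule ℂ W) (hpar : ∀ a ∈ I, A.par a ∈ I)
    (hT : ∀ a ∈ I, A.T a ∈ I) (hl : ∀ a ∈ I, ∀ b n, ncoeff (A.Y a) n b ∈ I)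
    (hr : ∀ a, ∀ b ∈ I, ∀ n, ncoeff (A.Y a) n b ∈ I) :
    ∃ A' : VertexAlgebra (W ⧸ I), A'.vac = I.mkQ A.vac ∧
      (∀ a, A'.par (I.mkQ a) = I.mkQ (A.par a)) ∧
      ∀ a b n, ncoeff (A'.Y (I.mkQ a)) n (I.mkQ b) = I.mkQ (ncoeff (A.Y a) n b) := by
  have hs : Function.Surjective I.mkQ := I.mkQ_surjective
  let Y0 : W →ₗ[ℂ] VField (W ⧸ I) :=
    { toFun := fun a => mkField (fun n => I.mapQ I (ncoeff (A.Y a) n) fun b hb => hr a b hb n)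
        fun v => by
          obtain ⟨b, rfl⟩ := hs v
          filter_upwards [ncoeff_eventually (A.Y a) b] with n hn
          change I.mkQ _ = 0
          rw [hn, map_zero]
      map_add' := fun a a' => field_ext fun n => LinearMap.ext fun v => by
        obtain ⟨b, rfl⟩ := hs v
        change I.mkQ (ncoeff (A.Y (a + a')) n b)
          = I.mkQ (ncoeff (A.Y a) n b) + I.mkQ (ncoeff (A.Y a') n b)
        rw [map_add, ncoeff_add, LinearMap.add_apply, map_add]
      map_smul' := fun c a => field_ext fun n => LinearMap.ext fun v => by
        obtain ⟨b, rfl⟩ := hs v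
        change I.mkQ (ncoeff (A.Y (c • a)) n b) = c • I.mkQ (ncoeff (A.Y a) n b)
        rw [map_smul, ncoeff_smul, LinearMap.smul_apply, map_smul] }
  let Y : (W ⧸ I) →ₗ[ℂ] VField (W ⧸ I) := I.liftQ Y0 fun a ha => field_ext fun n =>
    LinearMap.ext fun v => by
      obtain ⟨b, rfl⟩ := hs v
      exact (Submodule.Quotient.mk_eq_zero I).2 (hl a ha b n)
  have hY : ∀ a b n, ncoeff (Y (I.mkQ a)) n (I.mkQ b) = I.mkQ (ncoeff (A.Y a) n b) :=
    fun _ _ _ => rfl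
  let P : Superspace (W ⧸ I) :=
    { par := I.mapQ I A.par hpar
      par_par := fun v => by
        obtain ⟨a, rfl⟩ := hs v
        change I.mkQ (A.par (A.par a)) = _
        rw [A.par_par] }
  have hP : ∀ a, P.par (I.mkQ a) = I.mkQ (A.par a) := fun _ => rfl
  have hpart : ∀ i, ∀ v ∈ P.part i, ∃ a ∈ A.part i, I.mkQ a = v := fun i v hv => by
    obtain ⟨a, rfl⟩ := hs v
    -- The homogeneous lift is the component of parity `i` of an arbitrary lift. It is needed
    -- because the locality axiom refers to homogeneous vectors.
    refine ⟨(1 / 2 : ℂ) • (a + (-1 : ℂ) ^ i.val • A.par a), ?_, ?_⟩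
    · rw [Superspace.mem_part_iff, map_smul, map_add, map_smul, A.par_par,
        smul_comm ((-1 : ℂ) ^ i.val), smul_add ((-1 : ℂ) ^ i.val), smul_smul ((-1 : ℂ) ^ i.val),
        ← pow_add, Even.neg_one_pow ⟨_, rfl⟩, one_smul, add_comm]
    · rw [Superspace.mem_part_iff, hP] at hv
      rw [map_smul, map_add, map_smul, hv, smul_smul, ← pow_add, Even.neg_one_pow ⟨_, rfl⟩,
        one_smul, ← two_smul ℂ, smul_smul]
      norm_num
  let T : (W ⧸ I) →ₗ[ℂ] (W ⧸ I) := I.mapQ I A.T hT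
  have hTq : ∀ a, T (I.mkQ a) = I.mkQ (A.T a) := fun _ => rfl
  refine ⟨{
    toSuperspace := P
    vac := I.mkQ A.vac
    T := T
    Y := Y
    par_vac := by rw [hP, A.par_vac]
    par_Y := fun v w n => ?_
    T_vac := by rw [hTq, A.T_vac, map_zero]
    Y_vac := field_ext fun n => LinearMap.ext fun v => ?_
    creation := fun v => ?_
    creation_nonneg := fun v n hn => ?_
    translation := fun v w n => ?_
    locality := fun i j v hv w hw => ?_ }, rfl, hP, hY⟩
  · obtain ⟨a, rfl⟩ := hs v
    obtain ⟨b, rfl⟩ := hs w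
    rw [hY, hP, hP, hP, hY, A.par_Y]
  · obtain ⟨b, rfl⟩ := hs v
    rw [hY, A.Y_vac, ncoeff_oneField, ncoeff_oneField]
    split_ifs <;> simp
  · obtain ⟨a, rfl⟩ := hs v
    rw [hY, A.creation]
  · obtain ⟨a, rfl⟩ := hs v
    rw [hY, A.creation_nonneg a n hn, map_zero]
  · obtain ⟨a, rfl⟩ := hs v
    obtain ⟨b, rfl⟩ := hs w
    rw [hY, hTq, hTq, hY, hY, ← map_sub, A.translation, map_smul]
  · obtain ⟨a, ha, rfl⟩ := hpart i v hv
    obtain ⟨b, hb, rfl⟩ := hpart j w hw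
    obtain ⟨N, hN⟩ := A.locality i j a ha b hb
    refine ⟨N, fun m n => LinearMap.ext fun u => ?_⟩
    obtain ⟨c, rfl⟩ := hs u
    have h := congr_arg I.mkQ (LinearMap.congr_fun (hN m n) c)
    simpa only [LinearMap.sum_apply, LinearMap.smul_apply, LinearMap.sub_apply,
      Module.End.mul_apply, LinearMap.zero_apply, map_sum, map_smul, map_sub, hY, map_zero] using h

end VertexAlgebraOfFields

/-! ## Operators on tensor products -/

section Tensor

variable {V W : Type*} [AddCommGroup V] [Module ℂ V] [AddCommGroup W] [Module ℂ W]

/-- The operator `A ⊗ 1`. -/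
def opLeft : Module.End ℂ V →ₗ[ℂ] Module.End ℂ (V ⊗[ℂ] W) := LinearMap.rTensorHom W

/-- The operator `1 ⊗ B`, with the Koszul rule. -/
def opRight (S : Superspace V) (T : Superspace W) :
    Module.End ℂ W →ₗ[ℂ] Module.End ℂ (V ⊗[ℂ] W) :=
  LinearMap.lTensorHom V ∘ₗ T.endo.even + TensorProduct.mapBilinear (.id ℂ) V W V W S.par ∘ₗ T.endo.odd

variable {S : Superspace V} {T : Superspace W}

theorem opLeft_tmul (A : Module.End ℂ V) (v : V) (w : W) : opLeft A (v ⊗ₜ[ℂ] w) = A v ⊗ₜ w := rfl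

theorem opRight_tmul (B : Module.End ℂ W) (v : V) (w : W) : opRight S T B (v ⊗ₜ[ℂ] w)
    = v ⊗ₜ T.endo.even B w + S.par v ⊗ₜ T.endo.odd B w := rfl

theorem opLeft_one : opLeft (1 : Module.End ℂ V) = (1 : Module.End ℂ (V ⊗[ℂ] W)) :=
  TensorProduct.map_id

theorem even_one : T.endo.even 1 = 1 := by
  rw [Superspace.even_apply, T.endo_par_one, ← two_smul ℂ, smul_smul]
  norm_num

theorem odd_one : T.endo.odd 1 = 0 := by
  rw [Superspace.odd_apply, T.endo_par_one, sub_self, smul_zero]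

theorem opRight_one : opRight S T 1 = 1 :=
  TensorProduct.ext' fun v w => by simp [opRight_tmul, even_one, odd_one]

theorem opLeft_mul (A A' : Module.End ℂ V) :
    opLeft (A * A') = opLeft A * (opLeft A' : Module.End ℂ (V ⊗[ℂ] W)) :=
  TensorProduct.ext' fun _ _ => rfl

theorem even_mul (B B' : Module.End ℂ W) : T.endo.even (B * B')
    = T.endo.even B * T.endo.even B' + T.endo.odd B * T.endo.odd B' := by
  simp only [Superspace.even_apply, Superspace.odd_apply, T.endo_par_mul, smul_mul_smul_comm,
    add_mul, mul_add, sub_mul, mul_sub]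
  module

theorem odd_mul (B B' : Module.End ℂ W) : T.endo.odd (B * B')
    = T.endo.even B * T.endo.odd B' + T.endo.odd B * T.endo.even B' := by
  simp only [Superspace.even_apply, Superspace.odd_apply, T.endo_par_mul, smul_mul_smul_comm,
    add_mul, mul_add, sub_mul, mul_sub]
  module

theorem opRight_mul (B B' : Module.End ℂ W) :
    opRight S T (B * B') = opRight S T B * opRight S T B' :=
  TensorProduct.ext' fun v w => by
    simp only [opRight_tmul, even_mul, odd_mul, Module.End.mul_apply, map_add, S.par_par,
      LinearMap.add_apply, tmul_add]
    abel

theorem par_opLeft (A : Module.End ℂ V) :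
    (S.tensor T).endo.par (opLeft A) = opLeft (S.endo.par A) :=
  TensorProduct.ext' fun v w => by
    change (S.par (A (S.par v))) ⊗ₜ[ℂ] T.par (T.par w) = _
    rw [T.par_par]
    rfl

theorem even_odd_par (B : Module.End ℂ W) (w : W) :
    T.par (T.endo.even B (T.par w)) = T.endo.even B w ∧
      T.par (T.endo.odd B (T.par w)) = -T.endo.odd B w :=
  ⟨LinearMap.congr_fun (T.endo.mem_part_zero.1 (T.endo.even_mem B)) w,
    LinearMap.congr_fun (T.endo.mem_part_one.1 (T.endo.odd_mem B)) w⟩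

theorem par_opRight (B : Module.End ℂ W) :
    (S.tensor T).endo.par (opRight S T B) = opRight S T (T.endo.par B) :=
  TensorProduct.ext' fun v w => by
    have h1 : T.endo.even (T.endo.par B) = T.endo.even B := by
      rw [Superspace.even_apply, Superspace.even_apply, T.endo.par_par, add_comm]
    have h2 : T.endo.odd (T.endo.par B) = -T.endo.odd B := by
      rw [Superspace.odd_apply, Superspace.odd_apply, T.endo.par_par, ← smul_neg, neg_sub]
    change (S.tensor T).par (opRight S T B (S.par v ⊗ₜ T.par w)) = _
    rw [opRight_tmul, opRight_tmul, map_add, h1, h2]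
    change S.par (S.par v) ⊗ₜ T.par _ + S.par (S.par (S.par v)) ⊗ₜ[ℂ] T.par _ = _
    rw [(even_odd_par B w).1, (even_odd_par B w).2, S.par_par]
    rfl

/-- Only products and odd parts occur here, so any multiplicative linear map compatible with parity
preserves supercommutators. -/
theorem superComm_eq (A A' : Module.End ℂ V) :
    S.superComm A A' = A * A' - A' * A + (2 : ℂ) • (S.endo.odd A' * S.endo.odd A) := by
  rw [Superspace.superComm, Superspace.swapMul]
  abel

theorem superComm_opLeft (A A' : Module.End ℂ V) :
    (S.tensor T).superComm (opLeft A) (opLeft A') = opLeft (S.superComm A A') := by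
  simp only [superComm_eq, Superspace.odd_apply, par_opLeft, ← map_sub, ← map_smul, ← opLeft_mul,
    ← map_add]

theorem superComm_opRight (B B' : Module.End ℂ W) :
    (S.tensor T).superComm (opRight S T B) (opRight S T B') = opRight S T (T.superComm B B') := by
  simp only [superComm_eq, Superspace.odd_apply, par_opRight, ← map_sub, ← map_smul, ← opRight_mul,
    ← map_add]

theorem opLeft_mem {i : ZMod 2} {A : Module.End ℂ V} (h : A ∈ S.endo.part i) :
    opLeft A ∈ (S.tensor T).endo.part i := by
  rw [Superspace.mem_part_iff] at h ⊢
  rw [par_opLeft, h, map_smul]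

theorem opRight_mem {i : ZMod 2} {B : Module.End ℂ W} (h : B ∈ T.endo.part i) :
    opRight S T B ∈ (S.tensor T).endo.part i := by
  rw [Superspace.mem_part_iff] at h ⊢
  rw [par_opRight, h, map_smul]

theorem superComm_opLeft_opRight_of_mem {i j : ZMod 2} {A : Module.End ℂ V} {B : Module.End ℂ W}
    (hA : A ∈ S.endo.part i) (hB : B ∈ T.endo.part j) :
    (S.tensor T).superComm (opLeft A) (opRight S T B) = 0 := by
  rw [Superspace.superComm_of_mem_mem (opLeft_mem hA) (opRight_mem hB), sub_eq_zero]
  refine TensorProduct.ext' fun v w => ?_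
  rw [LinearMap.smul_apply, Module.End.mul_apply, Module.End.mul_apply, opLeft_tmul, opRight_tmul,
    opRight_tmul, map_add, opLeft_tmul, opLeft_tmul]
  rcases zmod_two_cases j with rfl | rfl
  · have : T.endo.odd B = 0 := by
      rw [Superspace.odd_apply, T.endo.mem_part_zero.1 hB, sub_self, smul_zero]
    rw [this]
    simp
  · have h0 : T.endo.even B = 0 := by
      rw [Superspace.even_apply, T.endo.mem_part_one.1 hB, add_neg_cancel, smul_zero]
    -- The parity involution built into `opRight` produces exactly the sign subtracted in the
    -- supercommutator.
    have h1 : A * S.par = koszul i 1 • (S.par * A) := by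
      have h2 := S.endo.mem_part_iff.1 hA
      rw [S.endo_par_eq, ← koszul_one_left, koszul_comm] at h2
      rw [← mul_smul_comm, ← h2, mul_assoc, ← mul_assoc, S.par_mul_par, one_mul]
    have h2 := LinearMap.congr_fun h1 v
    rw [h0]
    simp only [LinearMap.zero_apply, tmul_zero, zero_add]
    exact congr_arg (· ⊗ₜ[ℂ] T.endo.odd B w) h2

theorem superComm_opLeft_opRight (A : Module.End ℂ V) (B : Module.End ℂ W) :
    (S.tensor T).superComm (opLeft A) (opRight S T B) = 0 := by
  have h1 : ∀ i, ∀ B ∈ T.endo.part i, ∀ A, (S.tensor T).superComm (opLeft A) (opRight S T B) = 0 :=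
    fun i B hB A => S.endo.hom_induction
      (f := (S.tensor T).superCommL.flip (opRight S T B) ∘ₗ opLeft) (g := 0)
      (fun j A hA => superComm_opLeft_opRight_of_mem hA hB) A
  exact T.endo.hom_induction (f := (S.tensor T).superCommL (opLeft A) ∘ₗ opRight S T) (g := 0)
    (fun i B hB => h1 i B hB A) B

theorem superComm_opRight_opLeft (A : Module.End ℂ V) (B : Module.End ℂ W) :
    (S.tensor T).superComm (opRight S T B) (opLeft A) = 0 := by
  have h1 : ∀ i, ∀ B ∈ T.endo.part i, ∀ A, (S.tensor T).superComm (opRight S T B) (opLeft A) = 0 :=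
    fun i B hB A => S.endo.hom_induction
      (f := (S.tensor T).superCommL (opRight S T B) ∘ₗ opLeft) (g := 0)
      (fun j A hA => by
        have := Superspace.superComm_symm (S := S.tensor T) (opLeft_mem hA) (opRight_mem hB)
        rw [superComm_opLeft_opRight, smul_zero, neg_zero] at this
        exact this) A
  exact T.endo.hom_induction (f := (S.tensor T).superCommL.flip (opLeft A) ∘ₗ opRight S T) (g := 0)
    (fun i B hB => h1 i B hB A) B

end Tensor

/-! ## Modes on the vacuum module -/

namespace ModeData

variable {A : Type*} [AddCommGroup A] [Module ℂ A] (R : ModeData A)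

theorem mode_smul (c : ℂ) (a : A) (n : ℤ) : R.mode (c • a) n = c • R.mode a n := by
  simp [mode, freeMode, ← Finsupp.smul_single]

/-- The modes of the fields as linear maps. -/
def fieldMode (n : ℤ) : A →ₗ[ℂ] Module.End ℂ R.Vac where
  toFun a := R.act (R.mode a n)
  map_add' a b := by rw [mode_add, map_add]
  map_smul' c a := by rw [mode_smul, map_smul, RingHom.id_apply]

theorem par_fieldMode (a : A) (n : ℤ) :
    R.vacSuper.endo.par (R.fieldMode n a) = R.fieldMode n (R.par a) := by
  refine LinearMap.ext fun v => ?_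
  obtain ⟨u, rfl⟩ := R.toVac_surjective v
  change R.vacSuper.par (R.act (R.mode a n) (R.toVac (R.parU u))) = R.act _ (R.toVac u)
  rw [act, act_toVac, act_toVac]
  change R.toVac (R.parU _) = _
  rw [map_mul, parU_parU, parU_mode]

theorem fieldMode_mem {i : ZMod 2} {a : A} (h : a ∈ R.part i) (n : ℤ) :
    R.fieldMode n a ∈ R.vacSuper.endo.part i := by
  rw [Superspace.mem_part_iff] at h ⊢
  rw [par_fieldMode, h, map_smul]

/-- `central` as a bilinear form. -/
def centralL (m n : ℤ) : A →ₗ[ℂ] A →ₗ[ℂ] ℂ :=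
  (if m = -n - 1 then R.form0 else 0) + (if m = -n then (m : ℂ) • R.form1 else 0)

theorem centralL_apply (m n : ℤ) (a b : A) : R.centralL m n a b = R.central a b m n := by
  simp only [centralL, central, LinearMap.add_apply]
  split_ifs <;> simp

theorem superComm_fieldMode (a b : A) (m n : ℤ) :
    R.vacSuper.superComm (R.fieldMode m a) (R.fieldMode n b)
      = R.fieldMode (m + n) (R.bracket a b) + R.centralL m n a b • 1 := by
  have h : ∀ i j, ∀ a ∈ R.part i, ∀ b ∈ R.part j,
      R.vacSuper.superComm (R.fieldMode m a) (R.fieldMode n b)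
        = R.fieldMode (m + n) (R.bracket a b) + R.centralL m n a b • 1 := by
    intro i j a ha b hb
    rw [Superspace.superComm_of_mem_mem (R.fieldMode_mem ha m) (R.fieldMode_mem hb n),
      centralL_apply]
    change R.act (R.mode a m) * R.act (R.mode b n) - koszul i j • (R.act (R.mode b n)
      * R.act (R.mode a m)) = R.act (R.mode _ _) + _
    rw [← map_mul, R.mode_comm m n ha hb, map_add, map_add, map_smul, map_mul, AlgHom.commutes,
      Algebra.algebraMap_eq_smul_one]
    abel
  have h2 : ∀ j, ∀ b ∈ R.part j, ∀ a, R.vacSuper.superComm (R.fieldMode m a) (R.fieldMode n b)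
        = R.fieldMode (m + n) (R.bracket a b) + R.centralL m n a b • 1 := fun j b hb a =>
    R.hom_induction (f := R.vacSuper.superCommL.flip (R.fieldMode n b) ∘ₗ R.fieldMode m)
      (g := R.fieldMode (m + n) ∘ₗ R.bracket.flip b
        + ((R.centralL m n).flip b).smulRight (1 : Module.End ℂ R.Vac))
      (fun i a ha => h i j a ha b hb) a
  exact R.hom_induction (f := R.vacSuper.superCommL (R.fieldMode m a) ∘ₗ R.fieldMode n)
      (g := R.fieldMode (m + n) ∘ₗ R.bracket a
        + (R.centralL m n a).smulRight (1 : Module.End ℂ R.Vac))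
      (fun j b hb => h2 j b hb a) b

/-! ### Endomorphisms of mode data and their action on the vacuum module. -/

/-- An even endomorphism that respects the bracket and the forms. -/
structure Endo where
  map : A →ₗ[ℂ] A
  map_par : ∀ a, map (R.par a) = R.par (map a)
  map_bracket : ∀ a b, R.bracket (map a) (map b) = map (R.bracket a b)
  map_form0 : ∀ a b, R.form0 (map a) (map b) = R.form0 a b
  map_form1 : ∀ a b, R.form1 (map a) (map b) = R.form1 a b

namespace Endo

variable {R} (θ : R.Endo)

/-- The induced endomorphism of `U`. -/
def mapU : R.U →ₐ[ℂ] R.U :=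
  RingQuot.liftAlgHom ℂ
    ⟨(RingQuot.mkAlgHom ℂ R.Rel).comp
      (TensorAlgebra.lift ℂ (TensorAlgebra.ι ℂ ∘ₗ Finsupp.mapRange.linearMap θ.map)), by
      rintro _ _ ⟨m, n, ha, hb⟩
      have hp : ∀ {i : ZMod 2} {a : A}, a ∈ R.part i → θ.map a ∈ R.part i := fun h => by
        rw [Superspace.mem_part_iff] at h ⊢
        rw [← θ.map_par, h, map_smul]
      have := R.mode_comm m n (hp ha) (hp hb)
      rw [θ.map_bracket] at this
      simpa [mode, freeMode, central, θ.map_form0, θ.map_form1] using this⟩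

@[simp] theorem mapU_mode (a : A) (n : ℤ) : θ.mapU (R.mode a n) = R.mode (θ.map a) n := by
  simp [mapU, mode, freeMode]

theorem algHom_ext {f g : R.U →ₐ[ℂ] R.U} (h : ∀ a n, f (R.mode a n) = g (R.mode a n)) : f = g := by
  apply RingQuot.ringQuot_ext'
  apply TensorAlgebra.hom_ext
  apply Finsupp.lhom_ext
  intro n a
  exact h a n

theorem mapU_annih :
    R.annih.restrictScalars ℂ ≤ (R.annih.restrictScalars ℂ).comap θ.mapU.toLinearMap := by
  intro u hu
  change θ.mapU u ∈ R.annih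
  change u ∈ R.annih at hu
  induction hu using Submodule.span_induction with
  | mem u h =>
    obtain ⟨a, n, hn, rfl⟩ := h
    rw [mapU_mode]
    exact Submodule.subset_span ⟨_, n, hn, rfl⟩
  | zero => simp
  | add u v _ _ h1 h2 => rw [map_add]; exact add_mem h1 h2
  | smul c u _ h =>
    rw [smul_eq_mul, map_mul]
    exact Submodule.smul_mem _ _ h

/-- The induced endomorphism of the vacuum module. -/
def mapVac : Module.End ℂ R.Vac :=
  ((R.annih.restrictScalars ℂ).mapQ (R.annih.restrictScalars ℂ) θ.mapU.toLinearMap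
    θ.mapU_annih : R.U ⧸ R.annih.restrictScalars ℂ →ₗ[ℂ] R.U ⧸ R.annih.restrictScalars ℂ)

theorem mapVac_toVac (u : R.U) : θ.mapVac (R.toVac u) = R.toVac (θ.mapU u) := rfl

theorem mapVac_mul_fieldMode (a : A) (n : ℤ) :
    θ.mapVac * R.fieldMode n a = R.fieldMode n (θ.map a) * θ.mapVac := by
  refine LinearMap.ext fun v => ?_
  obtain ⟨u, rfl⟩ := R.toVac_surjective v
  change θ.mapVac (R.act (R.mode a n) (R.toVac u)) = R.act _ (θ.mapVac (R.toVac u))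
  rw [act, act_toVac, mapVac_toVac, mapVac_toVac, act_toVac, map_mul, mapU_mode]

theorem mapVac_mul_par : θ.mapVac * R.vacSuper.par = R.vacSuper.par * θ.mapVac := by
  have h : θ.mapU.comp R.parU = R.parU.comp θ.mapU := algHom_ext fun a n => by
    simp [θ.map_par]
  refine LinearMap.ext fun v => ?_
  obtain ⟨u, rfl⟩ := R.toVac_surjective v
  exact congr_arg R.toVac (DFunLike.congr_fun h u)

theorem mapVac_mul_mapVac {θ' : R.Endo} (h : ∀ a, θ.map (θ'.map a) = a) :
    θ.mapVac * θ'.mapVac = 1 := by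
  have h : θ.mapU.comp θ'.mapU = AlgHom.id ℂ _ := algHom_ext fun a n => by simp [h]
  refine LinearMap.ext fun v => ?_
  obtain ⟨u, rfl⟩ := R.toVac_surjective v
  exact congr_arg R.toVac (DFunLike.congr_fun h u)

end Endo

end ModeData

/-! ## Spaces of fields generated by a family with charges -/

section Generated

variable {V : Type*} [AddCommGroup V] [Module ℂ V] {S : Superspace V}

theorem oneField_mem_closure (G : Set (VField V)) : oneField ∈ closure S G :=
  Submodule.mem_sInf.2 fun _ hP => hP.1

theorem subset_closure (G : Set (VField V)) : G ⊆ closure S G := fun _ ha =>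
  Submodule.mem_sInf.2 fun _ hP => hP.2.1 ha

theorem nprod_mem_closure {G : Set (VField V)} {a b : VField V} (ha : a ∈ closure S G)
    (hb : b ∈ closure S G) (n : ℤ) : nprod S a n b ∈ closure S G :=
  Submodule.mem_sInf.2 fun P hP =>
    hP.2.2 a (Submodule.mem_sInf.1 ha P hP) b (Submodule.mem_sInf.1 hb P hP) n

theorem closure_le {G : Set (VField V)} {P : Submodule ℂ (VField V)} (h1 : oneField ∈ P)
    (hG : G ⊆ P) (hP : ∀ a ∈ P, ∀ b ∈ P, ∀ n : ℤ, nprod S a n b ∈ P) : closure S G ≤ P :=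
  sInf_le ⟨h1, hG, hP⟩

theorem par_mem_closure {G : Set (VField V)} (hG : ∀ a ∈ G, (fieldSuper S).par a ∈ G) :
    ∀ a ∈ closure S G, (fieldSuper S).par a ∈ closure S G := by
  refine closure_le (P := (closure S G).comap (fieldSuper S).par) ?_ (fun a ha => ?_)
    fun a ha b hb n => ?_
  · rw [Submodule.mem_comap, par_oneField]
    exact oneField_mem_closure G
  · exact subset_closure G (hG a ha)
  · rw [Submodule.mem_comap, par_nprod]
    exact nprod_mem_closure ha hb n

variable {G : ℤ → Set (VField V)}

theorem nprod_mem_chargePart {m m' : ℤ} {a b : VField V} (ha : a ∈ chargePart S G m)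
    (hb : b ∈ chargePart S G m') (n : ℤ) : nprod S a n b ∈ chargePart S G (m + m') :=
  Generated.nprod n ha hb

theorem par_mem_chargePart (hG : ∀ m, ∀ a ∈ G m, (fieldSuper S).par a ∈ G m) {m : ℤ} :
    ∀ a ∈ chargePart S G m, (fieldSuper S).par a ∈ chargePart S G m := by
  intro a ha
  change Generated S G m a at ha
  induction ha with
  | one => rw [par_oneField]; exact Generated.one
  | gen h => exact Generated.gen (hG _ _ h)
  | nprod n _ _ h1 h2 => rw [par_nprod]; exact Generated.nprod n h1 h2
  | zero m => rw [map_zero]; exact Generated.zero m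
  | add _ _ h1 h2 => rw [map_add]; exact Generated.add h1 h2
  | smul c _ h => rw [map_smul]; exact Generated.smul c h

theorem chargePart_le_closure (m : ℤ) : chargePart S G m ≤ closure S (⋃ m, G m) := by
  intro a ha
  change Generated S G m a at ha
  induction ha with
  | one => exact oneField_mem_closure _
  | gen h => exact subset_closure _ (Set.mem_iUnion.2 ⟨_, h⟩)
  | nprod n _ _ h1 h2 => exact nprod_mem_closure h1 h2 n
  | zero m => exact zero_mem _
  | add _ _ h1 h2 => exact add_mem h1 h2
  | smul c _ h => exact Submodule.smul_mem _ c h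

theorem iSup_chargePart : ⨆ m, chargePart S G m = closure S (⋃ m, G m) := by
  refine le_antisymm (iSup_le chargePart_le_closure) (closure_le ?_ (fun a ha => ?_) ?_)
  · exact Submodule.mem_iSup_of_mem 0 Generated.one
  · obtain ⟨m, hm⟩ := Set.mem_iUnion.1 ha
    exact Submodule.mem_iSup_of_mem m (Generated.gen hm)
  · intro a ha b hb n
    induction ha using Submodule.iSup_induction' with
    | mem m a ha =>
      induction hb using Submodule.iSup_induction' with
      | mem m' b hb => exact Submodule.mem_iSup_of_mem _ (nprod_mem_chargePart ha hb n)
      | zero => rw [nprod_zero_right]; exact zero_mem _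
      | add b b' _ _ h1 h2 => rw [nprod_add_right]; exact add_mem h1 h2
    | zero => rw [nprod_zero_left]; exact zero_mem _
    | add a a' _ _ h1 h2 => rw [nprod_add_left]; exact add_mem h1 h2

/-- If an even invertible operator `Θ` scales the generators of charge `m` by `t^m`, the charge
components are independent. -/
theorem iSupIndep_chargePart {t : ℂ} (ht : Function.Injective fun m : ℤ => t ^ m) (ht0 : t ≠ 0)
    {Θ Θ' : Module.End ℂ V} (hΘ : Θ * S.par = S.par * Θ) (hinv : Θ * Θ' = 1)
    (hG : ∀ m, ∀ a ∈ G m, ∀ n, Θ * ncoeff a n = ncoeff (t ^ m • a) n * Θ) :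
    iSupIndep (chargePart S G) := by
  -- The scaling property passes from the generators to all iterated products by `nprod_intertwine`,
  -- with the charges adding up.
  have key : ∀ m, ∀ a ∈ chargePart S G m, ∀ n, Θ * ncoeff a n = ncoeff (t ^ m • a) n * Θ := by
    intro m a ha
    change Generated S G m a at ha
    induction ha with
    | one =>
      intro n
      rw [zpow_zero, one_smul, ncoeff_oneField]
      split_ifs <;> simp
    | gen h => exact hG _ _ h
    | nprod n _ _ h1 h2 =>
      intro l
      rw [nprod_intertwine hΘ h1 h2, nprod_smul_left, nprod_smul_right, smul_smul, zpow_add₀ ht0]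
    | zero m => intro n; simp
    | add _ _ h1 h2 =>
      intro n
      rw [smul_add, ncoeff_add, ncoeff_add, mul_add, add_mul, h1, h2]
    | smul c _ h =>
      intro n
      rw [smul_comm, ncoeff_smul, ncoeff_smul, mul_smul_comm, h, smul_mul_assoc]
  -- Conjugation by `Θ`. The component of charge `m` lies in its eigenspace for `t^m`, and
  -- eigenspaces for distinct eigenvalues are independent.
  let Ξ : VField V →ₗ[ℂ] VField V :=
    { toFun := fun a => mkField (fun n => Θ * ncoeff a n * Θ') fun v => by
        filter_upwards [ncoeff_eventually a (Θ' v)] with n hn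
        simp [hn]
      map_add' := fun a b => field_ext fun n => by
        change Θ * (ncoeff a n + ncoeff b n) * Θ' = Θ * ncoeff a n * Θ' + Θ * ncoeff b n * Θ'
        rw [mul_add, add_mul]
      map_smul' := fun c a => field_ext fun n => by
        change Θ * (c • ncoeff a n) * Θ' = c • (Θ * ncoeff a n * Θ')
        rw [mul_smul_comm, smul_mul_assoc] }
  have h1 := (Module.End.eigenspaces_iSupIndep Ξ).comp ht
  refine h1.mono fun m a ha => ?_
  refine Module.End.mem_eigenspace_iff.2 (field_ext fun n => ?_)
  change Θ * ncoeff a n * Θ' = _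
  rw [key m a ha, mul_assoc, hinv, mul_one]

/-- A family depending only on `m + n` is killed by one factor `x - y`, while the same factor turns
`m δ_{m,-n}` into such a family; two factors therefore suffice. -/
theorem local_of_bracketModes {a b : VField V} {X : ℤ → Module.End ℂ V} {Z : Module.End ℂ V}
    (h : ∀ m n, S.superComm (ncoeff a m) (ncoeff b n)
      = X (m + n) + (if m = -n then (m : ℂ) else 0) • Z) : Local S a b := by
  refine ⟨2, ?_⟩
  have e : dif (bracketModes S a b) = fun m n => (if m + n = -1 then (1 : ℂ) else 0) • Z := by
    funext m n
    rw [dif_apply, bracketModes, bracketModes, h, h, show m + 1 + n = m + (n + 1) by ring]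
    by_cases hc : m + n = -1
    · rw [if_pos (by lia), if_pos (by lia), if_pos hc]
      push_cast
      module
    · rw [if_neg (by lia), if_neg (by lia), if_neg hc]
      module
  rw [dif_pow_succ, dif_pow_succ, pow_zero, Module.End.one_apply, e]
  funext m n
  rw [dif_apply, show m + 1 + n = m + (n + 1) by ring, sub_self]
  rfl

theorem adField_mem_part {i j : ZMod 2} {D : Module.End ℂ V} (hD : D ∈ S.endo.part i)
    {a : VField V} (ha : a ∈ (fieldSuper S).part j) :
    adField S D a ∈ (fieldSuper S).part (i + j) :=
  mem_field_part.2 fun n => Superspace.superComm_mem hD (mem_field_part.1 ha n)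

end Generated

/-! ## The generating fields of the complex -/

namespace ReductionData

variable {g : Type*} [AddCommGroup g] [Module ℂ g] {L : LieSuperalgebra g} (D : ReductionData L)
  (k : ℂ)

theorem superComm_cur_cur (u v : g) (m n : ℤ) :
    (D.super k).superComm (ncoeff (D.cur k u) m) (ncoeff (D.cur k v) n)
      = ncoeff (D.cur k (L.bracket u v)) (m + n)
        + (if m = -n then (m : ℂ) * (k * D.form u v) else 0) • 1 := by
  have h := superComm_opLeft (T := D.ghostSuper) (S := (D.currents k).vacSuper)
    ((D.currents k).fieldMode m u) ((D.currents k).fieldMode n v)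
  rw [ModeData.superComm_fieldMode, map_add, map_smul, opLeft_one, ModeData.centralL_apply] at h
  refine h.trans ?_
  rw [ModeData.central]
  simp only [currents, LinearMap.zero_apply, ite_self, zero_add, LinearMap.smul_apply, smul_eq_mul]
  rfl

theorem charged_central (φ ψ : D.gPlus × Module.Dual ℂ D.gPlus) (m n : ℤ) :
    D.charged.central φ ψ m n = if m = -n - 1 then D.chForm φ ψ else 0 := by
  change (if m = -n - 1 then D.chForm φ ψ else 0) + (if m = -n then (m : ℂ) * 0 else 0) = _
  simp

theorem neutral_central (a b : D.gr 1) (m n : ℤ) :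
    D.neutral.central a b m n = if m = -n - 1 then D.form D.f (L.bracket a b) else 0 := by
  change (if m = -n - 1 then D.form D.f (L.bracket a b) else 0)
    + (if m = -n then (m : ℂ) * 0 else 0) = _
  simp

theorem superComm_charged (φ ψ : D.gPlus × Module.Dual ℂ D.gPlus) (m n : ℤ) :
    D.charged.vacSuper.superComm (D.charged.fieldMode m φ) (D.charged.fieldMode n ψ)
      = (if m = -n - 1 then D.chForm φ ψ else 0) • 1 := by
  have h0 : D.charged.bracket φ ψ = 0 := rfl
  rw [ModeData.superComm_fieldMode, h0, LinearMap.map_zero, zero_add, ModeData.centralL_apply,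
    charged_central]

theorem superComm_neutral (a b : D.gr 1) (m n : ℤ) :
    D.neutral.vacSuper.superComm (D.neutral.fieldMode m a) (D.neutral.fieldMode n b)
      = (if m = -n - 1 then D.form D.f (L.bracket a b) else 0) • 1 := by
  have h0 : D.neutral.bracket a b = 0 := rfl
  rw [ModeData.superComm_fieldMode, h0, LinearMap.map_zero, zero_add, ModeData.centralL_apply,
    neutral_central]

theorem superComm_gh_gh (φ ψ : D.gPlus × Module.Dual ℂ D.gPlus) (m n : ℤ) :
    (D.super k).superComm (ncoeff (D.gh k φ) m) (ncoeff (D.gh k ψ) n)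
      = (if m = -n - 1 then D.chForm φ ψ else 0) • 1 := by
  have h := superComm_opLeft (T := D.neutral.vacSuper) (S := D.charged.vacSuper)
    (D.charged.fieldMode m φ) (D.charged.fieldMode n ψ)
  have h2 := superComm_opRight (T := D.ghostSuper) (S := (D.currents k).vacSuper)
    (opLeft (D.charged.fieldMode m φ)) (opLeft (D.charged.fieldMode n ψ))
  rw [superComm_charged, LinearMap.map_smul, opLeft_one] at h
  rw [ghostSuper, h, LinearMap.map_smul, opRight_one] at h2
  exact h2

theorem superComm_ne_ne (a b : D.gr 1) (m n : ℤ) :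
    (D.super k).superComm (ncoeff (D.ne k a) m) (ncoeff (D.ne k b) n)
      = (if m = -n - 1 then D.form D.f (L.bracket a b) else 0) • 1 := by
  have h := superComm_opRight (T := D.neutral.vacSuper) (S := D.charged.vacSuper)
    (D.neutral.fieldMode m a) (D.neutral.fieldMode n b)
  have h2 := superComm_opRight (T := D.ghostSuper) (S := (D.currents k).vacSuper)
    (opRight D.charged.vacSuper D.neutral.vacSuper (D.neutral.fieldMode m a))
    (opRight D.charged.vacSuper D.neutral.vacSuper (D.neutral.fieldMode n b))
  rw [superComm_neutral, LinearMap.map_smul, opRight_one] at h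
  rw [ghostSuper, h, LinearMap.map_smul, opRight_one] at h2
  exact h2

theorem superComm_cur_gh (u : g) (φ : D.gPlus × Module.Dual ℂ D.gPlus) (m n : ℤ) :
    (D.super k).superComm (ncoeff (D.cur k u) m) (ncoeff (D.gh k φ) n) = 0 :=
  superComm_opLeft_opRight _ _

theorem superComm_gh_cur (u : g) (φ : D.gPlus × Module.Dual ℂ D.gPlus) (m n : ℤ) :
    (D.super k).superComm (ncoeff (D.gh k φ) m) (ncoeff (D.cur k u) n) = 0 :=
  superComm_opRight_opLeft _ _

theorem superComm_cur_ne (u : g) (b : D.gr 1) (m n : ℤ) :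
    (D.super k).superComm (ncoeff (D.cur k u) m) (ncoeff (D.ne k b) n) = 0 :=
  superComm_opLeft_opRight _ _

theorem superComm_ne_cur (u : g) (b : D.gr 1) (m n : ℤ) :
    (D.super k).superComm (ncoeff (D.ne k b) m) (ncoeff (D.cur k u) n) = 0 :=
  superComm_opRight_opLeft _ _

theorem superComm_gh_ne (φ : D.gPlus × Module.Dual ℂ D.gPlus) (b : D.gr 1) (m n : ℤ) :
    (D.super k).superComm (ncoeff (D.gh k φ) m) (ncoeff (D.ne k b) n) = 0 := by
  have h2 := superComm_opRight (T := D.ghostSuper) (S := (D.currents k).vacSuper)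
    (opLeft (D.charged.fieldMode m φ))
    (opRight D.charged.vacSuper D.neutral.vacSuper (D.neutral.fieldMode n b))
  rw [ghostSuper, superComm_opLeft_opRight, map_zero] at h2
  exact h2

theorem superComm_ne_gh (φ : D.gPlus × Module.Dual ℂ D.gPlus) (b : D.gr 1) (m n : ℤ) :
    (D.super k).superComm (ncoeff (D.ne k b) m) (ncoeff (D.gh k φ) n) = 0 := by
  have h2 := superComm_opRight (T := D.ghostSuper) (S := (D.currents k).vacSuper)
    (opRight D.charged.vacSuper D.neutral.vacSuper (D.neutral.fieldMode m b))
    (opLeft (D.charged.fieldMode n φ))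
  rw [ghostSuper, superComm_opRight_opLeft, map_zero] at h2
  exact h2

theorem par_cur (u : g) : (fieldSuper (D.super k)).par (D.cur k u) = D.cur k (L.par u) :=
  field_ext fun n => by
    have h := par_opLeft (S := (D.currents k).vacSuper) (T := D.ghostSuper)
      ((D.currents k).fieldMode n u)
    rw [ModeData.par_fieldMode] at h
    exact h

theorem par_gh (φ : D.gPlus × Module.Dual ℂ D.gPlus) :
    (fieldSuper (D.super k)).par (D.gh k φ) = D.gh k (D.charged.par φ) :=
  field_ext fun n => by
    have h := par_opRight (S := (D.currents k).vacSuper) (T := D.ghostSuper)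
      (opLeft (D.charged.fieldMode n φ))
    rw [ghostSuper, par_opLeft, ModeData.par_fieldMode] at h
    exact h

theorem par_ne (b : D.gr 1) :
    (fieldSuper (D.super k)).par (D.ne k b) = D.ne k (D.neutral.par b) :=
  field_ext fun n => by
    have h := par_opRight (S := (D.currents k).vacSuper) (T := D.ghostSuper)
      (opRight D.charged.vacSuper D.neutral.vacSuper (D.neutral.fieldMode n b))
    have h2 := par_opRight (S := D.charged.vacSuper) (T := D.neutral.vacSuper)
      (D.neutral.fieldMode n b)
    rw [ghostSuper, h2, ModeData.par_fieldMode] at h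
    exact h

/-- The currents as a linear map. -/
def curL : g →ₗ[ℂ] VField (D.Space k) where
  toFun := D.cur k
  map_add' u v := field_ext fun n =>
    (opLeft (W := D.charged.Vac ⊗[ℂ] D.neutral.Vac) ∘ₗ (D.currents k).fieldMode n).map_add u v
  map_smul' c u := field_ext fun n =>
    (opLeft (W := D.charged.Vac ⊗[ℂ] D.neutral.Vac) ∘ₗ (D.currents k).fieldMode n).map_smul c u

/-- The charged ghosts as a linear map. -/
def ghL : (D.gPlus × Module.Dual ℂ D.gPlus) →ₗ[ℂ] VField (D.Space k) where
  toFun := D.gh k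
  map_add' u v := field_ext fun n => (opRight (D.currents k).vacSuper D.ghostSuper ∘ₗ
    opLeft ∘ₗ D.charged.fieldMode n).map_add u v
  map_smul' c u := field_ext fun n => (opRight (D.currents k).vacSuper D.ghostSuper ∘ₗ
    opLeft ∘ₗ D.charged.fieldMode n).map_smul c u

/-- The neutral ghosts as a linear map. -/
def neL : D.gr 1 →ₗ[ℂ] VField (D.Space k) where
  toFun := D.ne k
  map_add' u v := field_ext fun n => (opRight (D.currents k).vacSuper D.ghostSuper ∘ₗ
    opRight D.charged.vacSuper D.neutral.vacSuper ∘ₗ D.neutral.fieldMode n).map_add u v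
  map_smul' c u := field_ext fun n => (opRight (D.currents k).vacSuper D.ghostSuper ∘ₗ
    opRight D.charged.vacSuper D.neutral.vacSuper ∘ₗ D.neutral.fieldMode n).map_smul c u

theorem par_mem_gens (m : ℤ) : ∀ a ∈ D.gens k m, (fieldSuper (D.super k)).par a ∈ D.gens k m := by
  rintro a (⟨hm, u, rfl⟩ | ⟨hm, φ, rfl⟩ | ⟨hm, α, rfl⟩ | ⟨hm, b, rfl⟩)
  · exact Or.inl ⟨hm, _, D.par_cur k u⟩
  · refine Or.inr (Or.inl ⟨hm, (D.charged.par (φ, 0)).1, ?_⟩)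
    rw [par_gh]
    congr 1
    refine Prod.ext rfl ?_
    simp [charged, Superspace.prod]
  · refine Or.inr (Or.inr (Or.inl ⟨hm, (D.charged.par (0, α)).2, ?_⟩))
    rw [par_gh]
    congr 1
    refine Prod.ext ?_ rfl
    simp [charged, Superspace.prod]
  · exact Or.inr (Or.inr (Or.inr ⟨hm, _, D.par_ne k b⟩))

theorem par_mem_iUnion_gens : ∀ a ∈ ⋃ m, D.gens k m,
    (fieldSuper (D.super k)).par a ∈ ⋃ m, D.gens k m := fun a ha => by
  obtain ⟨m, hm⟩ := Set.mem_iUnion.1 ha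
  exact Set.mem_iUnion.2 ⟨m, D.par_mem_gens k m a hm⟩

theorem mem_gens {a : VField (D.Space k)} (ha : a ∈ ⋃ m, D.gens k m) :
    (∃ u, a = D.cur k u) ∨ (∃ φ, a = D.gh k φ) ∨ ∃ b, a = D.ne k b := by
  obtain ⟨m, ⟨-, u, h⟩ | ⟨-, φ, h⟩ | ⟨-, α, h⟩ | ⟨-, b, h⟩⟩ := Set.mem_iUnion.1 ha
  · exact Or.inl ⟨u, h⟩
  · exact Or.inr (Or.inl ⟨_, h⟩)
  · exact Or.inr (Or.inl ⟨_, h⟩)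
  · exact Or.inr (Or.inr ⟨b, h⟩)

theorem local_of_superComm_eq_zero {V : Type*} [AddCommGroup V] [Module ℂ V] {S : Superspace V}
    {a b : VField V} (h : ∀ m n, S.superComm (ncoeff a m) (ncoeff b n) = 0) : Local S a b :=
  local_of_bracketModes (X := 0) (Z := 0) fun m n => by simp [h]

theorem gens_local : ∀ a ∈ ⋃ m, D.gens k m, ∀ b ∈ ⋃ m, D.gens k m, Local (D.super k) a b := by
  -- The central term of the ghosts depends only on `m + n`, so it fits `local_of_bracketModes`
  -- without a linear part.
  have hc : ∀ (z : ℂ) (m n : ℤ), (if m = -n - 1 then z else 0) • (1 : Module.End ℂ (D.Space k))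
      = (if m + n = -1 then z else 0) • (1 : Module.End ℂ (D.Space k))
        + (if m = -n then (m : ℂ) else 0) • 0 := fun z m n => by
    rw [smul_zero, add_zero]
    congr 1
    exact if_congr (by lia) rfl rfl
  intro a ha b hb
  obtain ⟨u, rfl⟩ | ⟨φ, rfl⟩ | ⟨e, rfl⟩ := D.mem_gens k ha <;>
    obtain ⟨u', rfl⟩ | ⟨φ', rfl⟩ | ⟨e', rfl⟩ := D.mem_gens k hb
  · refine local_of_bracketModes (X := ncoeff (D.cur k (L.bracket u u')))
      (Z := (k * D.form u u') • 1) fun m n => ?_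
    rw [superComm_cur_cur, smul_smul, ite_mul, zero_mul]
  · exact local_of_superComm_eq_zero (D.superComm_cur_gh k u φ')
  · exact local_of_superComm_eq_zero (D.superComm_cur_ne k u e')
  · exact local_of_superComm_eq_zero (D.superComm_gh_cur k u' φ)
  · exact local_of_bracketModes (X := fun l => (if l = -1 then D.chForm φ φ' else 0) • 1)
      fun m n => (D.superComm_gh_gh k φ φ' m n).trans (hc _ m n)
  · exact local_of_superComm_eq_zero (D.superComm_gh_ne k φ e')
  · exact local_of_superComm_eq_zero (D.superComm_ne_cur k u' e)
  · exact local_of_superComm_eq_zero (D.superComm_ne_gh k φ' e)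
  · exact local_of_bracketModes
      (X := fun l => (if l = -1 then D.form D.f (L.bracket e e') else 0) • 1)
      fun m n => (D.superComm_ne_ne k e e' m n).trans (hc _ m n)

theorem C_local : ∀ a ∈ D.C k, ∀ b ∈ D.C k, Local (D.super k) a b :=
  closure_local (D.par_mem_iUnion_gens k) (D.gens_local k)

theorem par_mem_C : ∀ a ∈ D.C k, (fieldSuper (D.super k)).par a ∈ D.C k :=
  par_mem_closure (D.par_mem_iUnion_gens k)

theorem Cm_le_C (m : ℤ) : D.Cm k m ≤ D.C k := chargePart_le_closure m

theorem iSup_Cm : ⨆ m, D.Cm k m = D.C k := iSup_chargePart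

/-! ### The charge grading by rescaling the charged ghosts. -/

/-- The automorphism `φ ↦ t φ`, `φ* ↦ t⁻¹ φ*` of the charged ghosts. -/
def chargeEndo {t : ℂ} (ht : t ≠ 0) : D.charged.Endo where
  map := (t • LinearMap.id).prodMap (t⁻¹ • LinearMap.id)
  map_par a := by simp [charged, Superspace.prod]
  map_bracket a b := (map_zero _).symm
  map_form0 a b := by
    simp [charged, chForm, ht]
  map_form1 a b := by simp [charged]

/-- The operator by which `t` acts on the complex. -/
def chargeOp {t : ℂ} (ht : t ≠ 0) : Module.End ℂ (D.Space k) :=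
  (TensorProduct.map LinearMap.id (TensorProduct.map (D.chargeEndo ht).mapVac LinearMap.id) :
    Module.End ℂ ((D.currents k).Vac ⊗[ℂ] (D.charged.Vac ⊗[ℂ] D.neutral.Vac)))

theorem map_id_intertwine {V W : Type*} [AddCommGroup V] [Module ℂ V] [AddCommGroup W] [Module ℂ W]
    {S : Superspace V} {T : Superspace W} {Θ B B' : Module.End ℂ W}
    (hΘ : Θ * T.par = T.par * Θ) (h : Θ * B = B' * Θ) :
    TensorProduct.map LinearMap.id Θ * opRight S T B
      = opRight S T B' * TensorProduct.map LinearMap.id Θ := by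
  have hp : Θ * T.endo.par B = T.endo.par B' * Θ := by
    rw [T.endo_par_eq, T.endo_par_eq, ← mul_assoc, ← mul_assoc, hΘ, mul_assoc T.par, h, mul_assoc,
      mul_assoc, hΘ]
    simp only [mul_assoc]
  have he : Θ * T.endo.even B = T.endo.even B' * Θ := by
    simp only [Superspace.even_apply, mul_smul_comm, smul_mul_assoc, mul_add, add_mul, h, hp]
  have ho : Θ * T.endo.odd B = T.endo.odd B' * Θ := by
    simp only [Superspace.odd_apply, mul_smul_comm, smul_mul_assoc, mul_sub, sub_mul, h, hp]
  refine TensorProduct.ext' fun v w => ?_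
  simp only [Module.End.mul_apply, opRight_tmul, map_add, TensorProduct.map_tmul,
    LinearMap.id_apply]
  have he' := LinearMap.congr_fun he w
  have ho' := LinearMap.congr_fun ho w
  simp only [Module.End.mul_apply] at he' ho'
  rw [he', ho']

theorem map_id_mul_opLeft {V W : Type*} [AddCommGroup V] [Module ℂ V] [AddCommGroup W] [Module ℂ W]
    (Θ : Module.End ℂ W) (A : Module.End ℂ V) :
    TensorProduct.map LinearMap.id Θ * opLeft A = opLeft A * TensorProduct.map LinearMap.id Θ :=
  TensorProduct.ext' fun _ _ => rfl

theorem map_id_mul {V W : Type*} [AddCommGroup V] [Module ℂ V] [AddCommGroup W] [Module ℂ W]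
    (Θ Θ' : Module.End ℂ W) : (TensorProduct.map LinearMap.id Θ : Module.End ℂ (V ⊗[ℂ] W))
      * TensorProduct.map LinearMap.id Θ' = TensorProduct.map LinearMap.id (Θ * Θ') :=
  TensorProduct.ext' fun _ _ => rfl

/-- Any scalar that is not a root of unity would do; with `t = 2` the powers are separated by
comparing real numbers. Scaling by `t⁻¹` gives the inverse operator. -/
theorem iSupIndep_Cm : iSupIndep (D.Cm k) := by
  have h2 : (2 : ℂ) ≠ 0 := two_ne_zero
  set θ := (D.chargeEndo h2).mapVac
  let Θ : Module.End ℂ (D.charged.Vac ⊗[ℂ] D.neutral.Vac) := TensorProduct.map θ LinearMap.id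
  have hθ : θ * D.charged.vacSuper.par = D.charged.vacSuper.par * θ :=
    (D.chargeEndo h2).mapVac_mul_par
  have hθ' : ∀ v, θ (D.charged.vacSuper.par v) = D.charged.vacSuper.par (θ v) :=
    LinearMap.congr_fun hθ
  have hΘ : Θ * D.ghostSuper.par = D.ghostSuper.par * Θ := TensorProduct.ext' fun v w => by
    change θ (D.charged.vacSuper.par v) ⊗ₜ[ℂ] D.neutral.vacSuper.par w
      = D.charged.vacSuper.par (θ v) ⊗ₜ D.neutral.vacSuper.par w
    rw [hθ']
  have hgh : ∀ φ n, Θ * opLeft (D.charged.fieldMode n φ)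
      = opLeft (D.charged.fieldMode n ((D.chargeEndo h2).map φ)) * Θ := fun φ n => by
    change opLeft θ * opLeft _ = opLeft _ * opLeft θ
    rw [← opLeft_mul, ← opLeft_mul, ModeData.Endo.mapVac_mul_fieldMode]
  have hcharge : ∀ φ n, D.chargeOp k h2 * ncoeff (D.gh k φ) n
      = ncoeff (D.gh k ((D.chargeEndo h2).map φ)) n * D.chargeOp k h2 := fun φ n =>
    map_id_intertwine hΘ (hgh φ n)
  refine iSupIndep_chargePart (t := 2) (Θ := D.chargeOp k h2)
    (Θ' := D.chargeOp k (inv_ne_zero h2)) (fun m m' h => ?_) h2 ?_ ?_ ?_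
  · have h' : ((2 : ℝ) : ℂ) ^ m = ((2 : ℝ) : ℂ) ^ m' := by simpa using h
    rw [← Complex.ofReal_zpow, ← Complex.ofReal_zpow, Complex.ofReal_inj] at h'
    exact zpow_right_injective₀ (by norm_num) (by norm_num) h'
  · refine TensorProduct.ext' fun v w => ?_
    change (D.currents k).vacSuper.par v ⊗ₜ[ℂ] Θ (D.ghostSuper.par w)
      = (D.currents k).vacSuper.par v ⊗ₜ[ℂ] D.ghostSuper.par (Θ w)
    congr 1
    exact LinearMap.congr_fun hΘ w
  · have h1 : θ * (D.chargeEndo (inv_ne_zero h2)).mapVac = 1 :=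
      ModeData.Endo.mapVac_mul_mapVac _ fun a => by simp [chargeEndo]
    have h3 : (TensorProduct.map LinearMap.id Θ : Module.End ℂ ((D.currents k).Vac ⊗[ℂ]
        (D.charged.Vac ⊗[ℂ] D.neutral.Vac))) * TensorProduct.map LinearMap.id
        (opLeft (D.chargeEndo (inv_ne_zero h2)).mapVac) = 1 := by
      rw [map_id_mul, show Θ = opLeft θ from rfl, ← opLeft_mul, h1, opLeft_one]
      exact TensorProduct.map_id
    exact h3
  · rintro m a (⟨rfl, u, rfl⟩ | ⟨rfl, φ, rfl⟩ | ⟨rfl, α, rfl⟩ | ⟨rfl, b, rfl⟩) n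
    · rw [zpow_zero, one_smul]
      exact map_id_mul_opLeft Θ _
    · rw [hcharge, zpow_one, show (2 : ℂ) • D.gh k (φ, 0) = D.gh k ((2 : ℂ) • (φ, 0)) from
        ((D.ghL k).map_smul (2 : ℂ) (φ, 0)).symm]
      simp [chargeEndo]
    · rw [hcharge, zpow_neg_one, show (2 : ℂ)⁻¹ • D.gh k (0, α) = D.gh k ((2 : ℂ)⁻¹ • (0, α)) from
        ((D.ghL k).map_smul (2 : ℂ)⁻¹ (0, α)).symm]
      simp [chargeEndo]
    · rw [zpow_zero, one_smul]
      refine map_id_intertwine hΘ (TensorProduct.ext' fun v w => ?_)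
      change Θ (opRight D.charged.vacSuper D.neutral.vacSuper _ (v ⊗ₜ w))
        = opRight D.charged.vacSuper D.neutral.vacSuper _ (θ v ⊗ₜ w)
      rw [opRight_tmul, opRight_tmul, map_add, ← hθ']
      rfl

end ReductionData

/-! ## Pairs of fields with a λ-bracket that is constant in λ -/

section ConstantBracket

variable {V : Type*} [AddCommGroup V] [Module ℂ V]

/-- The field `z^{-M} a(z)`, with modes `a_(M+n)`. -/
def shiftField (M : ℤ) (a : VField V) : VField V :=
  mkField (fun n => ncoeff a (M + n)) fun v =>
    (tendsto_atTop_add_const_left _ M tendsto_id).eventually (ncoeff_eventually a v)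

@[simp] theorem ncoeff_shiftField (M : ℤ) (a : VField V) (n : ℤ) :
    ncoeff (shiftField M a) n = ncoeff a (M + n) := rfl

variable (S : Superspace V)

/-- `[a_λ b] = e`, i.e. `[a_(m), b_(n)] = e_(m+n)` for all modes. -/
def Br (a b e : VField V) : Prop :=
  ∀ m n, S.superComm (ncoeff a m) (ncoeff b n) = ncoeff e (m + n)

variable {S} {a a' b b' c e e' : VField V} {i j l : ZMod 2}

/-- The residue is taken in `x` only, so a power of the variable of `b` passes out of it. Nothing of
the kind holds for the left factor. -/
theorem nprod_shiftField_right (M : ℤ) (a b : VField V) (n : ℤ) :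
    nprod S a n (shiftField M b) = shiftField M (nprod S a n b) := by
  refine field_ext fun m => LinearMap.ext fun v => ?_
  refine finsum_congr fun r => ?_
  rw [nprodTerm, nprodTerm, ncoeff_shiftField, ncoeff_shiftField, add_assoc M m,
    show M + (m + n - (r : ℤ)) = M + m + n - r by ring]

theorem shiftField_mem_part (M : ℤ) (ha : a ∈ (fieldSuper S).part i) :
    shiftField M a ∈ (fieldSuper S).part i :=
  mem_field_part.2 fun n => mem_field_part.1 ha (M + n)

/-- A bracket constant in `λ` says that each single mode of `a` acts on `b` to give a shift of one
field, so `adField_nprod` can be applied mode by mode. -/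
theorem br_iff_adField : Br S a b e ↔ ∀ m, adField S (ncoeff a m) b = shiftField m e :=
  ⟨fun h m => field_ext fun n => h m n, fun h m n => congrArg (fun x => ncoeff x n) (h m)⟩

theorem Br.add_left (h : Br S a b e) (h' : Br S a' b e') : Br S (a + a') b (e + e') :=
  fun m n => by
    rw [ncoeff_add, ncoeff_add, ← h, ← h', ← Superspace.superCommL_apply, map_add]
    rfl

theorem Br.smul_left (r : ℂ) (h : Br S a b e) : Br S (r • a) b (r • e) := fun m n => by
  rw [ncoeff_smul, ncoeff_smul, ← h, ← Superspace.superCommL_apply, map_smul]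
  rfl

theorem Br.add_right (h : Br S a b e) (h' : Br S a b' e') : Br S a (b + b') (e + e') :=
  fun m n => by
    rw [ncoeff_add, ncoeff_add, ← h, ← h', ← Superspace.superCommL_apply, map_add]
    rfl

theorem Br.smul_right (r : ℂ) (h : Br S a b e) : Br S a (r • b) (r • e) := fun m n => by
  rw [ncoeff_smul, ncoeff_smul, ← h, ← Superspace.superCommL_apply, map_smul]
  rfl

theorem Br.sub_right (h : Br S a b e) (h' : Br S a b' e') : Br S a (b - b') (e - e') := by
  simpa [sub_eq_add_neg] using h.add_right (h'.smul_right (-1))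

theorem br_zero_left (b : VField V) : Br S 0 b 0 := fun m n => by
  rw [ncoeff_zero, ncoeff_zero, ← Superspace.superCommL_apply, map_zero]; rfl

theorem br_zero_right (a : VField V) : Br S a 0 0 := fun m n => by
  rw [ncoeff_zero, ncoeff_zero, ← Superspace.superCommL_apply, map_zero]

theorem Br.congr (h : Br S a b e) (he : e = e') : Br S a b e' := he ▸ h

theorem Br.sum_left {ι : Type*} {s : Finset ι} {a e : ι → VField V}
    (h : ∀ i ∈ s, Br S (a i) b (e i)) : Br S (∑ i ∈ s, a i) b (∑ i ∈ s, e i) := by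
  classical
  induction s using Finset.induction_on with
  | empty => exact br_zero_left b
  | insert i s hi ih =>
    rw [Finset.sum_insert hi, Finset.sum_insert hi]
    exact (h i (Finset.mem_insert_self i s)).add_left
      (ih fun j hj => h j (Finset.mem_insert_of_mem hj))

theorem Br.sum_right {ι : Type*} {s : Finset ι} {b e : ι → VField V}
    (h : ∀ i ∈ s, Br S a (b i) (e i)) : Br S a (∑ i ∈ s, b i) (∑ i ∈ s, e i) := by
  classical
  induction s using Finset.induction_on with
  | empty => exact br_zero_right a
  | insert i s hi ih =>
    rw [Finset.sum_insert hi, Finset.sum_insert hi]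
    exact (h i (Finset.mem_insert_self i s)).add_right
      (ih fun j hj => h j (Finset.mem_insert_of_mem hj))

theorem Br.sum_left_zero {ι : Type*} {s : Finset ι} {a : ι → VField V}
    (h : ∀ i ∈ s, Br S (a i) b 0) : Br S (∑ i ∈ s, a i) b 0 :=
  (Br.sum_left h).congr Finset.sum_const_zero

theorem Br.sum_right_zero {ι : Type*} {s : Finset ι} {b : ι → VField V}
    (h : ∀ i ∈ s, Br S a (b i) 0) : Br S a (∑ i ∈ s, b i) 0 :=
  (Br.sum_right h).congr Finset.sum_const_zero

theorem Br.smul_left_zero {r : ℂ} (h : r ≠ 0 → Br S a b 0) : Br S (r • a) b 0 := by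
  by_cases hr : r = 0
  · rw [hr, zero_smul]
    exact br_zero_left b
  · exact ((h hr).smul_left r).congr (smul_zero r)

theorem Br.smul_right_zero {r : ℂ} (h : r ≠ 0 → Br S a b 0) : Br S a (r • b) 0 := by
  by_cases hr : r = 0
  · rw [hr, zero_smul]
    exact br_zero_right a
  · exact ((h hr).smul_right r).congr (smul_zero r)

theorem Br.symm (ha : a ∈ (fieldSuper S).part i) (hb : b ∈ (fieldSuper S).part j)
    (h : Br S a b e) : Br S b a (-(koszul i j) • e) := fun m n => by
  rw [Superspace.superComm_symm (mem_field_part.1 ha n) (mem_field_part.1 hb m), h, ncoeff_smul,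
    neg_smul, add_comm n m]

theorem Br.symm_zero (ha : a ∈ (fieldSuper S).part i) (hb : b ∈ (fieldSuper S).part j)
    (h : Br S a b 0) : Br S b a 0 := (h.symm ha hb).congr (smul_zero _)

theorem br_oneField_left (b : VField V) : Br S oneField b 0 := fun m n => by
  rw [Superspace.superComm_of_mem (mem_field_part.1 oneField_mem_part m), ncoeff_oneField,
    ncoeff_zero]
  split_ifs <;> simp

theorem br_of_central {r : ℂ}
    (h : ∀ m n, S.superComm (ncoeff a m) (ncoeff b n) = (if m = -n - 1 then r else 0) • 1) :
    Br S a b (r • oneField) := fun m n => by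
  rw [h, ncoeff_smul, ncoeff_oneField]
  by_cases hc : m = -n - 1
  · rw [if_pos hc, if_pos (by lia)]
  · rw [if_neg hc, if_neg (by lia), zero_smul, smul_zero]

local notation:70 a:70 " ⊙ " b:71 => nprod S a (-1) b

/-- Commuting fields are local of order zero, so their left multiplications commute for every pair
of indices, in particular `(-1, -1)`. -/
theorem Br.left_comm (ha : a ∈ (fieldSuper S).part i) (hb : b ∈ (fieldSuper S).part j)
    (h : Br S a b 0) (c : VField V) : (a ⊙ (b ⊙ c)) = koszul i j • (b ⊙ (a ⊙ c)) := by
  have h0 : (dif ^ 0) (bracketModes S a b) = 0 := funext fun m => funext fun n => h m n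
  have := congrFun (congrFun (dif_pow_nprod_nprod ha hb h0 c) (-1)) (-1)
  exact sub_eq_zero.1 this

theorem Br.comm (ha : a ∈ (fieldSuper S).part i) (hb : b ∈ (fieldSuper S).part j)
    (h : Br S a b 0) : (a ⊙ b) = koszul i j • (b ⊙ a) := by
  simpa only [nprod_neg_one_oneField] using h.left_comm ha hb oneField

theorem br_nprod_zero (hc : c ∈ (fieldSuper S).part l) (ha : Br S c a 0) (hb : Br S c b 0)
    (n : ℤ) : Br S c (nprod S a n b) 0 := by
  refine br_iff_adField.2 fun m => ?_
  let a' : VField V := if l = 0 then a else (fieldSuper S).par a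
  have ha' : ∀ n, ncoeff a' n = S.tw l (ncoeff a n) := fun n => by
    rcases zmod_two_cases l with h | h
    · simp [a', h]
    · simp [a', h, ncoeff_par]
  rw [adField_nprod (mem_field_part.1 hc m) ha', br_iff_adField.1 ha, br_iff_adField.1 hb]
  have : shiftField m (0 : VField V) = 0 := rfl
  rw [this, nprod_zero_left, nprod_zero_right, add_zero]

/-- Normally ordered products are not associative in general. Here `c` commutes with `a` and `b`, so
it can be moved to the front, past `a` by `Br.left_comm`, and back behind `b`; the signs cancel. -/
theorem Br.assoc (ha : a ∈ (fieldSuper S).part i) (hb : b ∈ (fieldSuper S).part j)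
    (hc : c ∈ (fieldSuper S).part l) (h1 : Br S a c 0) (h2 : Br S b c 0) :
    ((a ⊙ b) ⊙ c) = a ⊙ (b ⊙ c) := by
  have h1' := h1.symm_zero ha hc
  have h2' := h2.symm_zero hb hc
  have hab := nprod_mem_part ha hb (-1)
  rw [((br_nprod_zero hc h1' h2' (-1)).symm_zero hc hab).comm hab hc, h1'.left_comm hc ha,
    h2'.comm hc hb, nprod_smul_right, smul_smul, smul_smul]
  have : koszul (i + j) l * (koszul l i * koszul l j) = 1 := by
    rw [koszul_comm (i + j), koszul_add_right, mul_mul_mul_comm, koszul_mul_self, koszul_mul_self,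
      one_mul]
  rw [mul_assoc, this, one_smul]

/-- The noncommutative Wick formula without the integral term. -/
theorem Br.nprod (hc : c ∈ (fieldSuper S).part l) (ha : a ∈ (fieldSuper S).part i)
    (hb : b ∈ (fieldSuper S).part j) {i' : ZMod 2} (he : e ∈ (fieldSuper S).part i')
    (h1 : Br S c a e) (h2 : Br S c b e') (heb : Br S e b 0) :
    Br S c (a ⊙ b) ((e ⊙ b) + koszul l i • (a ⊙ e')) := by
  refine br_iff_adField.2 fun m => ?_
  have ha' : ∀ n, ncoeff (koszul l i • a) n = S.tw l (ncoeff a n) := fun n => by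
    rw [Superspace.tw_of_mem l (mem_field_part.1 ha n), ncoeff_smul]
  rw [adField_nprod (mem_field_part.1 hc m) ha', br_iff_adField.1 h1, br_iff_adField.1 h2,
    nprod_smul_left, nprod_shiftField_right]
  -- A shift in the left factor cannot be pulled out directly. As `e` and `b` commute, they are
  -- exchanged, the shift is moved out on the right, and the exchange is undone. This is where the
  -- integral term of Wick's formula vanishes.
  have h3 : Br S (shiftField m e) b 0 := fun p q => heb _ _
  rw [h3.comm (shiftField_mem_part m he) hb, nprod_shiftField_right, heb.comm he hb]
  rfl

end ConstantBracket

/-! ## The BRST field of a positively graded Lie superalgebra of currents -/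

/-- The signs in the conclusion are those collected in `BRST.r_eq_zero` when three odd-shifted
factors are brought into a common order; in each of the eight parity cases they agree with the
Jacobi signs up to an overall sign. -/
theorem koszul_cyclic_jacobi (i j l : ZMod 2) (x y z : ℂ)
    (h : koszul i l * x + koszul i j * y + koszul j l * z = 0) :
    koszul 1 i * koszul i j * x + koszul 1 j * koszul j l *
        (koszul (j + 1) (l + 1) * koszul (i + 1) (l + 1)) * y
      + koszul 1 l * koszul l i * (koszul (j + 1) (l + 1) * koszul (i + 1) (j + 1)) * z = 0 := by
  rcases zmod_two_cases i with rfl | rfl <;> rcases zmod_two_cases j with rfl | rfl <;>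
    rcases zmod_two_cases l with rfl | rfl <;>
    simp [zmod_two_one_add_one] at h ⊢ <;> first | linear_combination h | linear_combination -h

theorem zmod_two_add_add_self (i j : ZMod 2) : i + j + i = j := by
  rw [add_right_comm, CharTwo.add_self_eq_zero, zero_add]

/-- The structure constants of a positively graded Lie superalgebra, currents `Y_i` for it, and
ghosts `φ_i`, `ψ_i`. -/
structure BRST {V : Type*} [AddCommGroup V] [Module ℂ V] (S : Superspace V) (I : Type*)
    [Fintype I] where
  p : I → ZMod 2
  deg : I → ℤ
  deg_pos : ∀ i, 0 < deg i
  c : I → I → I → ℂ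
  c_deg : ∀ l i j, c l i j ≠ 0 → deg l = deg i + deg j
  c_par : ∀ l i j, c l i j ≠ 0 → p l = p i + p j
  skew : ∀ l i j, c l i j = -(koszul (p i) (p j) * c l j i)
  jacobi : ∀ l i j r, koszul (p i) (p r) * ∑ m, c l m r * c m i j
    + koszul (p i) (p j) * ∑ m, c l m i * c m j r + koszul (p j) (p r) * ∑ m, c l m j * c m r i = 0
  Y : I → VField V
  φ : I → VField V
  ψ : I → VField V
  Y_mem : ∀ i, Y i ∈ (fieldSuper S).part (p i)
  φ_mem : ∀ i, φ i ∈ (fieldSuper S).part (p i + 1)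
  ψ_mem : ∀ i, ψ i ∈ (fieldSuper S).part (p i + 1)
  YY : ∀ i j, Br S (Y i) (Y j) (∑ l, c l i j • Y l)
  Yφ : ∀ i j, Br S (Y i) (φ j) 0
  Yψ : ∀ i j, Br S (Y i) (ψ j) 0
  φφ : ∀ i j, Br S (φ i) (φ j) 0
  ψψ : ∀ i j, Br S (ψ i) (ψ j) 0
  φψ_self : ∀ i, Br S (φ i) (ψ i) oneField
  φψ_of_ne : ∀ i j, i ≠ j → Br S (φ i) (ψ j) 0

namespace BRST

variable {V : Type*} [AddCommGroup V] [Module ℂ V] {S : Superspace V} {I : Type*}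
  [Fintype I] (B : BRST S I)

local notation:70 a:70 " ⊙ " b:71 => nprod S a (-1) b

/-- The sign `(-1)^{p(u_i)}`. -/
def s (i : I) : ℂ := koszul 1 (B.p i)

/-- The differential of `ψ_l`, up to a factor. -/
def q (l : I) : VField V :=
  ∑ i, ∑ j, (koszul (B.p i) (B.p l) * B.c l i j) • (B.ψ i ⊙ B.ψ j)

/-- The coefficient of the coadjoint action. -/
def w (l m : I) : VField V := ∑ j, B.c l m j • B.ψ j

/-- The BRST field. -/
def d : VField V := ∑ i, B.s i • (B.Y i ⊙ B.ψ i) - (1 / 2 : ℂ) • ∑ l, B.φ l ⊙ B.q l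

/-- The Chevalley–Eilenberg expression `∑ c^l_{mj} ψ_j q_m`. -/
def r (l : I) : VField V := ∑ m, B.w l m ⊙ B.q m

variable {B}

theorem sum_mem_part {ι : Type*} {s : Finset ι} {f : ι → ℂ} {a : ι → VField V} {i : ZMod 2}
    (h : ∀ x ∈ s, f x ≠ 0 → a x ∈ (fieldSuper S).part i) :
    ∑ x ∈ s, f x • a x ∈ (fieldSuper S).part i := by
  refine sum_mem fun x hx => ?_
  by_cases hf : f x = 0
  · rw [hf, zero_smul]
    exact zero_mem _
  · exact Submodule.smul_mem _ _ (h x hx hf)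

theorem q_mem (l : I) : B.q l ∈ (fieldSuper S).part (B.p l) := by
  refine sum_mem fun i _ => sum_mem_part fun j _ hc => ?_
  rw [B.c_par l i j (right_ne_zero_of_mul hc)]
  have h := nprod_mem_part (B.ψ_mem i) (B.ψ_mem j) (-1)
  rwa [add_add_add_comm, zmod_two_one_add_one, add_zero] at h

theorem w_mem (l m : I) : B.w l m ∈ (fieldSuper S).part (B.p l + B.p m + 1) := by
  refine sum_mem_part fun j _ hc => ?_
  rw [B.c_par l m j hc, zmod_two_add_add_self]
  exact B.ψ_mem j

theorem d_mem : B.d ∈ (fieldSuper S).part 1 := by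
  refine sub_mem (sum_mem fun i _ => Submodule.smul_mem _ _ ?_)
    (Submodule.smul_mem _ _ (sum_mem fun l _ => ?_))
  · have h := nprod_mem_part (B.Y_mem i) (B.ψ_mem i) (-1)
    rwa [← add_assoc, CharTwo.add_self_eq_zero, zero_add] at h
  · have h := nprod_mem_part (B.φ_mem l) (B.q_mem l) (-1)
    rwa [add_right_comm, CharTwo.add_self_eq_zero, zero_add] at h

/-- A field that commutes with the `ψ_j` of smaller degree commutes with `q`. -/
theorem br_q_zero {a : VField V} {i : ZMod 2} (ha : a ∈ (fieldSuper S).part i) (l : I)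
    (h : ∀ j, B.deg j < B.deg l → Br S a (B.ψ j) 0) : Br S a (B.q l) 0 := by
  refine Br.sum_right_zero fun m _ => Br.sum_right_zero fun j _ => Br.smul_right_zero fun hc => ?_
  -- Degrees add and are positive, so both `ψ` factors with nonzero coefficient have degree below
  -- `deg l`.
  have hd := B.c_deg l m j (right_ne_zero_of_mul hc)
  have h1 := B.deg_pos m
  have h2 := B.deg_pos j
  exact br_nprod_zero ha (h m (by lia)) (h j (by lia)) _

theorem br_w_zero {a : VField V} (l m : I)
    (h : ∀ j, B.deg j < B.deg l → Br S a (B.ψ j) 0) : Br S a (B.w l m) 0 := by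
  refine Br.sum_right_zero fun j _ => Br.smul_right_zero fun hc => ?_
  have hd := B.c_deg l m j hc
  have h1 := B.deg_pos m
  exact h j (by lia)

theorem φψ_of_lt {i j : I} (h : B.deg j < B.deg i) : Br S (B.φ i) (B.ψ j) 0 :=
  B.φψ_of_ne i j (by rintro rfl; exact lt_irrefl _ h)

variable (B) in
theorem φψ [DecidableEq I] (i j : I) :
    Br S (B.φ i) (B.ψ j) ((if i = j then (1 : ℂ) else 0) • oneField) := by
  split_ifs with h
  · rw [one_smul, h]
    exact B.φψ_self j
  · rw [zero_smul]
    exact B.φψ_of_ne i j h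

theorem ψφ [DecidableEq I] (i j : I) : Br S (B.ψ i) (B.φ j)
    ((if j = i then -koszul (B.p i + 1) (B.p i + 1) else 0) • oneField) :=
  ((B.φψ j i).symm (B.φ_mem j) (B.ψ_mem i)).congr (by
    split_ifs with h
    · rw [h, one_smul]
    · simp)

/-- The field `φ_m` can be contracted with either `ψ` factor; by skew-symmetry the two contractions
contribute equally, whence the `2` that later meets the `1/2` in `d`. -/
theorem φ_q (m l : I) : Br S (B.φ m) (B.q l) ((2 * koszul (B.p m) (B.p l)) • B.w l m) := by
  classical
  have h1 : ∀ i j, Br S (B.φ m) (B.ψ i ⊙ B.ψ j) ((if m = i then (1 : ℂ) else 0) • B.ψ j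
      + (koszul (B.p m + 1) (B.p i + 1) * if m = j then 1 else 0) • B.ψ i) := fun i j => by
    refine (Br.nprod (B.φ_mem m) (B.ψ_mem i) (B.ψ_mem j)
      (Submodule.smul_mem _ _ oneField_mem_part) (B.φψ m i) (B.φψ m j) ?_).congr ?_
    · exact ((br_oneField_left _).smul_left _).congr (smul_zero _)
    · rw [nprod_smul_left, nprod_smul_right, nprod_oneField_left, if_pos rfl,
        nprod_neg_one_oneField, smul_smul]
  refine (Br.sum_right fun i _ => Br.sum_right fun j _ => (h1 i j).smul_right _).congr ?_
  -- Skew-symmetry of the structure constants absorbs the sign of moving `φ_m` past the first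
  -- factor.
  have h2 : ∀ i, (koszul (B.p i) (B.p l) * B.c l i m) * koszul (B.p m + 1) (B.p i + 1)
      = koszul (B.p m) (B.p l) * B.c l m i := fun i => by
    rw [B.skew l i m]
    by_cases hc : B.c l m i = 0
    · simp [hc]
    · rw [B.c_par l m i hc]
      rcases zmod_two_cases (B.p m) with h | h <;> rcases zmod_two_cases (B.p i) with h' | h' <;>
        simp [h, h', zmod_two_one_add_one]
  simp only [smul_add, smul_smul, Finset.sum_add_distrib, mul_ite, mul_one, mul_zero]
  simp only [ite_smul, zero_smul, Finset.sum_ite_eq, Finset.mem_univ, if_true]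
  rw [Finset.sum_eq_single m (fun i _ hi => by simp [Ne.symm hi]) (by simp)]
  simp only [if_true, h2, w, Finset.smul_sum, smul_smul]
  rw [← Finset.sum_add_distrib]
  refine Finset.sum_congr rfl fun j _ => ?_
  module

/-! ### Brackets of the BRST field with ghosts and currents. -/

/-- The ghost part `∑_l (-1)^{p(u_l)} φ_l w_{lm}` of the differential of `φ_m`. -/
def ghost (B : BRST S I) (m : I) : VField V := ∑ l, B.s l • (B.φ l ⊙ B.w l m)

/-- In every monomial of `d` the first factor commutes with `φ_m`, so Wick's formula applies with
nothing to check. The bracket is computed with `φ_m` on the left and then reversed by skew-symmetry,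
as also for `ψ_m` and `Y_m`. -/
theorem d_φ (m : I) : Br S B.d (B.φ m) (B.Y m + B.ghost m) := by
  classical
  have h1 : ∀ i, Br S (B.φ m) (B.Y i ⊙ B.ψ i)
      ((koszul (B.p m + 1) (B.p i) * if m = i then 1 else 0) • B.Y i) := fun i => by
    refine (Br.nprod (B.φ_mem m) (B.Y_mem i) (B.ψ_mem i) (zero_mem ((fieldSuper S).part 0))
      ((B.Yφ i m).symm_zero (B.Y_mem i) (B.φ_mem m)) (B.φψ m i) (br_zero_left _)).congr ?_
    rw [nprod_zero_left, zero_add, nprod_smul_right, nprod_neg_one_oneField, smul_smul]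
  have h2 : ∀ l, Br S (B.φ m) (B.φ l ⊙ B.q l)
      ((koszul (B.p m + 1) (B.p l + 1) * (2 * koszul (B.p m) (B.p l))) • (B.φ l ⊙ B.w l m)) :=
      fun l => by
    refine (Br.nprod (B.φ_mem m) (B.φ_mem l) (B.q_mem l) (zero_mem ((fieldSuper S).part 0))
      (B.φφ m l) (φ_q m l) (br_zero_left _)).congr ?_
    rw [nprod_zero_left, zero_add, nprod_smul_right, smul_smul]
  have h3 := ((Br.sum_right fun i _ => (h1 i).smul_right (B.s i)).sub_right
    ((Br.sum_right fun l _ => h2 l).smul_right (1 / 2))).symm (B.φ_mem m) B.d_mem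
  refine h3.congr ?_
  simp only [mul_ite, mul_one, mul_zero, ite_smul, zero_smul, smul_ite, smul_zero,
    Finset.sum_ite_eq, Finset.mem_univ, if_true, smul_sub, smul_smul, Finset.smul_sum, ghost]
  rw [sub_eq_add_neg, ← Finset.sum_neg_distrib]
  congr 1
  · convert one_smul ℂ _
    rw [s]
    rcases zmod_two_cases (B.p m) with h | h <;> simp [h, zmod_two_one_add_one]
  · refine Finset.sum_congr rfl fun l _ => ?_
    rw [← neg_smul]
    congr 1
    rw [s]
    rcases zmod_two_cases (B.p m) with h | h <;> rcases zmod_two_cases (B.p l) with h' | h' <;>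
      simp [h, h', zmod_two_one_add_one]

theorem d_ψ (m : I) : Br S B.d (B.ψ m) ((-1 / 2 : ℂ) • B.q m) := by
  classical
  have h1 : ∀ i, Br S (B.ψ m) (B.Y i ⊙ B.ψ i) 0 := fun i =>
    br_nprod_zero (B.ψ_mem m) ((B.Yψ i m).symm_zero (B.Y_mem i) (B.ψ_mem m)) (B.ψψ m i) _
  have h2 : ∀ l, Br S (B.ψ m) (B.φ l ⊙ B.q l)
      ((if l = m then -koszul (B.p m + 1) (B.p m + 1) else 0) • B.q l) := fun l => by
    refine (Br.nprod (B.ψ_mem m) (B.φ_mem l) (B.q_mem l)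
      (Submodule.smul_mem _ _ oneField_mem_part) (ψφ m l)
      (br_q_zero (B.ψ_mem m) l fun j _ => B.ψψ m j) ?_).congr ?_
    · exact ((br_oneField_left _).smul_left _).congr (smul_zero _)
    · rw [nprod_smul_left, nprod_oneField_left, if_pos rfl, nprod_zero_right, smul_zero, add_zero]
  have h3 := ((Br.sum_right fun i _ => (h1 i).smul_right (B.s i)).sub_right
    ((Br.sum_right fun l _ => h2 l).smul_right (1 / 2))).symm (B.ψ_mem m) B.d_mem
  refine h3.congr ?_
  simp only [ite_smul, zero_smul, smul_zero, Finset.sum_const_zero, zero_sub,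
    Finset.sum_ite_eq', Finset.mem_univ, if_true, smul_smul, ← neg_smul]
  congr 1
  rcases zmod_two_cases (B.p m) with h | h <;> simp [h, zmod_two_one_add_one] <;> norm_num

/-- The coefficient `∑_i (-1)^{p(u_i)} c^l_{mi} ψ_i` of `Y_l` in the differential of `Y_m`, up to
sign. -/
def w' (B : BRST S I) (l m : I) : VField V := ∑ i, (B.s i * B.c l m i) • B.ψ i

/-- Only the currents in `d` see `Y_m`, and their brackets are again currents, which commute with
the `ψ` beside them; hence the integral term is absent. -/
theorem d_Y (m : I) : Br S B.d (B.Y m) (-(B.s m) • ∑ l, B.Y l ⊙ B.w' l m) := by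
  have h1 : ∀ i, Br S (B.Y m) (B.Y i ⊙ B.ψ i) (∑ l, B.c l m i • (B.Y l ⊙ B.ψ i)) := fun i => by
    refine (Br.nprod (i' := B.p m + B.p i) (B.Y_mem m) (B.Y_mem i) (B.ψ_mem i)
      (sum_mem_part fun l _ hc => ?_) (B.YY m i) (B.Yψ m i)
      (Br.sum_left_zero fun l _ => Br.smul_left_zero fun _ => B.Yψ l i)).congr ?_
    · rw [← B.c_par l m i hc]
      exact B.Y_mem l
    · simp only [nprod_zero_right, smul_zero, add_zero, nprod_sum_left, nprod_smul_left]
  have h2 : ∀ l, Br S (B.Y m) (B.φ l ⊙ B.q l) 0 := fun l =>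
    br_nprod_zero (B.Y_mem m) (B.Yφ m l) (br_q_zero (B.Y_mem m) l fun j _ => B.Yψ m j) _
  have h3 := ((Br.sum_right fun i _ => (h1 i).smul_right (B.s i)).sub_right
    ((Br.sum_right fun l _ => h2 l).smul_right (1 / 2))).symm (B.Y_mem m) B.d_mem
  refine h3.congr ?_
  rw [Finset.sum_const_zero, smul_zero, sub_zero, koszul_comm, ← s]
  congr 1
  simp only [w', nprod_sum_right, nprod_smul_right, Finset.smul_sum, smul_smul]
  exact Finset.sum_comm

/-- Identifies the coefficient of `Y_l` coming from the brackets of currents with a multiple of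
`q_l`, so that it can cancel against the other two sources of `Y_l`. -/
theorem sum_w'_ψ (l : I) : ∑ m, B.w' l m ⊙ B.ψ m = -B.q l := by
  simp only [w', q, nprod_sum_left, nprod_smul_left]
  rw [Finset.sum_comm, ← Finset.sum_neg_distrib]
  refine Finset.sum_congr rfl fun i _ => ?_
  rw [← Finset.sum_neg_distrib]
  refine Finset.sum_congr rfl fun j _ => ?_
  rw [← neg_smul, B.skew l j i]
  congr 1
  by_cases hc : B.c l i j = 0
  · simp [hc]
  · rw [B.c_par l i j hc, s]
    rcases zmod_two_cases (B.p i) with h | h <;> rcases zmod_two_cases (B.p j) with h' | h' <;>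
      simp [h, h', zmod_two_one_add_one]

/-! ### The Jacobi identity and the vanishing of the bracket of `d` with itself. -/

/-- `r` vanishes by the Jacobi identity. -/
theorem r_eq_zero (l : I) : B.r l = 0 := by
  let P : I → I → I → VField V := fun j a b => B.ψ j ⊙ (B.ψ a ⊙ B.ψ b)
  have hP1 : ∀ j a b, P a j b = koszul (B.p a + 1) (B.p j + 1) • P j a b := fun j a b =>
    (B.ψψ a j).left_comm (B.ψ_mem a) (B.ψ_mem j) _
  have hP2 : ∀ j a b, P j b a = koszul (B.p b + 1) (B.p a + 1) • P j a b := fun j a b => by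
    change (B.ψ j ⊙ (B.ψ b ⊙ B.ψ a)) = _
    rw [(B.ψψ b a).comm (B.ψ_mem b) (B.ψ_mem a), nprod_smul_right]
  let t : I → I → I → ℂ := fun a b j => ∑ m, B.c l m j * B.c m a b
  let f : I → I → I → VField V := fun j a b =>
    (koszul 1 (B.p a) * koszul (B.p a) (B.p b) * t a b j) • P j a b
  have e1 : B.r l = ∑ j, ∑ a, ∑ b, f j a b := by
    have e : ∀ m j a b, B.c l m j * (koszul (B.p a) (B.p m) * B.c m a b)
        = koszul 1 (B.p a) * koszul (B.p a) (B.p b) * (B.c l m j * B.c m a b) := by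
      intro m j a b
      by_cases hc : B.c m a b = 0
      · simp [hc]
      · rw [B.c_par m a b hc]
        rcases zmod_two_cases (B.p a) with h | h <;> rcases zmod_two_cases (B.p b) with h' | h' <;>
          simp [h, h', zmod_two_one_add_one]
    have e' : B.r l = ∑ m, ∑ j, ∑ a, ∑ b,
        (koszul 1 (B.p a) * koszul (B.p a) (B.p b) * (B.c l m j * B.c m a b)) • P j a b := by
      refine Finset.sum_congr rfl fun m _ => ?_
      rw [w, nprod_sum_left]
      refine Finset.sum_congr rfl fun j _ => ?_
      rw [nprod_smul_left, q, nprod_sum_right, Finset.smul_sum]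
      refine Finset.sum_congr rfl fun a _ => ?_
      rw [nprod_sum_right, Finset.smul_sum]
      refine Finset.sum_congr rfl fun b _ => ?_
      rw [nprod_smul_right, smul_smul, e]
    simp only [e', f, t, Finset.mul_sum, Finset.sum_smul]
    rw [Finset.sum_comm]
    refine Finset.sum_congr rfl fun j _ => ?_
    rw [Finset.sum_comm]
    refine Finset.sum_congr rfl fun a _ => ?_
    rw [Finset.sum_comm]
  have rot : ∀ g : I → I → I → VField V,
      ∑ j, ∑ a, ∑ b, g j a b = ∑ j, ∑ a, ∑ b, g a b j := fun g =>
    (Finset.sum_congr rfl fun a _ => Finset.sum_comm).trans Finset.sum_comm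
  have e2 : B.r l = ∑ j, ∑ a, ∑ b, f a b j := e1.trans (rot f)
  have e3 : B.r l = ∑ j, ∑ a, ∑ b, f b j a := e2.trans (rot fun j a b => f a b j)
  -- Averaging over the three cyclic relabellings and reordering the anticommuting `ψ` factors
  -- leaves, in front of each triple product, the cyclic Jacobi expression.
  have h3 : (3 : ℂ) • B.r l = 0 := by
    rw [show (3 : ℂ) = 1 + 1 + 1 by norm_num, add_smul, add_smul, one_smul]
    nth_rw 1 [e1]
    nth_rw 1 [e2]
    rw [e3]
    simp only [← Finset.sum_add_distrib]
    refine Finset.sum_eq_zero fun j _ => Finset.sum_eq_zero fun a _ =>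
      Finset.sum_eq_zero fun b _ => ?_
    simp only [f]
    rw [hP2 a j b, hP1 j a b, hP1 j b a, hP2 j a b]
    simp only [smul_smul, ← add_smul]
    have := koszul_cyclic_jacobi (B.p a) (B.p b) (B.p j) _ _ _ (B.jacobi l a b j)
    convert zero_smul ℂ _
    rw [← this]
    simp only [t]
    rw [koszul_comm (B.p a + 1) (B.p b + 1)]
    ring
  exact (smul_eq_zero.1 h3).resolve_left (by norm_num)

/-- Since `q_l` is a multiple of the bracket of `d` with `ψ_l`, this expresses that `d` squares to
zero on `ψ_l`. By the Leibniz rule there are two halves, each equal to `-½ r_l`. -/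
theorem d_q (l : I) : Br S B.d (B.q l) 0 := by
  have hψq : ∀ i j, Br S (B.ψ j) (B.q i) 0 := fun i j =>
    br_q_zero (B.ψ_mem j) i fun a _ => B.ψψ j a
  have hqψ : ∀ i j, Br S (B.q i) (B.ψ j) 0 := fun i j =>
    (hψq i j).symm_zero (B.ψ_mem j) (B.q_mem i)
  have h1 : ∀ i j, Br S B.d (B.ψ i ⊙ B.ψ j) ((-1 / 2 * koszul (B.p i) (B.p j + 1)) •
      (B.ψ j ⊙ B.q i) + (koszul 1 (B.p i + 1) * (-1 / 2)) • (B.ψ i ⊙ B.q j)) := fun i j => by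
    refine (Br.nprod B.d_mem (B.ψ_mem i) (B.ψ_mem j) (Submodule.smul_mem _ _ (B.q_mem i))
      (d_ψ i) (d_ψ j) (((hqψ i j).smul_left _).congr (smul_zero _))).congr ?_
    rw [nprod_smul_left, nprod_smul_right, (hqψ i j).comm (B.q_mem i) (B.ψ_mem j), smul_smul,
      smul_smul]
  refine (Br.sum_right fun i _ => Br.sum_right fun j _ => (h1 i j).smul_right _).congr ?_
  have hr : B.r l = ∑ i, ∑ j, B.c l i j • (B.ψ j ⊙ B.q i) := by
    simp only [r, w, nprod_sum_left, nprod_smul_left]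
  have e1 : ∀ i j, koszul (B.p i) (B.p l) * B.c l i j * (-1 / 2 * koszul (B.p i) (B.p j + 1))
      = -1 / 2 * B.c l i j := fun i j => by
    by_cases hc : B.c l i j = 0
    · simp [hc]
    · rw [B.c_par l i j hc]
      rcases zmod_two_cases (B.p i) with h | h <;> rcases zmod_two_cases (B.p j) with h' | h' <;>
        simp [h, h', zmod_two_one_add_one] <;> ring
  have e2 : ∀ i j, koszul (B.p i) (B.p l) * B.c l i j * (koszul 1 (B.p i + 1) * (-1 / 2))
      = -1 / 2 * B.c l j i := fun i j => by
    rw [B.skew l i j]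
    by_cases hc : B.c l j i = 0
    · simp [hc]
    · rw [B.c_par l j i hc]
      rcases zmod_two_cases (B.p i) with h | h <;> rcases zmod_two_cases (B.p j) with h' | h' <;>
        simp [h, h', zmod_two_one_add_one] <;> ring
  simp only [smul_add, smul_smul, e1, e2, Finset.sum_add_distrib]
  simp only [← smul_smul, ← Finset.smul_sum]
  rw [← hr, Finset.sum_comm, ← hr, r_eq_zero, smul_zero, add_zero]

/-- The BRST field has zero λ-bracket with itself. -/
theorem d_d : Br S B.d B.d 0 := by
  have hYq : ∀ i l, Br S (B.Y i) (B.q l) 0 := fun i l =>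
    br_q_zero (B.Y_mem i) l fun a _ => B.Yψ i a
  have hψw : ∀ a l m, Br S (B.ψ a) (B.w l m) 0 := fun a l m => br_w_zero l m fun j _ => B.ψψ a j
  have hwψ : ∀ a l m, Br S (B.w l m) (B.ψ a) 0 := fun a l m =>
    (hψw a l m).symm_zero (B.ψ_mem a) (B.w_mem l m)
  have hwq : ∀ i l m, Br S (B.w l m) (B.q i) 0 := fun i l m =>
    br_q_zero (B.w_mem l m) i fun a _ => hwψ a l m
  have hYw' : ∀ l m a, Br S (B.w' l m) (B.ψ a) 0 := fun l m a =>
    Br.sum_left_zero fun i _ => Br.smul_left_zero fun _ => B.ψψ i a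
  have hw' : ∀ l m, B.w' l m ∈ (fieldSuper S).part (B.p l + B.p m + 1) := fun l m => by
    refine sum_mem_part fun j _ hc => ?_
    rw [B.c_par l m j (right_ne_zero_of_mul hc), zmod_two_add_add_self]
    exact B.ψ_mem j
  have hYw'_mem : ∀ m, ∑ l, (B.Y l ⊙ B.w' l m) ∈ (fieldSuper S).part (B.p m + 1) := fun m =>
    sum_mem fun l _ => by
      have h := nprod_mem_part (B.Y_mem l) (hw' l m) (-1)
      rwa [← add_assoc, ← add_assoc, CharTwo.add_self_eq_zero, zero_add] at h
  have hφw_mem : ∀ l m, (B.φ l ⊙ B.w l m) ∈ (fieldSuper S).part (B.p m) := fun l m => by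
    have h := nprod_mem_part (B.φ_mem l) (B.w_mem l m) (-1)
    convert h using 2
    rcases zmod_two_cases (B.p l) with h | h <;> rcases zmod_two_cases (B.p m) with h' | h' <;>
      rw [h, h'] <;> rfl
  have hghost : ∀ m, B.ghost m ∈ (fieldSuper S).part (B.p m) := fun m =>
    sum_mem fun l _ => Submodule.smul_mem _ _ (hφw_mem l m)
  have hYψ : ∀ m, Br S (-(B.s m) • ∑ l, B.Y l ⊙ B.w' l m) (B.ψ m) 0 := fun m =>
    Br.smul_left_zero fun _ => Br.sum_left_zero fun l _ =>
      (br_nprod_zero (B.ψ_mem m) ((B.Yψ l m).symm_zero (B.Y_mem l) (B.ψ_mem m))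
        ((hYw' l m m).symm_zero (hw' l m) (B.ψ_mem m)) _).symm_zero (B.ψ_mem m)
        (nprod_mem_part (B.Y_mem l) (hw' l m) _)
  -- If `deg m < deg l`, the `ψ` in `q_m` have degree below `deg l`, so `φ_l` commutes with `q_m`
  -- and reassociation is allowed. Otherwise no `c^l_{mj}` is nonzero and `w l m = 0`. Thus no
  -- double contraction arises.
  have hgq : ∀ l m, B.s l • ((B.φ l ⊙ B.w l m) ⊙ B.q m) = B.s l • (B.φ l ⊙ (B.w l m ⊙ B.q m))
      ∧ Br S (B.s l • (B.φ l ⊙ B.w l m)) (B.q m) 0 := fun l m => by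
    by_cases hd : B.deg m < B.deg l
    · have hφq : Br S (B.φ l) (B.q m) 0 :=
        br_q_zero (B.φ_mem l) m fun j hj => φψ_of_lt (hj.trans hd)
      refine ⟨?_, Br.smul_left_zero fun _ => ?_⟩
      · rw [Br.assoc (B.φ_mem l) (B.w_mem l m) (B.q_mem m) hφq (hwq m l m)]
      · exact (br_nprod_zero (B.q_mem m) (hφq.symm_zero (B.φ_mem l) (B.q_mem m))
          ((hwq m l m).symm_zero (B.w_mem l m) (B.q_mem m)) _).symm_zero (B.q_mem m)
          (hφw_mem l m)
    · have hw0 : B.w l m = 0 := Finset.sum_eq_zero fun j _ => by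
        by_cases hc : B.c l m j = 0
        · rw [hc, zero_smul]
        · have := B.c_deg l m j hc
          have := B.deg_pos j
          lia
      simp only [hw0, nprod_zero_right, nprod_zero_left, smul_zero, true_and]
      exact br_zero_left _
  have h1 : ∀ m, Br S B.d (B.s m • (B.Y m ⊙ B.ψ m))
      (-(∑ l, B.Y l ⊙ (B.w' l m ⊙ B.ψ m)) + (-1 / 2 : ℂ) • (B.Y m ⊙ B.q m)) := fun m => by
    refine ((Br.nprod B.d_mem (B.Y_mem m) (B.ψ_mem m)
      (Submodule.smul_mem _ _ (hYw'_mem m)) (d_Y m) (d_ψ m) (hYψ m)).smul_right _).congr ?_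
    have hs : B.s m * B.s m = 1 := koszul_mul_self _ _
    rw [nprod_smul_left, nprod_smul_right, smul_add, smul_smul, smul_smul, smul_smul, mul_neg, hs,
      neg_smul, one_smul, nprod_sum_left,
      show B.s m * koszul 1 (B.p m) = 1 from hs, one_mul]
    congr 2
    exact Finset.sum_congr rfl fun l _ => Br.assoc (B.Y_mem l) (hw' l m) (B.ψ_mem m)
      (B.Yψ l m) (hYw' l m m)
  have h2 : ∀ m, Br S B.d (B.φ m ⊙ B.q m)
      ((B.Y m ⊙ B.q m) + ∑ l, B.s l • (B.φ l ⊙ (B.w l m ⊙ B.q m))) := fun m => by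
    refine (Br.nprod B.d_mem (B.φ_mem m) (B.q_mem m) (add_mem (B.Y_mem m) (hghost m))
      (d_φ m) (d_q m) (((hYq m m).add_left
        (Br.sum_left_zero fun l _ => (hgq l m).2)).congr (add_zero _))).congr ?_
    rw [nprod_zero_right, smul_zero, add_zero, nprod_add_left, ghost, nprod_sum_left]
    congr 1
    exact Finset.sum_congr rfl fun l _ => by rw [nprod_smul_left, (hgq l m).1]
  refine ((Br.sum_right fun m _ => h1 m).sub_right
    ((Br.sum_right fun m _ => h2 m).smul_right (1 / 2))).congr ?_
  have e1 : ∑ m, ∑ l, (B.Y l ⊙ (B.w' l m ⊙ B.ψ m)) = -∑ l, B.Y l ⊙ B.q l := by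
    rw [Finset.sum_comm, ← Finset.sum_neg_distrib]
    refine Finset.sum_congr rfl fun l _ => ?_
    rw [← nprod_sum_right, sum_w'_ψ, ← neg_one_smul ℂ (B.q l), nprod_smul_right, neg_one_smul]
  -- For each `l` the sum over `m` is `φ_l` times `r l`.
  have e2 : ∑ m, ∑ l, B.s l • (B.φ l ⊙ (B.w l m ⊙ B.q m)) = 0 := by
    rw [Finset.sum_comm]
    refine Finset.sum_eq_zero fun l _ => ?_
    have h := B.r_eq_zero l
    rw [r] at h
    rw [← Finset.smul_sum, ← nprod_sum_right, h, nprod_zero_right, smul_zero]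
  -- Only multiples of `∑ Y_l q_l` remain: `1` from the currents acting on each other, `-½` from the
  -- action on `ψ`, and `-½` from the action on `φ`.
  rw [Finset.sum_add_distrib, Finset.sum_add_distrib, Finset.sum_neg_distrib, e1, e2,
    ← Finset.smul_sum]
  module

end BRST

/-! ## Gradings of the structure constants -/

namespace LieSuperalgebra

variable {g : Type*} [AddCommGroup g] [Module ℂ g] (L : LieSuperalgebra g)

theorem bracket_mem_part {i j : ZMod 2} {a b : g} (ha : a ∈ L.part i) (hb : b ∈ L.part j) :
    L.bracket a b ∈ L.part (i + j) := by
  rw [Superspace.mem_part_iff] at ha hb ⊢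
  rw [← L.bracket_par, ha, hb]
  simp only [map_smul, LinearMap.smul_apply, smul_smul, ← koszul_one_left, koszul_add_right]
  rw [mul_comm]

/-- The cyclic form of the Jacobi identity. -/
theorem jacobi_cyclic {i j r : ZMod 2} {a b c : g} (ha : a ∈ L.part i) (hb : b ∈ L.part j)
    (hc : c ∈ L.part r) :
    koszul i r • L.bracket (L.bracket a b) c + koszul i j • L.bracket (L.bracket b c) a
      + koszul j r • L.bracket (L.bracket c a) b = 0 := by
  have h := L.jacobi i j a ha b hb c
  rw [L.skew _ _ a ha _ (L.bracket_mem_part hb hc), L.skew _ _ b hb _ (L.bracket_mem_part ha hc),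
    L.skew _ _ a ha c hc] at h
  simp only [map_neg, map_smul, LinearMap.neg_apply, LinearMap.smul_apply] at h
  rw [← sub_eq_zero] at h
  rcases zmod_two_cases i with rfl | rfl <;> rcases zmod_two_cases j with rfl | rfl <;>
    rcases zmod_two_cases r with rfl | rfl <;>
    simp [zmod_two_one_add_one] at h ⊢ <;>
    first
    | (rw [← neg_eq_zero, ← h]; module)
    | (rw [← h]; module)

end LieSuperalgebra

namespace ReductionData

variable {g : Type*} [AddCommGroup g] [Module ℂ g] {L : LieSuperalgebra g} (D : ReductionData L)

theorem mem_gr_iff {j : ℤ} {a : g} : a ∈ D.gr j ↔ L.bracket D.x a = ((j : ℂ) / 2) • a :=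
  Module.End.mem_eigenspace_iff

theorem f_mem_gr : D.f ∈ D.gr (-2) := by
  rw [mem_gr_iff, D.bracket_x_f]
  push_cast
  rw [neg_div, div_self two_ne_zero, neg_one_smul]

theorem bracket_mem_gr {p : ZMod 2} {i j : ℤ} {a b : g} (hp : a ∈ L.part p) (ha : a ∈ D.gr i)
    (hb : b ∈ D.gr j) : L.bracket a b ∈ D.gr (i + j) := by
  rw [mem_gr_iff] at ha hb ⊢
  rw [L.jacobi 0 p _ D.x_even a hp, ha, hb, koszul_zero_left, one_smul, map_smul,
    LinearMap.smul_apply, map_smul, ← add_smul]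
  push_cast
  ring_nf

/-- Invariance under `ad x` pairs an eigenvalue only with its negative. In particular `g₊` is
isotropic, so the level `k` disappears from the brackets of its currents. -/
theorem form_eq_zero_of_gr {p : ZMod 2} {i j : ℤ} {a b : g} (hp : a ∈ L.part p) (ha : a ∈ D.gr i)
    (hb : b ∈ D.gr j) (hij : i + j ≠ 0) : D.form a b = 0 := by
  have h := D.form_inv a D.x b
  rw [mem_gr_iff] at ha hb
  rw [L.skew p 0 a hp _ D.x_even, koszul_zero_right, one_smul, ha, hb] at h
  simp only [map_neg, map_smul, LinearMap.neg_apply, LinearMap.smul_apply, smul_eq_mul] at h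
  have hij' : ((i : ℂ) + j) ≠ 0 := by exact_mod_cast hij
  refine (mul_eq_zero.1 (?_ : ((i : ℂ) + j) * D.form a b = 0)).resolve_left hij'
  linear_combination (-2 : ℂ) * h

theorem form_f_eq_zero {j : ℤ} {a : g} (ha : a ∈ D.gr j) (hj : j ≠ 2) : D.form D.f a = 0 :=
  D.form_eq_zero_of_gr D.f_even D.f_mem_gr ha (by lia)

theorem form_f_eq_zero_of_odd {a : g} (ha : a ∈ L.part 1) : D.form D.f a = 0 := by
  have h := D.form_par D.f a
  have hf := D.f_even
  rw [Superspace.mem_part_iff] at hf ha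
  rw [hf, ha, zmod_two_one_val] at h
  simp only [ZMod.val_zero, pow_zero, one_smul, pow_one, map_smul, smul_eq_mul] at h
  linear_combination (-1 / 2 : ℂ) * h

namespace AdaptedBasis

variable {D} {ι : Type*} (E : D.AdaptedBasis ι)

/-- The coordinate functionals are eigenvectors of the transpose of `ad x`; therefore a homogeneous
vector involves only basis vectors of its own degree, and so structure constants respect degrees. -/
theorem repr_bracket_x (v : g) (l : ι) :
    E.u.repr (L.bracket D.x v) l = ((E.deg l : ℂ) / 2) * E.u.repr v l := by
  have h : E.u.coord l ∘ₗ L.bracket D.x = ((E.deg l : ℂ) / 2) • E.u.coord l :=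
    E.u.ext fun i => by
      have := (D.mem_gr_iff).1 (E.mem_gr i)
      by_cases hi : i = l
      · subst hi
        simp [this]
      · simp [this, Finsupp.single_eq_of_ne (Ne.symm hi)]
  exact DFunLike.congr_fun h v

theorem repr_par (v : g) (l : ι) :
    E.u.repr (L.par v) l = (-1 : ℂ) ^ (E.p l).val * E.u.repr v l := by
  have h : E.u.coord l ∘ₗ L.par = ((-1 : ℂ) ^ (E.p l).val) • E.u.coord l :=
    E.u.ext fun i => by
      have := Superspace.mem_part_iff L.toSuperspace |>.1 (E.mem_part i)
      by_cases hi : i = l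
      · subst hi
        simp [this]
      · simp [this, Finsupp.single_eq_of_ne (Ne.symm hi)]
  exact DFunLike.congr_fun h v

theorem deg_eq_of_repr_ne_zero {v : g} {m : ℤ} (hv : v ∈ D.gr m) {l : ι}
    (h : E.u.repr v l ≠ 0) : E.deg l = m := by
  have h1 := E.repr_bracket_x v l
  rw [D.mem_gr_iff.1 hv, map_smul, Finsupp.smul_apply, smul_eq_mul] at h1
  have h2 := mul_right_cancel₀ h h1
  have h3 : (E.deg l : ℂ) = m := by linear_combination (-2 : ℂ) * h2
  exact_mod_cast h3

theorem p_eq_of_repr_ne_zero {v : g} {i : ZMod 2} (hv : v ∈ L.part i) {l : ι}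
    (h : E.u.repr v l ≠ 0) : E.p l = i := by
  have h1 := E.repr_par v l
  rw [(Superspace.mem_part_iff _).1 hv, map_smul, Finsupp.smul_apply, smul_eq_mul] at h1
  have h2 := mul_right_cancel₀ h h1
  rw [← koszul_one_left, ← koszul_one_left] at h2
  rcases zmod_two_cases i with rfl | rfl <;> rcases zmod_two_cases (E.p l) with h' | h' <;>
    rw [h'] at h2 ⊢ <;> norm_num at h2

theorem c_deg {l i j : ι} (h : E.c l i j ≠ 0) : E.deg l = E.deg i + E.deg j :=
  E.deg_eq_of_repr_ne_zero (D.bracket_mem_gr (E.mem_part i) (E.mem_gr i) (E.mem_gr j)) h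

theorem c_par {l i j : ι} (h : E.c l i j ≠ 0) : E.p l = E.p i + E.p j :=
  E.p_eq_of_repr_ne_zero (L.bracket_mem_part (E.mem_part i) (E.mem_part j)) h

theorem c_skew (l i j : ι) : E.c l i j = -(koszul (E.p i) (E.p j) * E.c l j i) := by
  rw [c, L.skew _ _ _ (E.mem_part i) _ (E.mem_part j)]
  simp [c]

/-- Sums against structure constants of `g₊` may be taken over the basis of `g₊`. -/
theorem sum_c [Fintype ι] {M : Type*} [AddCommGroup M] [Module ℂ M] (i j : E.S) (F : ι → M) :
    ∑ l : E.S, E.c l i j • F l = ∑ l, E.c l i j • F l := by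
  refine Fintype.sum_of_injective Subtype.val Subtype.val_injective _ _ (fun l hl => ?_)
    fun _ => rfl
  have hc : E.c l i j = 0 := by
    by_contra hc
    have h := E.c_deg hc
    have h1 := i.2
    have h2 := j.2
    exact hl ⟨⟨l, by lia⟩, rfl⟩
  rw [hc, zero_smul]

theorem sum_c_u [Fintype ι] (i j : E.S) : ∑ l : E.S, E.c l i j • E.u l = L.bracket (E.u i) (E.u j) :=
  (E.sum_c i j E.u).trans (E.u.sum_repr _)

theorem sum_c_c [Fintype ι] (l i j r : E.S) : ∑ m : E.S, E.c l m r * E.c m i j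
    = E.u.repr (L.bracket (L.bracket (E.u i) (E.u j)) (E.u r)) l := by
  rw [← E.sum_c_u]
  simp [map_sum, LinearMap.sum_apply, c, mul_comm]

theorem c_jacobi [Fintype ι] (l i j r : E.S) :
    koszul (E.p i) (E.p r) * ∑ m : E.S, E.c l m r * E.c m i j
      + koszul (E.p i) (E.p j) * ∑ m : E.S, E.c l m i * E.c m j r
      + koszul (E.p j) (E.p r) * ∑ m : E.S, E.c l m j * E.c m r i = 0 := by
  rw [sum_c_c, sum_c_c, sum_c_c]
  have := congrArg (fun v => E.u.repr v l)
    (L.jacobi_cyclic (E.mem_part i) (E.mem_part j) (E.mem_part r))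
  simpa using this

variable (k : ℂ)

theorem phi_mem (i : E.S) : E.phi k i ∈ (fieldSuper (D.super k)).part (E.p i + 1) := by
  rw [Superspace.mem_part_iff, phi, D.par_gh k]
  have h : D.charged.par (E.uPlus i, 0) = (-1 : ℂ) ^ (E.p i + 1).val • (E.uPlus i, 0) := by
    refine Prod.ext (Subtype.ext ?_) ?_
    · change -(L.par (E.u i)) = (-1 : ℂ) ^ (E.p i + 1).val • E.u i
      rw [(Superspace.mem_part_iff _).1 (E.mem_part i), ← koszul_one_left, ← koszul_one_left,
        koszul_add_right, koszul_one_one, mul_neg_one, neg_smul]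
    · simp [charged, Superspace.prod]
  rw [h]
  exact (D.ghL k).map_smul _ _

theorem phiStar_mem (i : E.S) : E.phiStar k i ∈ (fieldSuper (D.super k)).part (E.p i + 1) := by
  rw [Superspace.mem_part_iff, phiStar, D.par_gh k]
  have h : D.charged.par (0, (E.u.coord i).comp D.gPlus.subtype)
      = (-1 : ℂ) ^ (E.p i + 1).val • ((0 : D.gPlus), (E.u.coord i).comp D.gPlus.subtype) := by
    refine Prod.ext ?_ (LinearMap.ext fun v => ?_)
    · simp [charged, Superspace.prod]
    · change -(E.u.repr (L.par v) i) = (-1 : ℂ) ^ (E.p i + 1).val • E.u.repr v i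
      rw [E.repr_par, ← koszul_one_left, ← koszul_one_left,
        koszul_add_right, koszul_one_one, mul_neg_one, neg_smul]
      rfl
  rw [h]
  exact (D.ghL k).map_smul _ _

theorem cur_mem (i : ι) : D.cur k (E.u i) ∈ (fieldSuper (D.super k)).part (E.p i) := by
  rw [Superspace.mem_part_iff, D.par_cur k, (Superspace.mem_part_iff _).1 (E.mem_part i)]
  exact (D.curL k).map_smul _ _

theorem Phi_mem (i : E.S') : E.Phi k i ∈ (fieldSuper (D.super k)).part (E.p i) := by
  rw [Superspace.mem_part_iff, Phi, D.par_ne k]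
  refine Eq.trans ?_ ((D.neL k).map_smul _ _)
  exact congrArg (D.ne k) (Subtype.ext ((Superspace.mem_part_iff _).1 (E.mem_part i)))

theorem br_gh_gh_zero {φ ψ : D.gPlus × Module.Dual ℂ D.gPlus} (h : D.chForm φ ψ = 0) :
    Br (D.super k) (D.gh k φ) (D.gh k ψ) 0 :=
  (br_of_central (D.superComm_gh_gh k φ ψ)).congr (by rw [h, zero_smul])

/-! ### The currents of `g₊` shifted by `f` and by the neutral ghosts. -/

/-- The neutral ghost of `u_i`, with a sign; it is zero unless `u_i ∈ g_{1/2}`. -/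
def neutralPart (i : E.S) : VField (D.Space k) :=
  if h : E.deg i = 1 then koszul 1 (E.p i) • E.Phi k ⟨i, h⟩ else 0

theorem neutralPart_mem (i : E.S) :
    E.neutralPart k i ∈ (fieldSuper (D.super k)).part (E.p i) := by
  rw [neutralPart]
  split_ifs with h
  · exact Submodule.smul_mem _ _ (E.Phi_mem k ⟨i, h⟩)
  · exact zero_mem _

theorem br_neutralPart_zero (i : E.S) {b : VField (D.Space k)}
    (h : ∀ v, Br (D.super k) (D.ne k v) b 0) : Br (D.super k) (E.neutralPart k i) b 0 := by
  rw [neutralPart]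
  split_ifs
  · exact Br.smul_left_zero fun _ => h _
  · exact br_zero_left b

theorem br_zero_neutralPart (i : E.S) {b : VField (D.Space k)}
    (h : ∀ v, Br (D.super k) b (D.ne k v) 0) : Br (D.super k) b (E.neutralPart k i) 0 := by
  rw [neutralPart]
  split_ifs
  · exact Br.smul_right_zero fun _ => h _
  · exact br_zero_right b

/-- A nonzero `(f|[u_i,u_j])` requires doubled degrees with sum `2`, and positivity forces both to
be `1`, so cutting the ghosts off outside `g_{1/2}` loses nothing. It also requires equal parities,
so the two signs cancel. -/
theorem br_neutralPart_neutralPart (i j : E.S) :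
    Br (D.super k) (E.neutralPart k i) (E.neutralPart k j)
      (D.form D.f (L.bracket (E.u i) (E.u j)) • oneField) := by
  have hgr := D.bracket_mem_gr (E.mem_part i) (E.mem_gr i) (E.mem_gr j)
  have hi := i.2
  have hj := j.2
  by_cases h1 : E.deg i = 1
  · by_cases h2 : E.deg j = 1
    · rw [neutralPart, neutralPart, dif_pos h1, dif_pos h2]
      refine (((br_of_central (D.superComm_ne_ne k _ _)).smul_left _).smul_right _).congr ?_
      rw [smul_smul, smul_smul]
      congr 1
      have hpar := L.bracket_mem_part (E.mem_part i) (E.mem_part j)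
      change _ * D.form D.f (L.bracket (E.u i) (E.u j)) = _
      rcases zmod_two_cases (E.p i) with h | h <;> rcases zmod_two_cases (E.p j) with h' | h' <;>
        rw [h, h'] at hpar ⊢
      · simp
      · rw [D.form_f_eq_zero_of_odd (by simpa using hpar), mul_zero]
      · rw [D.form_f_eq_zero_of_odd (by simpa using hpar), mul_zero]
      · simp
    · rw [D.form_f_eq_zero hgr (by lia), zero_smul, show E.neutralPart k j = 0 from dif_neg h2]
      exact br_zero_right _
  · rw [D.form_f_eq_zero hgr (by lia), zero_smul, show E.neutralPart k i = 0 from dif_neg h1]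
    exact br_zero_left _

/-- The current `u_i + (f|u_i) ± Φ_i`, the shift of `u_i` by the neutral ghosts. -/
def shifted (i : E.S) : VField (D.Space k) :=
  D.cur k (E.u i) + D.form D.f (E.u i) • oneField + E.neutralPart k i

theorem shifted_mem (i : E.S) : E.shifted k i ∈ (fieldSuper (D.super k)).part (E.p i) := by
  refine add_mem (add_mem (E.cur_mem k i) ?_) (E.neutralPart_mem k i)
  rcases zmod_two_cases (E.p i) with h | h
  · rw [h]
    exact Submodule.smul_mem _ _ oneField_mem_part
  · rw [D.form_f_eq_zero_of_odd (h ▸ E.mem_part i), zero_smul]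
    exact zero_mem _

theorem br_shifted_gh (i : E.S) (φ : D.gPlus × Module.Dual ℂ D.gPlus) :
    Br (D.super k) (E.shifted k i) (D.gh k φ) 0 := by
  have h1 : Br (D.super k) (D.cur k (E.u i)) (D.gh k φ) 0 := fun m n =>
    D.superComm_cur_gh k _ _ m n
  have h2 : Br (D.super k) (D.form D.f (E.u i) • oneField) (D.gh k φ) 0 :=
    Br.smul_left_zero fun _ => br_oneField_left _
  have h3 := E.br_neutralPart_zero k i (b := D.gh k φ) fun v m n => D.superComm_ne_gh k _ _ m n
  exact ((h1.add_left h2).add_left h3).congr (by simp)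

variable [Fintype ι]

/-- The currents close on `[u_i,u_j]` without central term because `g₊` is isotropic, and the
neutral ghosts supply the scalar `(f|[u_i,u_j])`, which is the shift required for that bracket. -/
theorem br_shifted_shifted (i j : E.S) :
    Br (D.super k) (E.shifted k i) (E.shifted k j) (∑ l : E.S, E.c l i j • E.shifted k l) := by
  have hone : ∀ (r : ℂ) {a : VField (D.Space k)} {p : ZMod 2},
      a ∈ (fieldSuper (D.super k)).part p → Br (D.super k) a (r • oneField) 0 := fun r a p ha =>
    Br.smul_right_zero fun _ => (br_oneField_left a).symm_zero oneField_mem_part ha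
  have hi := i.2
  have hj := j.2
  have h1 : Br (D.super k) (D.cur k (E.u i)) (D.cur k (E.u j))
      (D.cur k (L.bracket (E.u i) (E.u j))) := fun m n => by
    rw [D.superComm_cur_cur, D.form_eq_zero_of_gr (E.mem_part i) (E.mem_gr i) (E.mem_gr j)
      (by lia), mul_zero, mul_zero, ite_self, zero_smul, add_zero]
  have h2 := (((h1.add_right (hone (D.form D.f (E.u j)) (E.cur_mem k i))).add_right
    (E.br_zero_neutralPart k j fun v m n => D.superComm_cur_ne k _ _ m n)).add_left
    (Br.smul_left_zero (r := D.form D.f (E.u i)) fun _ =>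
      br_oneField_left (E.shifted k j))).add_left
    (((E.br_neutralPart_zero k i fun v m n => D.superComm_ne_cur k (E.u j) v m n).add_right
      (hone (D.form D.f (E.u j)) (E.neutralPart_mem k i))).add_right
      (E.br_neutralPart_neutralPart k i j))
  refine h2.congr ?_
  have e1 : ∀ l : E.S, E.c l i j • E.shifted k l
      = E.c l i j • D.curL k (E.u l) + (E.c l i j * D.form D.f (E.u l)) • oneField := fun l => by
    by_cases hc : E.c l i j = 0
    · simp [hc]
    -- A vector occurring in `[u_i,u_j]` has doubled degree at least `2`, hence no neutral part.
    · have hd := E.c_deg hc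
      rw [shifted, show E.neutralPart k l = 0 from dif_neg (by lia), add_zero, smul_add, smul_smul]
      rfl
  have e2 : ∑ l : E.S, E.c l i j • D.curL k (E.u l) = D.cur k (L.bracket (E.u i) (E.u j)) := by
    rw [← E.sum_c_u]
    exact ((map_sum (D.curL k) _ _).trans
      (Finset.sum_congr rfl fun l _ => map_smul (D.curL k) _ _)).symm
  have e3 : ∑ l : E.S, E.c l i j * D.form D.f (E.u l)
      = D.form D.f (L.bracket (E.u i) (E.u j)) := by
    rw [← E.sum_c_u, map_sum]
    exact Finset.sum_congr rfl fun l _ => (map_smul (D.form D.f) _ _).symm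
  rw [Finset.sum_congr rfl fun l _ => e1 l, Finset.sum_add_distrib, ← Finset.sum_smul, e2, e3]
  simp only [add_zero, zero_add]

/-- The structure constants of `g₊` with the shifted currents and the charged ghosts. -/
def brst : BRST (D.super k) E.S where
  p i := E.p i
  deg i := E.deg i
  deg_pos i := i.2
  c l i j := E.c l i j
  c_deg _ _ _ := E.c_deg
  c_par _ _ _ := E.c_par
  skew l i j := E.c_skew l i j
  jacobi := E.c_jacobi
  Y := E.shifted k
  φ := E.phi k
  ψ := E.phiStar k
  Y_mem := E.shifted_mem k
  φ_mem := E.phi_mem k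
  ψ_mem := E.phiStar_mem k
  YY := E.br_shifted_shifted k
  Yφ i j := E.br_shifted_gh k i _
  Yψ i j := E.br_shifted_gh k i _
  φφ i j := br_gh_gh_zero k (by simp [chForm])
  ψψ i j := br_gh_gh_zero k (by simp [chForm])
  φψ_self i := (br_of_central (D.superComm_gh_gh k _ _)).congr (by simp [chForm, uPlus])
  φψ_of_ne i j h := br_gh_gh_zero k (by
    simp [chForm, uPlus, Finsupp.single_eq_of_ne fun e => h (Subtype.ext e.symm)])

/-- The terms linear in `φ*` and those with neutral ghosts are the contributions of the shift to `∑
± Y_i φ*_i`. The sign in `neutralPart` is chosen to cancel the sign in this sum. -/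
theorem d_eq : E.d k = (E.brst k).d := by
  -- For the same index `φ*_i` and `Φ_i` have opposite parities, so one of them is even and the
  -- exchange costs no sign.
  have hcomm : ∀ i : E.S', nprod (D.super k) (E.Phi k i) (-1) (E.phiStar k (E.incl i))
      = nprod (D.super k) (E.phiStar k (E.incl i)) (-1) (E.Phi k i) := fun i => by
    have h : Br (D.super k) (E.Phi k i) (E.phiStar k (E.incl i)) 0 := fun m n =>
      D.superComm_ne_gh k _ _ m n
    rw [h.comm (E.Phi_mem k i) (E.phiStar_mem k _)]
    convert one_smul ℂ _
    change koszul (E.p i) (E.p i + 1) = 1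
    rcases zmod_two_cases (E.p i) with h | h <;> simp [h, zmod_two_one_add_one]
  have e1 : ∑ i : E.S', nprod (D.super k) (E.phiStar k (E.incl i)) (-1) (E.Phi k i)
      = ∑ i : E.S, koszul 1 (E.p i) • nprod (D.super k) (E.neutralPart k i) (-1)
        (E.phiStar k i) := by
    refine Fintype.sum_of_injective E.incl (fun i j h => Subtype.ext (congrArg (fun x : E.S => (x : ι)) h)) _ _
      (fun i hi => ?_) fun i => ?_
    · rw [neutralPart, dif_neg fun h => hi ⟨⟨i, h⟩, rfl⟩, nprod_zero_left, smul_zero]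
    · rw [neutralPart, dif_pos (show E.deg (E.incl i) = 1 from i.2), nprod_smul_left, smul_smul,
        koszul_mul_self, one_smul]
      exact (hcomm i).symm
  have e2 : ∑ i : E.S, D.form D.f (E.u i) • E.phiStar k i
      = ∑ i : E.S, koszul 1 (E.p i) • nprod (D.super k) (D.form D.f (E.u i) • oneField) (-1)
        (E.phiStar k i) := by
    -- The extra sign is harmless because `(f|u_i) = 0` for odd `u_i`.
    refine Finset.sum_congr rfl fun i _ => ?_
    rw [nprod_smul_left, nprod_oneField_left, if_pos rfl, smul_smul]
    rcases zmod_two_cases (E.p i) with h | h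
    · rw [h, koszul_zero_right, one_mul]
    · rw [D.form_f_eq_zero_of_odd (h ▸ E.mem_part i), mul_zero]
  have e3 : ∑ i : E.S, ∑ j : E.S, ∑ l : E.S,
      ((-1 : ℂ) ^ ((E.p i).val * (E.p l).val) * E.c l i j) •
        nprod (D.super k) (E.phi k l) (-1)
          (nprod (D.super k) (E.phiStar k i) (-1) (E.phiStar k j))
      = ∑ l, nprod (D.super k) ((E.brst k).φ l) (-1) ((E.brst k).q l) := by
    simp only [BRST.q, nprod_sum_right, nprod_smul_right]
    rw [Finset.sum_congr rfl fun i _ => Finset.sum_comm, Finset.sum_comm]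
    rfl
  have e4 : ∑ i, (E.brst k).s i • nprod (D.super k) ((E.brst k).Y i) (-1) ((E.brst k).ψ i)
      = ∑ i : E.S, (-1 : ℂ) ^ (E.p i).val • nprod (D.super k) (D.cur k (E.u i)) (-1)
          (E.phiStar k i)
        + ∑ i : E.S, koszul 1 (E.p i) • nprod (D.super k) (D.form D.f (E.u i) • oneField) (-1)
          (E.phiStar k i)
        + ∑ i : E.S, koszul 1 (E.p i) • nprod (D.super k) (E.neutralPart k i) (-1)
          (E.phiStar k i) := by
    rw [← Finset.sum_add_distrib, ← Finset.sum_add_distrib]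
    refine Finset.sum_congr rfl fun i _ => ?_
    rw [← koszul_one_left, ← smul_add, ← smul_add, ← nprod_add_left, ← nprod_add_left]
    rfl
  rw [d, BRST.d, e1, e2, e3, e4]
  abel

theorem br_d_d : Br (D.super k) (E.d k) (E.d k) 0 := by
  rw [d_eq]
  exact BRST.d_d

theorem d_mem_part : E.d k ∈ (fieldSuper (D.super k)).part 1 := by
  rw [d_eq]
  exact BRST.d_mem

theorem d_mem_Cm : E.d k ∈ D.Cm k (-1) := by
  have hψ : ∀ i, E.phiStar k i ∈ D.Cm k (-1) := fun i =>
    Generated.gen (Or.inr (Or.inr (Or.inl ⟨rfl, _, rfl⟩)))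
  have hφ : ∀ i, E.phi k i ∈ D.Cm k 1 := fun i => Generated.gen (Or.inr (Or.inl ⟨rfl, _, rfl⟩))
  have hu : ∀ u, D.cur k u ∈ D.Cm k 0 := fun u => Generated.gen (Or.inl ⟨rfl, u, rfl⟩)
  have hΦ : ∀ i, E.Phi k i ∈ D.Cm k 0 := fun i =>
    Generated.gen (Or.inr (Or.inr (Or.inr ⟨rfl, _, rfl⟩)))
  refine add_mem (add_mem (sub_mem (sum_mem fun i _ => Submodule.smul_mem _ _ ?_)
    (Submodule.smul_mem _ _ (sum_mem fun i _ => sum_mem fun j _ => sum_mem fun l _ =>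
      Submodule.smul_mem _ _ ?_))) (sum_mem fun i _ => Submodule.smul_mem _ _ (hψ i)))
    (sum_mem fun i _ => ?_)
  · exact nprod_mem_chargePart (hu _) (hψ i) (-1)
  · exact nprod_mem_chargePart (hφ l) (nprod_mem_chargePart (hψ i) (hψ j) (-1)) (-1)
  · exact nprod_mem_chargePart (hψ _) (hΦ i) (-1)

end AdaptedBasis

end ReductionData

/-! ## The differential and its homology -/

namespace ReductionData

namespace AdaptedBasis

variable {g : Type*} [AddCommGroup g] [Module ℂ g] {L : LieSuperalgebra g} {D : ReductionData L}
  {ι : Type*} [Fintype ι] (E : D.AdaptedBasis ι) (k : ℂ)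

theorem lambdaBracket_d_d : lambdaBracket (D.super k) (E.d k) (E.d k) = 0 := funext fun n => by
  have h : bracketModes (D.super k) (E.d k) (E.d k) = 0 :=
    funext fun p => funext fun q => E.br_d_d k p q
  have h' : nprod (D.super k) (E.d k) n (E.d k) = 0 := field_ext fun m => by
    rw [ncoeff_nprod_natCast, h, map_zero]
    rfl
  rw [lambdaBracket, h', smul_zero]
  rfl

theorem d0_mem : E.d0 k ∈ (D.super k).endo.part 1 := mem_field_part.1 (E.d_mem_part k) 0

/-- For an odd operator the supercommutator with itself is twice its square, and here it is a mode
of the zero field. -/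
theorem d0_mul_d0 : E.d0 k * E.d0 k = 0 := by
  have h : (D.super k).superComm (E.d0 k) (E.d0 k) = 0 := E.br_d_d k 0 0
  rw [Superspace.superComm_of_mem_mem (E.d0_mem k) (E.d0_mem k), koszul_one_one, neg_one_smul,
    sub_neg_eq_add, ← two_smul ℂ] at h
  exact (smul_eq_zero.1 h).resolve_left two_ne_zero

/-- The differential is itself a product with `d`; stability of `C` and the shift of charge by `-1`
follow at once. -/
theorem diff_eq_nprod (a : VField (D.Space k)) :
    E.diff k a = nprod (D.super k) (E.d k) 0 a := (nprod_zero_eq_adField _ _ _).symm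

theorem diff_diff (a : VField (D.Space k)) : E.diff k (E.diff k a) = 0 :=
  field_ext fun n => Superspace.superComm_superComm_self (E.d0_mem k) (E.d0_mul_d0 k) (ncoeff a n)

theorem diff_mem_C {a : VField (D.Space k)} (ha : a ∈ D.C k) : E.diff k a ∈ D.C k := by
  rw [diff_eq_nprod]
  exact nprod_mem_closure (D.Cm_le_C k _ (E.d_mem_Cm k)) ha 0

theorem diff_mem_Cm {m : ℤ} {a : VField (D.Space k)} (ha : a ∈ D.Cm k m) :
    E.diff k a ∈ D.Cm k (m - 1) := by
  rw [diff_eq_nprod, sub_eq_neg_add]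
  exact nprod_mem_chargePart (E.d_mem_Cm k) ha 0

theorem diff_mem_part {i : ZMod 2} {a : VField (D.Space k)}
    (ha : a ∈ (fieldSuper (D.super k)).part i) :
    E.diff k a ∈ (fieldSuper (D.super k)).part (i + 1) :=
  add_comm 1 i ▸ adField_mem_part (E.d0_mem k) ha

theorem diff_nprod {i : ZMod 2} {a : VField (D.Space k)}
    (ha : a ∈ (fieldSuper (D.super k)).part i) (b : VField (D.Space k)) (n : ℤ) :
    E.diff k (nprod (D.super k) a n b) = nprod (D.super k) (E.diff k a) n b
      + (-1 : ℂ) ^ i.val • nprod (D.super k) a n (E.diff k b) := by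
  have ha' : ∀ n, ncoeff ((-1 : ℂ) ^ i.val • a) n = (D.super k).tw 1 (ncoeff a n) := fun n => by
    rw [Superspace.tw_of_mem 1 (mem_field_part.1 ha n), koszul_one_left, ncoeff_smul]
  rw [← nprod_smul_left]
  exact adField_nprod (E.d0_mem k) ha' b n

/-- Parity and the differential anticommute, which still makes the kernel and the image stable under
parity. -/
theorem par_diff (a : VField (D.Space k)) : (fieldSuper (D.super k)).par (E.diff k a)
    = -E.diff k ((fieldSuper (D.super k)).par a) := by
  have hd := (Superspace.mem_part_iff _).1 (E.d_mem_part k)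
  rw [diff_eq_nprod, diff_eq_nprod, par_nprod, hd, nprod_smul_left, zmod_two_one_val, pow_one,
    neg_one_smul]

theorem par_mem_Cm (m : ℤ) : ∀ a ∈ D.Cm k m, (fieldSuper (D.super k)).par a ∈ D.Cm k m :=
  par_mem_chargePart (D.par_mem_gens k)

theorem diff_of_mem_Z {a : VField (D.Space k)} (ha : a ∈ E.Z k) : E.diff k a = 0 := ha.2

/-! ### Cycles, boundaries and the homology vertex algebra. -/

theorem oneField_mem_Z : oneField ∈ E.Z k :=
  ⟨Generated.one, by
    change E.diff k oneField = 0
    rw [diff_eq_nprod]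
    exact nprod_natCast_oneField (S := D.super k) (E.d k) 0⟩

theorem par_mem_Z : ∀ a ∈ E.Z k, (fieldSuper (D.super k)).par a ∈ E.Z k := fun a ha =>
  ⟨par_mem_Cm k 0 a ha.1, by
    have h := E.par_diff k a
    rw [E.diff_of_mem_Z k ha, map_zero] at h
    exact neg_eq_zero.1 h.symm⟩

theorem nprod_mem_Z : ∀ a ∈ E.Z k, ∀ b ∈ E.Z k, ∀ n : ℤ, nprod (D.super k) a n b ∈ E.Z k := by
  intro a ha b hb n
  refine hom_induction_on (T := fieldSuper (D.super k)) (E.par_mem_Z k)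
    (p := fun a => nprod (D.super k) a n b ∈ E.Z k) (fun a a' h h' => ?_) (fun i a ha hi => ?_) ha
  · rw [nprod_add_left]
    exact add_mem h h'
  · refine ⟨nprod_mem_chargePart ha.1 hb.1 n, ?_⟩
    change E.diff k (nprod (D.super k) a n b) = 0
    rw [E.diff_nprod k hi, E.diff_of_mem_Z k ha, E.diff_of_mem_Z k hb,
      nprod_zero_left, nprod_zero_right, smul_zero, add_zero]

theorem par_mem_B : ∀ a ∈ E.B k, (fieldSuper (D.super k)).par a ∈ E.B k := by
  rintro _ ⟨c, hc, rfl⟩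
  rw [par_diff]
  exact neg_mem (Submodule.mem_map_of_mem (par_mem_Cm k 1 c hc))

/-- For a homogeneous cycle `a`, the derivation rule makes the product of `a` with the differential
of `c` equal, up to sign, to the differential of the product of `a` and `c`. -/
theorem nprod_mem_B_right {a b : VField (D.Space k)} (ha : a ∈ E.Z k) (hb : b ∈ E.B k) (n : ℤ) :
    nprod (D.super k) a n b ∈ E.B k := by
  obtain ⟨c, hc, rfl⟩ := hb
  refine hom_induction_on (T := fieldSuper (D.super k)) (E.par_mem_Z k)
    (p := fun a => nprod (D.super k) a n (E.diff k c) ∈ E.B k) (fun a a' h h' => ?_)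
    (fun i a ha hi => ?_) ha
  · rw [nprod_add_left]
    exact add_mem h h'
  · have h := E.diff_nprod k hi c n
    rw [E.diff_of_mem_Z k ha, nprod_zero_left, zero_add] at h
    have h1 : E.diff k (nprod (D.super k) a n c) ∈ E.B k :=
      Submodule.mem_map_of_mem (nprod_mem_chargePart ha.1 hc n)
    rw [h] at h1
    exact (Submodule.smul_mem_iff _ (pow_ne_zero _ (neg_ne_zero.2 one_ne_zero))).1 h1

theorem nprod_mem_B_left {a b : VField (D.Space k)} (ha : a ∈ E.B k) (hb : b ∈ E.Z k) (n : ℤ) :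
    nprod (D.super k) a n b ∈ E.B k := by
  obtain ⟨c, hc, rfl⟩ := ha
  refine hom_induction_on (T := fieldSuper (D.super k)) (par_mem_Cm k 1)
    (p := fun c => nprod (D.super k) (E.diff k c) n b ∈ E.B k) (fun a a' h h' => ?_)
    (fun i c hc hi => ?_) hc
  · rw [map_add, nprod_add_left]
    exact add_mem h h'
  · have h := E.diff_nprod k hi b n
    rw [E.diff_of_mem_Z k hb, nprod_zero_right, smul_zero, add_zero] at h
    rw [← h]
    exact Submodule.mem_map_of_mem (nprod_mem_chargePart hc hb.1 n)

/-- The homology is a vertex algebra. -/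
theorem exists_vertexAlgebra_Wk : ∃ A : VertexAlgebra (E.Wk k),
    (∃ v : E.Z k, (v : VField (D.Space k)) = oneField ∧ A.vac = E.cls k v) ∧
    (∀ a : E.Z k, ∃ c : E.Z k, (c : VField (D.Space k)) = (fieldSuper (D.super k)).par a ∧
      A.par (E.cls k a) = E.cls k c) ∧
    ∀ (a b : E.Z k) (n : ℤ), ∃ c : E.Z k,
      (c : VField (D.Space k)) = nprod (D.super k) a n b ∧
      ncoeff (A.Y (E.cls k a)) n (E.cls k b) = E.cls k c := by
  have hZC : E.Z k ≤ D.C k := inf_le_left.trans (D.Cm_le_C k 0)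
  obtain ⟨A, hvac, hpar, hT, hY⟩ := exists_vertexAlgebra (E.oneField_mem_Z k) (E.par_mem_Z k)
    (E.nprod_mem_Z k) fun a ha b hb => D.C_local k a (hZC ha) b (hZC hb)
  obtain ⟨A', hvac', hpar', hY'⟩ := exists_vertexAlgebra_quotient A ((E.B k).comap (E.Z k).subtype)
    (fun a ha => by
      rw [Submodule.mem_comap, Submodule.subtype_apply, hpar]
      exact E.par_mem_B k a ha)
    (fun a ha => by
      rw [Submodule.mem_comap, Submodule.subtype_apply, hT]
      -- Translation is the product `a_(-2) 1` and the identity field is a cycle, so its stability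
      -- is a case of the ideal property.
      exact E.nprod_mem_B_left k ha (E.oneField_mem_Z k) _)
    (fun a ha b n => by
      rw [Submodule.mem_comap, Submodule.subtype_apply, hY]
      exact E.nprod_mem_B_left k ha b.2 n)
    (fun a b hb n => by
      rw [Submodule.mem_comap, Submodule.subtype_apply, hY]
      exact E.nprod_mem_B_right k a.2 hb n)
  exact ⟨A', ⟨A.vac, hvac, hvac'⟩, fun a => ⟨A.par a, hpar a, hpar' a⟩,
    fun a b n => ⟨ncoeff (A.Y a) n b, hY a b n, hY' a b n⟩⟩

end AdaptedBasis

end ReductionData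

end QRed

end

theorem theorem2p1 {g : Type*} [AddCommGroup g] [Module ℂ g] [FiniteDimensional ℂ g]
    (L : QRed.LieSuperalgebra g) (hL : L.IsSimple) (D : QRed.ReductionData L) (k : ℂ)
    {ι : Type*} [Fintype ι] (E : D.AdaptedBasis ι) :
    -- `C` is a vertex algebra with the `n`-th products of fields
    (∃ A : QRed.VertexAlgebra (D.C k),
      (A.vac : QRed.VField (D.Space k)) = QRed.oneField ∧
      (∀ a, (A.par a : QRed.VField (D.Space k)) = (QRed.fieldSuper (D.super k)).par a) ∧
      ∀ a b n, (QRed.ncoeff (A.Y a) n b : QRed.VField (D.Space k))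
        = QRed.nprod (D.super k) a n b) ∧
    -- `C` is the direct sum of its charge components, and `d` is an odd field of charge `-1` in `C`
    iSupIndep (D.Cm k) ∧ (⨆ m, D.Cm k m) = D.C k ∧
    E.d k ∈ D.C k ∧ E.d k ∈ D.Cm k (-1) ∧ E.d k ∈ (QRed.fieldSuper (D.super k)).part 1 ∧
    -- `[d_λ d] = 0`
    QRed.lambdaBracket (D.super k) (E.d k) (E.d k) = 0 ∧
    -- `d₀² = 0`, and `[d₀, ·]` is an odd derivation of all `n`-th products of square zero on `C`
    -- that maps `C_m` to `C_{m-1}`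
    E.d0 k * E.d0 k = 0 ∧
    (∀ a ∈ D.C k, E.diff k a ∈ D.C k) ∧
    (∀ a ∈ D.C k, E.diff k (E.diff k a) = 0) ∧
    (∀ m, ∀ a ∈ D.Cm k m, E.diff k a ∈ D.Cm k (m - 1)) ∧
    (∀ i, ∀ a ∈ D.C k, a ∈ (QRed.fieldSuper (D.super k)).part i →
      E.diff k a ∈ (QRed.fieldSuper (D.super k)).part (i + 1) ∧
      ∀ b ∈ D.C k, ∀ n, E.diff k (QRed.nprod (D.super k) a n b)
        = QRed.nprod (D.super k) (E.diff k a) n b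
          + (-1 : ℂ) ^ i.val • QRed.nprod (D.super k) a n (E.diff k b)) ∧
    -- the `0`-th homology is a vertex algebra, with the operations induced from `C`
    (∃ A : QRed.VertexAlgebra (E.Wk k),
      (∃ v : E.Z k, (v : QRed.VField (D.Space k)) = QRed.oneField ∧ A.vac = E.cls k v) ∧
      (∀ a : E.Z k, ∃ c : E.Z k, (c : QRed.VField (D.Space k))
        = (QRed.fieldSuper (D.super k)).par a ∧ A.par (E.cls k a) = E.cls k c) ∧
      ∀ (a b : E.Z k) (n : ℤ), ∃ c : E.Z k, (c : QRed.VField (D.Space k))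
        = QRed.nprod (D.super k) a n b ∧
        QRed.ncoeff (A.Y (E.cls k a)) n (E.cls k b) = E.cls k c) := by
  obtain ⟨A, hvac, hpar, -, hY⟩ := QRed.exists_vertexAlgebra (S := D.super k) (P := D.C k)
    (QRed.oneField_mem_closure _) (D.par_mem_C k)
    (fun a ha b hb n => QRed.nprod_mem_closure ha hb n) (D.C_local k)
  exact ⟨⟨A, hvac, hpar, hY⟩, D.iSupIndep_Cm k, D.iSup_Cm k, D.Cm_le_C k _ (E.d_mem_Cm k),
    E.d_mem_Cm k, E.d_mem_part k, E.lambdaBracket_d_d k, E.d0_mul_d0 k,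
    fun a ha => E.diff_mem_C k ha, fun a _ => E.diff_diff k a, fun m a ha => E.diff_mem_Cm k ha,
    fun i a _ hi => ⟨E.diff_mem_part k hi, fun b _ n => E.diff_nprod k hi b n⟩,
    E.exists_vertexAlgebra_Wk k⟩
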